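/- **Notation.** $b(x)=x-x^{-1}$, $[X,Y]_q=qXY-q^{-1}YX$, $[n]_q=\frac{q^n-q^{-n}}{q-q^{-1}}$, $(a;q)_n=\prod_{k=0}^{n-1}(1-aq^k)$. **Parameters.** Let $s\in\frac12\mathbb Z_{\ge 0}$, let $q\in\mathbb C^*$ be not a root of unity, with a fixed square root $q^{1/2}$, and let $r_0,\zeta,\mathrm b,\mathrm c,\mathrm b^*,\mathrm c^*,\mathrm b^\diamond,\mathrm c^\diamond\in\mathbb C^*$ satisfy $r_0^{-2}=\mathrm b\mathrm c=\mathrm b^*\mathrm c^*=\mathrm b^\diamond\mathrm c^\diamond$, $\zeta^{-2}=\mathrm b^\diamond r_0q^{2s}$, $\zeta^2=\mathrm c^\diamond r_0q^{-2s}$. Put $\theta^a_M=\mathrm b^aq^{2M}+\mathrm c^aq^{-2M}$ for $a\in\{\cdot,*,\diamond\}$ (also for $M=s$), $$\omega^{\{a,b,c\}}=-(q-q^{-1})^2\Big(\theta^a_s\theta^b_s-r_0^{-1}(q^{2s+1}+q^{-2s-1})\theta^c_s\Big),$$ $\rho=-(q^2-q^{-2})^2r_0^{-2}$, $\omega=\omega^{\{\cdot,*,\diamond\}}$,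 $\eta=\frac{q+q^{-1}}{r_0}\omega^{\{\cdot,\diamond,*\}}$, $\eta^*=\frac{q+q^{-1}}{r_0}\omega^{\{*,\diamond,\cdot\}}$. **Leonard pair.** Let $(A,A^*)$ be a Leonard pair on a complex vector space $\mathcal V$ of dimension $2s+1$: the numbers $\theta_0,\dots,\theta_{2s}$ are distinct, the numbers $\theta^*_0,\dots,\theta^*_{2s}$ are distinct, there is a basis in which $A=\mathrm{diag}(\theta_0,\dots,\theta_{2s})$ and $A^*$ is irreducible tridiagonal, and there is a basis in which $A^*=\mathrm{diag}(\theta_0^*,\dots,\theta_{2s}^*)$ and $A$ is irreducible tridiagonal. Assume the Askey–Wilson relations $$[A,[A,A^*]_q]_{q^{-1}}=\rho A^*+\omega A+\eta,\qquad [A^*,[A^*,A]_q]_{q^{-1}}=\rho A+\omega A^*+\eta^*.$$ A *normalized eigenbasis* $|\theta_0\rangle,\dots,|\theta_{2s}\rangle$ of $A$ is a basis with $A|\theta_M\rangle=\theta_M|\theta_M\rangle$ and $A^*|\theta_M\rangle=A_{M+1,M}|\theta_{M+1}\rangle+A_{M,M}|\theta_M\rangle+A_{M-1,M}|\theta_{M-1}\rangle$,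 where for $1\le M\le 2s$ $$A_{M,M-1}=q^{2-4s}\frac{(1-q^{2M})(\mathrm c-\mathrm bq^{2M+4s})(\mathrm b^*\mathrm b^\diamond r_0q^{4s-1}+\mathrm bq^{2M-2})(\mathrm c\,\mathrm c^\diamond r_0q^{-1}+\mathrm c^*q^{2M-2})}{(\mathrm c-\mathrm bq^{4M-2})(\mathrm c-\mathrm bq^{4M})},$$ $$A_{M-1,M}=\frac{(1-q^{2M-4s-2})(\mathrm c-\mathrm bq^{2M-2})(\mathrm c+\mathrm b^*\mathrm b^\diamond r_0q^{2M+4s-1})(\mathrm c^*+\mathrm b\mathrm c^\diamond r_0q^{2M-1})}{(\mathrm c-\mathrm bq^{4M-4})(\mathrm c-\mathrm bq^{4M-2})},$$ $A_{M,M}=\theta_0^*-A_{M,M+1}-A_{M,M-1}$ and $A_{0,-1}=A_{-1,0}=A_{2s,2s+1}=A_{2s+1,2s}=0$ (the equal factors in numerator and denominator of $A_{2s,2s-1}$ and of $A_{0,1}$ are cancelled). Let $\langle\theta_M|$ be eigen-covectors of $A$ with $\langle\theta_{M}|\theta_{M'}\rangle=\delta_{MM'}\xi_M$, $\xi_M\ne0$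 arbitrary. **Bethe states.** For $m_0\in\mathbb Z$ and $\alpha,\chi\in\mathbb C$, $\chi\neq0$, with $(q^2-q^{-2})\chi^{-1}\alpha\,\mathrm b\,q^{-m_0}=-1$ put $$|\Psi_-^{2s}(u_1,\dots,u_{2s})\rangle=\mathscr B^-(u_1,m_0+2(2s-1))\cdots\mathscr B^-(u_{2s},m_0)|\theta_0\rangle,$$ where (the dynamical operator at $\beta=0$) $$\mathscr B^-(u,m)=\frac{b(u^2)q^{2m+3}}{\alpha}\Big(\frac{u\chi q^{-m-1}}{\rho}[A^*,A]_q+\frac{q^{-m-2}\chi}{\rho\, b(q^2)}\big(\rho(q^2u^3+u^{-1})+(q^2+1)u\,\omega\big)\Big),$$ and let $X_M(\bar u)=\langle\theta_M|\Psi_-^{2s}(\bar u)\rangle/\langle\theta_M|\theta_M\rangle$. **Inhomogeneous Bethe roots.** Let $$f(u,v)=\frac{b(qv/u)b(uv)}{b(v/u)b(quv)},\qquad h(u,v)=\frac{b(q^2uv)b(qu/v)}{b(quv)b(u/v)},$$ $$\Lambda_1(u)=q^{-2s-1}u\,(q^{2s+1}u\zeta^{-1}-u^{-1}\zeta)(q^{2s+1}u\zeta-u^{-1}\zeta^{-1})(u\mathrm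 c^*q^{-2s}+u^{-1}\mathrm bq^{2s})(u\tfrac{\mathrm c}{\mathrm c^*}+u^{-1}),$$ $$\Lambda_2(u)=\tfrac{(u^2-u^{-2})q^{-2s-1}u}{qu^2-q^{-1}u^{-2}}(q^{2s-1}u^{-1}\zeta-u\zeta^{-1})(q^{2s-1}u^{-1}\zeta^{-1}-u\zeta)(q^2u\mathrm bq^{2s}+u^{-1}\mathrm c^*q^{-2s})(q^2u+u^{-1}\tfrac{\mathrm c}{\mathrm c^*}),$$ $$E_-(u_i,\bar u_i)=\frac{b(u_i^2)}{b(qu_i^2)}u_i^{-1}\prod_{j\ne i}f(u_i,u_j)\Lambda_1(u_i)-q^2u_i^3\prod_{j\neq i}h(u_i,u_j)\Lambda_2(u_i)+q^{1+4s}\mathrm b\,\frac{u_i^2b(u_i^2)}{b(q)}\frac{\prod_{k=0}^{2s}b(q^{1/2+k-s}\zeta u_i)b(q^{1/2+k-s}\zeta^{-1}u_i)}{\prod_{j\ne i}b(u_iu_j^{-1})b(qu_iu_j)}.$$ A set $S_-^{*N(i)}=\{u_1,\dots,u_{2s}\}$ of inhomogeneous Bethe roots for $\theta^*_N$ consists of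 $u_i\in\mathbb C^*$ with $u_i^2\ne u_i^{-2}$, with pairwise distinct $U(u_i)$, where $U(u)=\frac{qu^2+q^{-1}u^{-2}}{q+q^{-1}}$, with $E_-(u_i,\bar u_i)=0$ for $i=1,\dots,2s$, and with $$\theta_N^*=q^{4s}\Big(\mathrm b(\zeta^2+\zeta^{-2})[2s]_q+q^{-2s}(\mathrm b^*q^{2s}+\mathrm c^*q^{-2s})-q^{-1}\mathrm b\sum_{j=1}^{2s}(qu_j^2+q^{-1}u_j^{-2})\Big).$$ **The linear system.** For $y=(y_1,\dots,y_{2s+1})$ let $\bar{\mathcal Y}_k$ be $y$ with $y_k$ omitted. Call $y$ *regular* if all $y_i$, $b(y_i^2)$, $b(qy_i^2)$, $b(q^2y_i^2)$ and, for $i\neq j$, $b(y_i/y_j)$, $b(qy_iy_j)$ are non-zero. Put $g(u,\bar v)=\prod_{v\in\bar v}(b(u/v)b(quv))^{-1}$, $$Y_-(u|\bar v)=\frac{u^{-1}\Lambda_1(u)}{b(u^2)b(qu^2)}\prod_{v\in\bar v}b(u/(qv))b(uv)+\frac{u^{-1}\Lambda_2(u)}{b(u^2)b(q^2u^2)}\prod_{v\in\bar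 v}b(qu/v)b(q^2uv),$$ and let $\mathcal M^{-,M}(y)$ be the $(2s+1)\times(2s+1)$ matrix with entries $$\mathcal M^{-,M}_{jk}=\frac{y_k}{y_j}\frac{b(y_k^2)}{b(y_j^2)}g(y_k,\bar{\mathcal Y}_k)Y_-(y_k|\bar{\mathcal Y}_j)+\delta_{jk}\Big(\frac{(q+q^{-1})^2}{\rho\,b(y_j^2)b(q^2y_j^2)}\big(\eta^*+\eta\,U(y_j)\big)-\theta_M\Big).$$ A *reduction* for $M$ on a set $\Omega$ of regular points is a matrix-valued function $\mathcal W^{-,M}$ on $\Omega$ with $\det\mathcal W^{-,M}\ne0$ such that for $\widetilde{\mathcal M}^{-,M}=\mathcal W^{-,M}\mathcal M^{-,M}$: (i) the last row of $\widetilde{\mathcal M}^{-,M}$ vanishes; (ii) $\det\widetilde{\mathcal M}^{-,M}_{[2s+1,k]}$ (last row and $k$-th column deleted) does not depend on $y_k$, for each $k$. The $q$-Racah polynomials are $$R^{\{\cdot,\diamond\}}_M(\theta_N^*)={}_4\phi_3\left[\begin{matrix}q^{-2M},\ \frac{\mathrm b}{\mathrm c}q^{2M},\ q^{-2N},\ \frac{\mathrm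 b^*}{\mathrm c^*}q^{2N}\\ -\frac{\mathrm b\mathrm c^\diamond}{\mathrm c^*}r_0q,\ -\frac{\mathrm b^*\mathrm b^\diamond}{\mathrm c}r_0q^{4s+1},\ q^{-4s}\end{matrix};q^2,q^2\right],\qquad 0\le M,N\le2s.$$ **Corollary.** A normalized eigenbasis of $A$ exists, and for each $M=0,\dots,2s$ there is a reduction on the set of all regular points. Moreover, fix any normalized eigenbasis, covectors and $m_0,\alpha,\chi$ as above, let $P\ne0$ be a polynomial in $y_1,\dots,y_{2s+1}$, let $\Omega$ be the set of regular $y$ with $P(y)\ne0$, and for each $M$ let $\mathcal W^{-,M}$ be any reduction for $M$ on $\Omega$. Then there are unique scalars $\psi_0^-,\dots,\psi_{2s}^-$, independent of $y$, such that $$X_M(\bar{\mathcal Y}_k)=\psi_M^-(-1)^k\det\widetilde{\mathcal M}^{-,M}_{[2s+1,k]}\qquad(0\le M\le 2s,\ 1\le k\le2s+1,\ y\in\Omega),$$ and for all $0\le M,N\le 2s$ and all $y\in\Omega$ such that $\bar{\mathcal Y}_{2s+1}$ is a set $S_-^{*N(i)}$ of inhomogeneous Bethe roots for $\theta_N^*$,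 the denominators below are non-zero and $$R^{\{\cdot,\diamond\}}_M(\theta^*_N)=\frac{\psi_M^-}{\psi_0^-}\,\frac{\det\widetilde{\mathcal M}^{-,M}_{[2s+1,2s+1]}}{\det\widetilde{\mathcal M}^{-,0}_{[2s+1,2s+1]}}\,.$$ -/

import Mathlib

noncomputable section

namespace QRacah

/-- The function `b(x) = x - x⁻¹`. -/
def bb (x : ℂ) : ℂ := x - x⁻¹

/-- The parameters. Here `d = 2s`, so that the underlying vector space has dimension `d + 1`;
`qh` stands for `q^{1/2}`; `(b, c)`, `(bs, cs)`, `(bd, cd)` are the parameters of the eigenvalue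
sequences of `A`, `A^*`, `A^⋄`; `ζ` is the Bethe ansatz parameter. -/
structure Params where
  d : ℕ
  q : ℂ
  qh : ℂ
  r₀ : ℂ
  b : ℂ
  c : ℂ
  bs : ℂ
  cs : ℂ
  bd : ℂ
  cd : ℂ
  ζ : ℂ

/-- The standing assumptions on the parameters. -/
structure Params.Valid (p : Params) : Prop where
  q_ne : p.q ≠ 0
  q_not_root_of_unity : ∀ n : ℕ, 0 < n → p.q ^ n ≠ 1
  qh_sq : p.qh ^ 2 = p.q
  r₀_ne : p.r₀ ≠ 0
  b_ne : p.b ≠ 0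
  c_ne : p.c ≠ 0
  bs_ne : p.bs ≠ 0
  cs_ne : p.cs ≠ 0
  bd_ne : p.bd ≠ 0
  cd_ne : p.cd ≠ 0
  ζ_ne : p.ζ ≠ 0
  bc : p.r₀ ^ (-2 : ℤ) = p.b * p.c
  bcs : p.r₀ ^ (-2 : ℤ) = p.bs * p.cs
  bcd : p.r₀ ^ (-2 : ℤ) = p.bd * p.cd
  ζ_neg_two : p.ζ ^ (-2 : ℤ) = p.bd * p.r₀ * p.q ^ (p.d : ℤ)
  ζ_two : p.ζ ^ (2 : ℤ) = p.cd * p.r₀ * p.q ^ (-(p.d : ℤ))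

namespace Params

variable (p : Params)

/-- `θ_M`. -/
def θ (M : ℕ) : ℂ := p.b * p.q ^ (2 * (M : ℤ)) + p.c * p.q ^ (-2 * (M : ℤ))

/-- `θ^*_N`. -/
def θs (N : ℕ) : ℂ := p.bs * p.q ^ (2 * (N : ℤ)) + p.cs * p.q ^ (-2 * (N : ℤ))

/-- The value `θ_s` of an eigenvalue sequence with parameters `(x, y)` at the index `s = d / 2`. -/
def mid (x y : ℂ) : ℂ := x * p.q ^ (p.d : ℤ) + y * p.q ^ (-(p.d : ℤ))

/-- The expression for `ω^{a,b,c}` in terms of `θ^a_s`, `θ^b_s`, `θ^c_s`. -/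
def ωOf (ta tb tc : ℂ) : ℂ :=
  -(p.q - p.q⁻¹) ^ 2 *
    (ta * tb - p.r₀⁻¹ * (p.q ^ ((p.d : ℤ) + 1) + p.q ^ (-(p.d : ℤ) - 1)) * tc)

/-! The structure constants of the Askey-Wilson relations. -/

def ρ : ℂ := -(p.q ^ (2 : ℤ) - p.q ^ (-2 : ℤ)) ^ 2 / p.r₀ ^ 2

def ω : ℂ := p.ωOf (p.mid p.b p.c) (p.mid p.bs p.cs) (p.mid p.bd p.cd)

def η : ℂ := (p.q + p.q⁻¹) / p.r₀ *
  p.ωOf (p.mid p.b p.c) (p.mid p.bd p.cd) (p.mid p.bs p.cs)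

def ηs : ℂ := (p.q + p.q⁻¹) / p.r₀ *
  p.ωOf (p.mid p.bs p.cs) (p.mid p.bd p.cd) (p.mid p.b p.c)

end Params

section Representation

variable {V : Type*} [AddCommGroup V] [Module ℂ V]

/-- The `q`-commutator `[X, Y]_q = q X Y - q⁻¹ Y X`. -/
def qComm (q : ℂ) (X Y : Module.End ℂ V) : Module.End ℂ V := q • (X * Y) - q⁻¹ • (Y * X)

/-- An irreducible tridiagonal matrix. -/
def IrredTridiagonal {n : ℕ} (T : Matrix (Fin n) (Fin n) ℂ) : Prop :=
  (∀ i j : Fin n, (i : ℕ) + 1 < j ∨ (j : ℕ) + 1 < i → T i j = 0) ∧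
  (∀ i j : Fin n, (i : ℕ) + 1 = j ∨ (j : ℕ) + 1 = i → T i j ≠ 0)

/-- `(A, A^*)` is a Leonard pair on `V` with (standardly ordered, multiplicity-free)
eigenvalue sequences `θ_0, …, θ_d` and `θ^*_0, …, θ^*_d`. -/
structure IsLeonardPair {n : ℕ} (A As : Module.End ℂ V) (θ θs : Fin n → ℂ) : Prop where
  inj : Function.Injective θ
  injs : Function.Injective θs
  basis : ∃ e : Module.Basis (Fin n) ℂ V,
    (∀ M, A (e M) = θ M • e M) ∧ IrredTridiagonal (LinearMap.toMatrix e e As)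
  basiss : ∃ e : Module.Basis (Fin n) ℂ V,
    (∀ N, As (e N) = θs N • e N) ∧ IrredTridiagonal (LinearMap.toMatrix e e A)

/-- The Askey-Wilson relations for `A`, `A^*` with the structure constants of `p`. -/
structure AskeyWilson (p : Params) (A As : Module.End ℂ V) : Prop where
  aw : qComm p.q⁻¹ A (qComm p.q A As) = p.ρ • As + p.ω • A + p.η • (1 : Module.End ℂ V)
  aws : qComm p.q⁻¹ As (qComm p.q As A) = p.ρ • A + p.ω • As + p.ηs • (1 : Module.End ℂ V)

/-- A Leonard pair of `q`-Racah type `(A, A^*)` with parameters `p`. -/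
structure IsQRacahPair (p : Params) (A As : Module.End ℂ V) : Prop where
  leonard : IsLeonardPair A As (fun M : Fin (p.d + 1) => p.θ M) (fun N => p.θs N)
  askeyWilson : AskeyWilson p A As

/-- The coefficient `A^{(*,.)}_{M,M-1}`, `1 ≤ M ≤ d`. For `M = d` the factor
`c - b q^{2M+2d} = c - b q^{4M}` common to numerator and denominator is cancelled. -/
def Params.low (p : Params) (M : ℕ) : ℂ :=
  p.q ^ (2 - 2 * (p.d : ℤ)) * (1 - p.q ^ (2 * (M : ℤ)))
    * (p.bs * p.bd * p.r₀ * p.q ^ (2 * (p.d : ℤ) - 1) + p.b * p.q ^ (2 * (M : ℤ) - 2))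
    * (p.c * p.cd * p.r₀ * p.q⁻¹ + p.cs * p.q ^ (2 * (M : ℤ) - 2))
    / (p.c - p.b * p.q ^ (4 * (M : ℤ) - 2))
    * (if M = p.d then 1 else
        (p.c - p.b * p.q ^ (2 * (M : ℤ) + 2 * (p.d : ℤ))) / (p.c - p.b * p.q ^ (4 * (M : ℤ))))

/-- The coefficient `A^{(*,.)}_{M-1,M}`, `1 ≤ M ≤ d`. For `M = 1` the factor
`c - b q^{2M-2} = c - b q^{4M-4}` common to numerator and denominator is cancelled. -/
def Params.up (p : Params) (M : ℕ) : ℂ :=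
  (1 - p.q ^ (2 * (M : ℤ) - 2 * (p.d : ℤ) - 2))
    * (p.c + p.bs * p.bd * p.r₀ * p.q ^ (2 * (M : ℤ) + 2 * (p.d : ℤ) - 1))
    * (p.cs + p.b * p.cd * p.r₀ * p.q ^ (2 * (M : ℤ) - 1))
    / (p.c - p.b * p.q ^ (4 * (M : ℤ) - 2))
    * (if M = 1 then 1 else
        (p.c - p.b * p.q ^ (2 * (M : ℤ) - 2)) / (p.c - p.b * p.q ^ (4 * (M : ℤ) - 4)))

/-- The tridiagonal matrix of `A^*` in the normalized eigenbasis of `A`: the coefficients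
`A^{(*,.)}_{M',M}`, with `A^{(*,.)}_{0,-1} = A^{(*,.)}_{d,d+1} = 0`. -/
def Params.starMatrix (p : Params) : Matrix (Fin (p.d + 1)) (Fin (p.d + 1)) ℂ := fun i j =>
  if (i : ℕ) = j + 1 then p.low i
  else if (j : ℕ) = i + 1 then p.up j
  else if i = j then
    p.θs 0 - (if (i : ℕ) = p.d then 0 else p.up (i + 1)) - (if (i : ℕ) = 0 then 0 else p.low i)
  else 0

/-- `e` is the eigenbasis `|θ_0⟩, …, |θ_d⟩` of `A`, normalized through the action of `A^*`. -/
structure IsEigenbasis (p : Params) (A As : Module.End ℂ V)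
    (e : Module.Basis (Fin (p.d + 1)) ℂ V) : Prop where
  eig : ∀ M, A (e M) = p.θ M • e M
  tridiag : ∀ M, As (e M) = ∑ M' : Fin (p.d + 1), p.starMatrix M' M • e M'

/-- `f` is a family of covectors `⟨θ_0|, …, ⟨θ_d|` dual to the eigenbasis `e`, with arbitrary
non-zero normalizations `⟨θ_M|θ_M⟩`. -/
structure IsDualFamily (p : Params) (A : Module.End ℂ V)
    (e : Module.Basis (Fin (p.d + 1)) ℂ V) (f : Fin (p.d + 1) → Module.Dual ℂ V) : Prop where
  eig : ∀ M v, f M (A v) = p.θ M * f M v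
  orth : ∀ M M', M ≠ M' → f M (e M') = 0
  norm_ne : ∀ M, f M (e M) ≠ 0

/-- The dynamical operator `ℬ⁻(u, m)` with gauge parameters `α, β, χ`, where the overall factor `β`
has been multiplied into the bracket so that `β = 0` is allowed. -/
def dynB (p : Params) (A As : Module.End ℂ V) (α β χ u : ℂ) (m : ℤ) : Module.End ℂ V :=
  (bb (u ^ 2) * p.q ^ (2 * m + 1) / (α * p.q ^ (-2 : ℤ) - β * p.q ^ (2 * m))) •
    ((u * χ * p.q ^ (-m - 1) / p.ρ) • qComm p.q As A
      - (β ^ 2 * u * p.q ^ (m - 1) / χ) • qComm p.q A As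
      + (β * (p.q ^ 2 * u ^ 4 + 1) / (p.q ^ 2 * u)) • A
      - (β * (p.q ^ 2 + 1) * u / p.q ^ 2) • As
      - (p.q ^ (-m - 4) / (p.ρ * χ * bb (p.q ^ 2)) *
          (p.ρ * p.q ^ 2 * (p.q ^ 2 * u ^ 3 + u⁻¹) * (β ^ 2 * p.ρ * p.q ^ (2 * m) - χ ^ 2)
            + (p.q ^ 2 + 1) * u *
              (p.ω * (β ^ 2 * p.ρ * p.q ^ (2 * m + 2) - p.q ^ 2 * χ ^ 2)
                + β * (p.q ^ 4 - 1) * p.η * χ * p.q ^ m))) • (1 : Module.End ℂ V))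

/-- The Bethe state
`|Ψ_-^n(u, m)⟩ = ℬ⁻(u_1, m + 2(n-1)) ⋯ ℬ⁻(u_{n-1}, m + 2) ℬ⁻(u_n, m) |Ω⁻⟩` with `β = 0`. -/
def betheState (p : Params) (A As : Module.End ℂ V) (α χ : ℂ) (m : ℤ) (ref : V)
    {n : ℕ} (u : Fin n → ℂ) : V :=
  (List.ofFn fun i : Fin n =>
    dynB p A As α 0 χ (u i) (m + 2 * ((n : ℤ) - 1 - (i : ℤ)))).prod ref

/-- The normalized scalar product `X_M^{-,off}(u) = ⟨θ_M|Ψ_-^{2s}(u, m)⟩ / ⟨θ_M|θ_M⟩`,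
with reference state `|Ω⁻⟩ = |θ_0⟩`. -/
def scalarX (p : Params) (A As : Module.End ℂ V) (α χ : ℂ) (m : ℤ)
    (e : Module.Basis (Fin (p.d + 1)) ℂ V) (f : Fin (p.d + 1) → Module.Dual ℂ V)
    (M : Fin (p.d + 1)) (u : Fin p.d → ℂ) : ℂ :=
  f M (betheState p A As α χ m (e 0) u) / f M (e M)

end Representation

namespace Params

variable (p : Params)

/-! ### Functions entering the Bethe equations and the linear system (`ε = -`) -/

def f (u v : ℂ) : ℂ := bb (p.q * v / u) * bb (u * v) / (bb (v / u) * bb (p.q * u * v))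

def h (u v : ℂ) : ℂ :=
  bb (p.q ^ 2 * u * v) * bb (p.q * u / v) / (bb (p.q * u * v) * bb (u / v))

/-- `Λ_1^-(u)`. -/
def Λ₁ (u : ℂ) : ℂ :=
  p.q ^ (-(p.d : ℤ) - 1) * u
    * (p.q ^ ((p.d : ℤ) + 1) * u * p.ζ⁻¹ - u⁻¹ * p.ζ)
    * (p.q ^ ((p.d : ℤ) + 1) * u * p.ζ - u⁻¹ * p.ζ⁻¹)
    * (u * p.cs * p.q ^ (-(p.d : ℤ)) + u⁻¹ * p.b * p.q ^ (p.d : ℤ))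
    * (u * (p.c / p.cs) + u⁻¹)

/-- `Λ_2^-(u)`. -/
def Λ₂ (u : ℂ) : ℂ :=
  (u ^ (2 : ℤ) - u ^ (-2 : ℤ)) * p.q ^ (-(p.d : ℤ) - 1) * u
      / (p.q * u ^ (2 : ℤ) - p.q⁻¹ * u ^ (-2 : ℤ))
    * (p.q ^ ((p.d : ℤ) - 1) * u⁻¹ * p.ζ - u * p.ζ⁻¹)
    * (p.q ^ ((p.d : ℤ) - 1) * u⁻¹ * p.ζ⁻¹ - u * p.ζ)
    * (p.q ^ 2 * u * p.b * p.q ^ (p.d : ℤ) + u⁻¹ * p.cs * p.q ^ (-(p.d : ℤ)))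
    * (p.q ^ 2 * u + u⁻¹ * (p.c / p.cs))

/-- The symmetric variable `U = (q u² + q⁻¹ u⁻²) / (q + q⁻¹)`. -/
def symU (u : ℂ) : ℂ := (p.q * u ^ 2 + p.q⁻¹ * (u ^ 2)⁻¹) / (p.q + p.q⁻¹)

/-- `[n]_q`. -/
def qNum (n : ℕ) : ℂ := (p.q ^ (n : ℤ) - p.q ^ (-(n : ℤ))) / (p.q - p.q⁻¹)

def νMinus : ℂ := p.q ^ (1 + 2 * (p.d : ℤ)) * p.b

/-- The inhomogeneous Bethe function `E_-(u_i, u ∖ u_i)`. The numbers `q^{1/2+k-s}` are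
`qh^{1+2k-d}`. -/
def inhomE (u : Fin p.d → ℂ) (i : Fin p.d) : ℂ :=
  bb (u i ^ 2) / bb (p.q * u i ^ 2) * (u i)⁻¹
      * (∏ j ∈ Finset.univ.erase i, p.f (u i) (u j)) * p.Λ₁ (u i)
    - p.q ^ 2 * u i ^ 3
      * (∏ j ∈ Finset.univ.erase i, p.h (u i) (u j)) * p.Λ₂ (u i)
    + p.νMinus * (u i ^ 2 * bb (u i ^ 2) / bb p.q)
      * ((∏ k ∈ Finset.range (p.d + 1),
            bb (p.qh ^ (1 + 2 * (k : ℤ) - (p.d : ℤ)) * p.ζ * u i)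
              * bb (p.qh ^ (1 + 2 * (k : ℤ) - (p.d : ℤ)) * p.ζ⁻¹ * u i))
          / ∏ j ∈ Finset.univ.erase i, bb (u i * (u j)⁻¹) * bb (p.q * u i * u j))

/-- `u` is a set `S_-^{*N(i)}` of admissible inhomogeneous Bethe roots associated with the
eigenvalue `θ^*_N`. -/
structure IsInhomRoots (N : ℕ) (u : Fin p.d → ℂ) : Prop where
  ne_zero : ∀ i, u i ≠ 0
  sq_ne : ∀ i, u i ^ 2 ≠ (u i ^ 2)⁻¹
  symU_ne : ∀ i j, i ≠ j → p.symU (u i) ≠ p.symU (u j)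
  bethe : ∀ i, p.inhomE u i = 0
  eigenvalue : p.θs N = p.q ^ (2 * (p.d : ℤ)) *
    (p.b * (p.ζ ^ (2 : ℤ) + p.ζ ^ (-2 : ℤ)) * p.qNum p.d
      + p.q ^ (-(p.d : ℤ)) * (p.bs * p.q ^ (p.d : ℤ) + p.cs * p.q ^ (-(p.d : ℤ)))
      - p.q⁻¹ * p.b * ∑ j, (p.q * u j ^ (2 : ℤ) + p.q⁻¹ * u j ^ (-2 : ℤ)))

/-- `g(u, v)` for a family `v`. -/
def g {n : ℕ} (u : ℂ) (v : Fin n → ℂ) : ℂ := ∏ i, (bb (u / v i) * bb (p.q * u * v i))⁻¹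

/-- `Y_-(u | v)` for a family `v`. -/
def Y {n : ℕ} (u : ℂ) (v : Fin n → ℂ) : ℂ :=
  u⁻¹ * p.Λ₁ u / (bb (u ^ 2) * bb (p.q * u ^ 2))
      * ∏ i, bb (u / (p.q * v i)) * bb (u * v i)
    + u⁻¹ * p.Λ₂ u / (bb (u ^ 2) * bb (p.q ^ 2 * u ^ 2))
      * ∏ i, bb (p.q * u / v i) * bb (p.q ^ 2 * u * v i)

/-- The family `𝒴̄_k` obtained from `y = (y_1, …, y_{2s+1})` by omitting `y_k`. -/
def dropAt {d : ℕ} (y : Fin (d + 1) → ℂ) (k : Fin (d + 1)) : Fin d → ℂ := fun i => y (k.succAbove i)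

/-- `L^-_{jk}`. -/
def L (y : Fin (p.d + 1) → ℂ) (j k : Fin (p.d + 1)) : ℂ :=
  (y j / y k)⁻¹ * (bb (y k ^ 2) / bb (y j ^ 2)) * p.g (y k) (dropAt y k) * p.Y (y k) (dropAt y j)
    + (if j = k then
        (p.q + p.q⁻¹) ^ 2 / (p.ρ * bb (y j ^ 2) * bb (p.q ^ 2 * y j ^ 2))
          * (p.ηs + p.η * p.symU (y j))
      else 0)

/-- The matrix `ℳ^{-,M}` of the Belliard-Slavnov linear system. -/
def bsMatrix (M : Fin (p.d + 1)) (y : Fin (p.d + 1) → ℂ) :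
    Matrix (Fin (p.d + 1)) (Fin (p.d + 1)) ℂ :=
  Matrix.of fun j k => p.L y j k - if j = k then p.θ M else 0

/-- The points `y` at which all denominators in the linear system are non-zero. -/
structure Regular (y : Fin (p.d + 1) → ℂ) : Prop where
  ne_zero : ∀ i, y i ≠ 0
  bb_ne : ∀ i, bb (y i ^ 2) ≠ 0
  bb_q_ne : ∀ i, bb (p.q * y i ^ 2) ≠ 0
  bb_q_sq_ne : ∀ i, bb (p.q ^ 2 * y i ^ 2) ≠ 0
  bb_div_ne : ∀ i j, i ≠ j → bb (y i / y j) ≠ 0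
  bb_mul_ne : ∀ i j, i ≠ j → bb (p.q * y i * y j) ≠ 0

/-- The generic points: the regular points off the zero set of the polynomial `P`. -/
def generic (P : MvPolynomial (Fin (p.d + 1)) ℂ) : Set (Fin (p.d + 1) → ℂ) :=
  {y | p.Regular y ∧ MvPolynomial.eval y P ≠ 0}

end Params

/-- `T_{[2s+1,k]}`: delete the last row and the `k`-th column. -/
def deleteLast {d : ℕ} (T : Matrix (Fin (d + 1)) (Fin (d + 1)) ℂ) (k : Fin (d + 1)) :
    Matrix (Fin d) (Fin d) ℂ :=
  T.submatrix (Fin.last d).succAbove k.succAbove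

/-- `det ℳ̃^{-,M}_{[2s+1,k]}` at `y`, where `ℳ̃^{-,M} = 𝒲^{-,M} ℳ^{-,M}`. -/
def Params.minor (p : Params) (M : Fin (p.d + 1))
    (W : (Fin (p.d + 1) → ℂ) → Matrix (Fin (p.d + 1)) (Fin (p.d + 1)) ℂ)
    (k : Fin (p.d + 1)) (y : Fin (p.d + 1) → ℂ) : ℂ :=
  (deleteLast (W y * p.bsMatrix M y) k).det

/-- `W` is, on the set `S` of points `y`, a non-degenerate matrix function `𝒲^{-,M}` satisfying the
conditions (i) (the last row of `𝒲^{-,M} ℳ^{-,M}` vanishes) and (ii) (the `k`-th minor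
does not depend on `y_k`). -/
structure IsReduction (p : Params) (M : Fin (p.d + 1)) (S : Set (Fin (p.d + 1) → ℂ))
    (W : (Fin (p.d + 1) → ℂ) → Matrix (Fin (p.d + 1)) (Fin (p.d + 1)) ℂ) : Prop where
  nondegenerate : ∀ y ∈ S, (W y).det ≠ 0
  last_row : ∀ y ∈ S, ∀ k, (W y * p.bsMatrix M y) (Fin.last p.d) k = 0
  indep : ∀ k, ∀ y ∈ S, ∀ y' ∈ S, (∀ i, i ≠ k → y i = y' i) → p.minor M W k y = p.minor M W k y'

/-- The `q`-shifted factorial `(a; q)_n`. -/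
def qPoch (a q : ℂ) (n : ℕ) : ℂ := ∏ k ∈ Finset.range n, (1 - a * q ^ k)

/-- The terms `0, …, n` of the basic hypergeometric series
`₄φ₃(a₁, a₂, a₃, a₄; b₁, b₂, b₃; q, z)`. -/
def phi43 (n : ℕ) (a₁ a₂ a₃ a₄ b₁ b₂ b₃ q z : ℂ) : ℂ :=
  ∑ k ∈ Finset.range (n + 1),
    qPoch a₁ q k * qPoch a₂ q k * qPoch a₃ q k * qPoch a₄ q k
      / (qPoch b₁ q k * qPoch b₂ q k * qPoch b₃ q k * qPoch q q k) * z ^ k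

/-- The `q`-Racah polynomial `R_M^{{.,⋄}}(θ^*_N)`; its series terminates at the index `min M N`. -/
def Params.qRacah (p : Params) (M N : ℕ) : ℂ :=
  phi43 (min M N)
    (p.q ^ (-2 * (M : ℤ))) (p.b / p.c * p.q ^ (2 * (M : ℤ)))
    (p.q ^ (-2 * (N : ℤ))) (p.bs / p.cs * p.q ^ (2 * (N : ℤ)))
    (-(p.b * p.cd / p.cs) * p.r₀ * p.q)
    (-(p.bs * p.bd / p.c) * p.r₀ * p.q ^ (2 * (p.d : ℤ) + 1))
    (p.q ^ (-2 * (p.d : ℤ)))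
    (p.q ^ 2) (p.q ^ 2)

end QRacah

end

/-! Write D for the third operator `diamond`, an affine function of [A^*, A]_q. The two Askey-Wilson
relations become a cyclic triple of q-commutators for A, A^*, D, so D and A again satisfy a relation
of Askey-Wilson type. In the eigenbasis of A the operator D is irreducible tridiagonal; hence |θ_0⟩
is cyclic for D, and the whole computation takes place in the model of polynomials in D applied to
|θ_0⟩.

At β = 0 the dynamical operator is a non-zero constant times u b(u²) (D - σ(u)), where σ(u) = (q u²
+ q⁻¹ u⁻²)/r₀. A Bethe state is therefore a scalar times ∏ (D - σ(u_i)) |θ_0⟩ (`betheState_eq`). In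
the polynomial model A becomes a second order q-difference operator whose coefficients are those of
the linear system (`exists_actRel`): A and the difference operator obey the same relation with D,
respectively with multiplication by σ(u), and by `split_action` such a relation together with two
initial values fixes the action on the Newton basis.

Lagrange interpolation at the nodes σ(y_k) turns the action of A into the linear system: the
invertible matrix of Bethe components conjugates ℳ^{-,M} to diag(θ_i - θ_M)
(`bsMatrix_mul_betheMatrix`). Its kernel is the line spanned by the components X_M(𝒴̄_k). When the
last row of 𝒲ℳ vanishes, Cramer's rule makes the signed minors a non-zero multiple l(y) of that
vector. Since X_M(𝒴̄_k) does not involve y_k, condition (ii) says that l is unchanged when y_k moves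
while this component is non-zero. Any two generic points are joined by such moves through a third
one (`const_on_generic`), so l is constant; this gives ψ_M.

For Bethe roots, write A^* as an affine function of [A, D]_q and apply it to F(D)|θ_0⟩, where F has
the roots σ(u_i). The inhomogeneous Bethe equations say that the resulting polynomial is a multiple
of F modulo the characteristic polynomial of D, which kills |θ_0⟩ (`newton_diamond_apply`). So the
Bethe state is an eigenvector of A^* (`star_bethe`), with the prescribed eigenvalue θ^*_N
(`betheEig_eq`). By the split form of (A, A^*), the components of such an eigenvector in the
normalized eigenbasis are proportional to the q-Racah polynomials (`exists_star_eigenvector`), and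
the ratio of the M-th to the 0-th component is the claim.

The normalized eigenbasis itself is obtained by scaling eigenvectors of A so that they sum to the
θ^*_0-eigenvector of A^*; the entries of A^* are then forced by linear equations (`star_unique`). -/

noncomputable section

/-! ### Split form of an Askey-Wilson relation in a Newton basis. -/

namespace QRacah

open Polynomial

/-- The sequence `x q^{2n} + x' q^{-2n}`. -/
def racahSeq (q x x' : ℂ) (n : ℕ) : ℂ := x * (q ^ 2) ^ n + x' * ((q ^ 2) ^ n)⁻¹

/-- The polynomial `∏_{k < n} (X - t_k)`. -/
def newton (t : ℕ → ℂ) (n : ℕ) : ℂ[X] := ∏ k ∈ Finset.range n, (X - C (t k))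

/-- The coefficient below the diagonal in the split form, as a function of `z = q^{2n}`. -/
def splitFun (q Q g x x' y y' m z : ℂ) : ℂ :=
  q ^ 2 * (z ^ 2)⁻¹ * (1 - z) * (1 - z / (q ^ 2 * Q ^ 2)) *
    (x' * y' + z * Q * g * m / q + x * y * z ^ 2 * Q ^ 2 / q ^ 2)

/-- The linear structure constant, with `mx`, `my`, `mz` the middle values. -/
def awLin (q Q g mx my mz : ℂ) : ℂ :=
  -(q - q⁻¹) ^ 2 * (mx * my - g * (q * Q + (q * Q)⁻¹) * mz)

lemma newton_zero (t : ℕ → ℂ) : newton t 0 = 1 := by simp [newton]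

lemma newton_succ (t : ℕ → ℂ) (n : ℕ) : newton t (n + 1) = newton t n * (X - C (t n)) := by
  simp [newton, Finset.prod_range_succ]

lemma X_mul_newton (t : ℕ → ℂ) (n : ℕ) :
    X * newton t n = newton t (n + 1) + t n • newton t n := by
  rw [newton_succ, smul_eq_C_mul]; ring

lemma newton_monic (t : ℕ → ℂ) (n : ℕ) : (newton t n).Monic :=
  monic_prod_of_monic _ _ fun _ _ => monic_X_sub_C _

lemma newton_natDegree (t : ℕ → ℂ) (n : ℕ) : (newton t n).natDegree = n := by
  simp [newton, natDegree_prod_of_monic _ _ fun k _ => monic_X_sub_C (t k)]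

section Identities

variable {q Q g x x' y y' m z : ℂ}

/-- The comparison of coefficients at the Newton polynomial of index n + 1 in the recursion of
`split_step`, with z = q^{2n}; `split_identity_two` is the comparison at index n. -/
lemma split_identity_one (hq : q ≠ 0) (hQ : Q ≠ 0) (hz : z ≠ 0) :
    splitFun q Q g x x' y y' m (z * q ^ 2 * q ^ 2)
        + ((x * z + x' * z⁻¹) + (x * (z * q ^ 2) + x' * (z * q ^ 2)⁻¹))
          * (y * (z * q ^ 2) + y' * (z * q ^ 2)⁻¹) =
      (q ^ 2 + (q ^ 2)⁻¹) * ((y * (z * q ^ 2) + y' * (z * q ^ 2)⁻¹)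
          * (x * (z * q ^ 2) + x' * (z * q ^ 2)⁻¹)
        + splitFun q Q g x x' y y' m (z * q ^ 2) + (x * z + x' * z⁻¹) * (y * z + y' * z⁻¹))
      - (y * z + y' * z⁻¹) * ((x * z + x' * z⁻¹) + (x * (z * q ^ 2) + x' * (z * q ^ 2)⁻¹))
      - splitFun q Q g x x' y y' m z
      + awLin q Q g (x * Q + x' * Q⁻¹) (y * Q + y' * Q⁻¹) m := by
  unfold splitFun awLin
  field_simp
  ring

lemma split_identity_two (hq : q ≠ 0) (hQ : Q ≠ 0) (hx0 : x ≠ 0) (hy0 : y ≠ 0)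
    (hx : x * x' = g ^ 2) (hy : y * y' = g ^ 2) (hz : z ≠ 0) :
    ((x * z + x' * z⁻¹) + (x * (z * q ^ 2) + x' * (z * q ^ 2)⁻¹))
          * splitFun q Q g x x' y y' m (z * q ^ 2)
        + (x * z + x' * z⁻¹) ^ 2 * (y * z + y' * z⁻¹) =
      (q ^ 2 + (q ^ 2)⁻¹) * ((splitFun q Q g x x' y y' m (z * q ^ 2)
          + (x * z + x' * z⁻¹) * (y * z + y' * z⁻¹)) * (x * z + x' * z⁻¹)
          + (x * z + x' * z⁻¹) * splitFun q Q g x x' y y' m z)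
      - (y * z + y' * z⁻¹) * (x * z + x' * z⁻¹) ^ 2
      - splitFun q Q g x x' y y' m z * ((x * z + x' * z⁻¹)
          + (x * (z * (q ^ 2)⁻¹) + x' * (z * (q ^ 2)⁻¹)⁻¹))
      - (q ^ 2 - (q ^ 2)⁻¹) ^ 2 * g ^ 2 * (y * z + y' * z⁻¹)
      + awLin q Q g (x * Q + x' * Q⁻¹) (y * Q + y' * Q⁻¹) m * (x * z + x' * z⁻¹)
      + (q + q⁻¹) * g * awLin q Q g (x * Q + x' * Q⁻¹) m (y * Q + y' * Q⁻¹) := by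
  obtain rfl : x' = g ^ 2 / x := by field_simp; linear_combination hx
  obtain rfl : y' = g ^ 2 / y := by field_simp; linear_combination hy
  unfold splitFun awLin
  field_simp
  ring

end Identities

end QRacah

namespace QRacah

open Polynomial

section Split

variable {V' : Type*} [AddCommGroup V'] [Module ℂ V']

/-- The relation expresses Y on X² N_n through Y on X N_n and N_n, so the action on N_{n+2} follows
from the two preceding ones. The map `i` is kept abstract in order to serve both for operators
applied to a vector and for evaluation of polynomials at a point. The vector `a` stands for the
image of N_{n-1}; the hypothesis on it carries the factor `f₀`, so that nothing is required where no
N_{n-1} exists. -/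
lemma split_step {X' : Module.End ℂ V'} {i Y : ℂ[X] →ₗ[ℂ] V'} {t : ℕ → ℂ}
    {β κ e₁ e₀ tm y₀ y₁ y₂ f₀ f₁ f₂ : ℂ}
    (hi : ∀ p, i (X * p) = X' (i p))
    (hY : ∀ p, Y (X * (X * p)) = β • X' (Y (X * p)) - X' (X' (Y p)) + κ • Y p
      + e₁ • i (X * p) + e₀ • i p) (n : ℕ) (a : V')
    (ha : f₀ • X' a = f₀ • (i (newton t n) + tm • a))
    (h0 : Y (newton t n) = y₀ • i (newton t n) + f₀ • a)
    (h1 : Y (newton t (n + 1)) = y₁ • i (newton t (n + 1)) + f₁ • i (newton t n))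
    (hy : y₂ = β * y₁ - y₀)
    (h₁ : f₂ + (t n + t (n + 1)) * y₁ = β * (y₁ * t (n + 1) + f₁ + t n * y₀)
      - y₀ * (t n + t (n + 1)) - f₀ + e₁)
    (h₂ : (t n + t (n + 1)) * f₁ + t n ^ 2 * y₀ = β * ((f₁ + t n * y₀) * t n + t n * f₀)
      - y₀ * t n ^ 2 - f₀ * (t n + tm) + κ * y₀ + e₁ * t n + e₀)
    (h₃ : f₀ * (t n ^ 2 - β * (t n * tm) + tm ^ 2 - κ) = 0) :
    Y (newton t (n + 2)) = y₂ • i (newton t (n + 2)) + f₂ • i (newton t (n + 1)) := by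
  have hX0 := X_mul_newton t n
  have hX1 : X * newton t (n + 1) = newton t (n + 2) + t (n + 1) • newton t (n + 1) :=
    X_mul_newton t (n + 1)
  have e0 : X' (i (newton t n)) = i (newton t (n + 1)) + t n • i (newton t n) := by
    rw [← hi, hX0, map_add, map_smul]
  have e1 : X' (i (newton t (n + 1)))
      = i (newton t (n + 2)) + t (n + 1) • i (newton t (n + 1)) := by
    rw [← hi, hX1, map_add, map_smul]
  have key := hY (newton t n)
  rw [hX0, mul_add, mul_smul_comm, hX0, hX1] at key
  simp only [map_add, map_smul, h0, h1, smul_add, e0, e1] at key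
  have ha2 : f₀ • X' (X' a) = f₀ • (i (newton t (n + 1)) + t n • i (newton t n)
      + tm • (i (newton t n))) + (f₀ * tm ^ 2) • a := by
    have h := congrArg X' ha
    simp only [map_smul, map_add, e0] at h
    linear_combination (norm := module) h + tm • ha
  -- The hypotheses `hy`, `h₁`, `h₂`, `h₃` are the comparisons of coefficients at N_{n+2}, N_{n+1},
  -- N_n and `a`.
  linear_combination (norm := module) key + (β * t n) • ha - ha2
    - h₁ • i (newton t (n + 1)) - h₂ • i (newton t n) - h₃ • a - hy • i (newton t (n + 2))

variable {q Q g x x' y y' m : ℂ}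

/-- The coefficients below the diagonal in the split form. -/
def splitCoeff (q Q g x x' y y' m : ℂ) (n : ℕ) : ℂ := splitFun q Q g x x' y y' m ((q ^ 2) ^ n)

/-- The split form of a pair satisfying an Askey-Wilson relation. -/
theorem split_action (hq : q ≠ 0) (hQ : Q ≠ 0) (hx0 : x ≠ 0) (hy0 : y ≠ 0)
    (hx : x * x' = g ^ 2) (hy : y * y' = g ^ 2)
    {X' : Module.End ℂ V'} {i Y : ℂ[X] →ₗ[ℂ] V'}
    (hi : ∀ p, i (X * p) = X' (i p))
    (hY : ∀ p, Y (X * (X * p)) = (q ^ 2 + (q ^ 2)⁻¹) • X' (Y (X * p)) - X' (X' (Y p))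
      + (-((q ^ 2 - (q ^ 2)⁻¹) ^ 2 * g ^ 2)) • Y p
      + awLin q Q g (x * Q + x' * Q⁻¹) (y * Q + y' * Q⁻¹) m • i (X * p)
      + ((q + q⁻¹) * g * awLin q Q g (x * Q + x' * Q⁻¹) m (y * Q + y' * Q⁻¹)) • i p)
    (h0 : Y 1 = racahSeq q y y' 0 • i 1)
    (h1 : Y (newton (racahSeq q x x') 1) = racahSeq q y y' 1 • i (newton (racahSeq q x x') 1)
      + splitCoeff q Q g x x' y y' m 1 • i 1) (n : ℕ) :
    Y (newton (racahSeq q x x') (n + 1))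
      = racahSeq q y y' (n + 1) • i (newton (racahSeq q x x') (n + 1))
        + splitCoeff q Q g x x' y y' m (n + 1) • i (newton (racahSeq q x x') n) := by
  have hz : ∀ n : ℕ, (q ^ 2) ^ n ≠ 0 := fun n => by positivity
  have hyrec : ∀ n, racahSeq q y y' (n + 2)
      = (q ^ 2 + (q ^ 2)⁻¹) * racahSeq q y y' (n + 1) - racahSeq q y y' n := by
    intro n
    simp only [racahSeq, pow_succ (q ^ 2)]
    field_simp [hz n]
    ring
  induction n using Nat.twoStepInduction with
  | zero => simpa only [newton_zero] using h1
  | one =>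
    -- There is no N_{-1}: the lower coefficient is 0, in accordance with the factor 1 - z of
    -- `splitFun` at z = 1, and the value of `tm` is immaterial.
    refine split_step (f₀ := 0) (tm := racahSeq q x x' 0) hi hY 0 0 (by simp)
      (by simpa [newton_zero] using h0) (by simpa only [newton_zero] using h1) (hyrec 0) ?_ ?_
      (by simp)
    · have := split_identity_one (q := q) (Q := Q) (g := g) (x := x) (x' := x') (y := y)
        (y' := y') (m := m) hq hQ (one_ne_zero)
      simp only [splitCoeff, racahSeq, pow_succ (q ^ 2), pow_zero, zero_add]
      simpa [splitFun] using this
    · have := split_identity_two (q := q) (Q := Q) (g := g) (x := x) (x' := x') (y := y)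
        (y' := y') (m := m) hq hQ hx0 hy0 hx hy (one_ne_zero)
      have h0 : splitFun q Q g x x' y y' m 1 = 0 := by simp [splitFun]
      rw [h0] at this
      simp only [splitCoeff, racahSeq, pow_succ (q ^ 2), pow_zero, zero_add]
      linear_combination this
  | more n ih0 ih1 =>
    refine split_step (tm := racahSeq q x x' n) hi hY (n + 1)
      (i (newton (racahSeq q x x') n)) ?_ ih0 ih1 (hyrec _) ?_ ?_ ?_
    · rw [← hi, X_mul_newton, map_add, map_smul]
    · have := split_identity_one (q := q) (Q := Q) (g := g) (x := x) (x' := x') (y := y)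
        (y' := y') (m := m) hq hQ (hz (n + 1))
      simp only [splitCoeff, racahSeq, pow_succ (q ^ 2) (n + 1), pow_succ (q ^ 2) (n + 1 + 1)]
      linear_combination this
    · have := split_identity_two (q := q) (Q := Q) (g := g) (x := x) (x' := x') (y := y)
        (y' := y') (m := m) hq hQ hx0 hy0 hx hy (hz (n + 1))
      have e : (q ^ 2) ^ (n + 1) * (q ^ 2)⁻¹ = (q ^ 2) ^ n := by
        rw [pow_succ (q ^ 2)]; field_simp
      rw [e] at this
      simp only [splitCoeff, racahSeq, pow_succ (q ^ 2) (n + 1)]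
      linear_combination this
    -- Consecutive terms of the sequence satisfy t² - (q² + q⁻²) t t' + t'² = -(q² - q⁻²)² x x'.
    · refine mul_eq_zero_of_right _ ?_
      rw [← hx]
      simp only [racahSeq, pow_succ (q ^ 2)]
      field_simp [hz n]
      ring

end Split

end QRacah

/-! ### Structure constants and the third operator of the Askey-Wilson triple. -/

namespace QRacah

open Polynomial

namespace Params.Valid

variable {p : Params} (hp : p.Valid)
include hp

lemma q_pow_ne {n : ℕ} (hn : n ≠ 0) : p.q ^ n ≠ 1 :=
  hp.q_not_root_of_unity n (Nat.pos_of_ne_zero hn)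

lemma q_pow_inj {m n : ℕ} (h : p.q ^ m = p.q ^ n) : m = n := by
  have hq := hp.q_ne
  wlog hmn : m ≤ n generalizing m n
  · exact (this h.symm (le_of_not_ge hmn)).symm
  obtain ⟨k, rfl⟩ := Nat.exists_eq_add_of_le hmn
  by_contra hk
  refine hp.q_pow_ne (n := k) (by rintro rfl; simp at hk) ?_
  rw [pow_add] at h
  exact (mul_left_cancel₀ (pow_ne_zero m hq) (by rw [mul_one]; exact h)).symm

lemma q_sub_ne : p.q - p.q⁻¹ ≠ 0 := by
  have hq := hp.q_ne
  intro h
  apply hp.q_pow_ne (n := 2) (by norm_num)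
  field_simp at h
  linear_combination h

lemma q_sq_sub_ne : p.q ^ 2 - (p.q ^ 2)⁻¹ ≠ 0 := by
  have hq := hp.q_ne
  intro h
  apply hp.q_pow_ne (n := 4) (by norm_num)
  field_simp at h
  linear_combination h

lemma q_add_ne : p.q + p.q⁻¹ ≠ 0 := by
  have hq := hp.q_ne
  intro h
  apply hp.q_sq_sub_ne
  have : p.q ^ 2 - (p.q ^ 2)⁻¹ = (p.q + p.q⁻¹) * (p.q - p.q⁻¹) := by
    field_simp; ring
  rw [this, h, zero_mul]

lemma Q_ne : p.q ^ p.d ≠ 0 := pow_ne_zero _ hp.q_ne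

lemma b_mul_c : p.b * p.c = p.r₀⁻¹ ^ 2 := by
  rw [← hp.bc, zpow_neg, inv_pow]; rfl

lemma bs_mul_cs : p.bs * p.cs = p.r₀⁻¹ ^ 2 := by
  rw [← hp.bcs, zpow_neg, inv_pow]; rfl

lemma bd_mul_cd : p.bd * p.cd = p.r₀⁻¹ ^ 2 := by
  rw [← hp.bcd, zpow_neg, inv_pow]; rfl

omit hp in
lemma _root_.QRacah.Params.θ_eq (p : Params) (M : ℕ) : p.θ M = racahSeq p.q p.b p.c M := by
  simp only [Params.θ, racahSeq, ← pow_mul, neg_mul, zpow_neg]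
  norm_cast

omit hp in
lemma _root_.QRacah.Params.θs_eq (p : Params) (M : ℕ) : p.θs M = racahSeq p.q p.bs p.cs M := by
  simp only [Params.θs, racahSeq, ← pow_mul, neg_mul, zpow_neg]
  norm_cast

omit hp in
lemma _root_.QRacah.Params.mid_eq (p : Params) (x y : ℂ) :
    p.mid x y = x * p.q ^ p.d + y * (p.q ^ p.d)⁻¹ := by
  simp [Params.mid]

lemma ωOf_eq (x y z : ℂ) : p.ωOf x y z = awLin p.q (p.q ^ p.d) p.r₀⁻¹ x y z := by
  have hq := hp.q_ne
  simp only [Params.ωOf, awLin]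
  rw [zpow_add₀ hq, sub_eq_add_neg (-(p.d : ℤ)) 1, ← neg_add, zpow_neg, zpow_add₀ hq]
  simp only [zpow_natCast, zpow_one, mul_comm (p.q ^ p.d) p.q]

omit hp in
lemma _root_.QRacah.Params.ρ_eq (p : Params) :
    p.ρ = -((p.q ^ 2 - (p.q ^ 2)⁻¹) ^ 2 * p.r₀⁻¹ ^ 2) := by
  simp only [Params.ρ, zpow_neg, inv_pow, div_eq_mul_inv]
  norm_cast
  ring

lemma ρ_ne : p.ρ ≠ 0 := by
  rw [p.ρ_eq]
  exact neg_ne_zero.2 (mul_ne_zero (pow_ne_zero _ hp.q_sq_sub_ne)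
    (pow_ne_zero _ (inv_ne_zero hp.r₀_ne)))

lemma ω_eq : p.ω = awLin p.q (p.q ^ p.d) p.r₀⁻¹ (p.b * p.q ^ p.d + p.c * (p.q ^ p.d)⁻¹)
    (p.bs * p.q ^ p.d + p.cs * (p.q ^ p.d)⁻¹) (p.bd * p.q ^ p.d + p.cd * (p.q ^ p.d)⁻¹) := by
  simp only [Params.ω, hp.ωOf_eq, Params.mid_eq]

lemma η_eq : p.η = (p.q + p.q⁻¹) * p.r₀⁻¹ * awLin p.q (p.q ^ p.d) p.r₀⁻¹
    (p.b * p.q ^ p.d + p.c * (p.q ^ p.d)⁻¹) (p.bd * p.q ^ p.d + p.cd * (p.q ^ p.d)⁻¹)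
    (p.bs * p.q ^ p.d + p.cs * (p.q ^ p.d)⁻¹) := by
  simp only [Params.η, hp.ωOf_eq, Params.mid_eq, div_eq_mul_inv]

lemma ηs_eq : p.ηs = (p.q + p.q⁻¹) * p.r₀⁻¹ * awLin p.q (p.q ^ p.d) p.r₀⁻¹
    (p.bs * p.q ^ p.d + p.cs * (p.q ^ p.d)⁻¹) (p.bd * p.q ^ p.d + p.cd * (p.q ^ p.d)⁻¹)
    (p.b * p.q ^ p.d + p.c * (p.q ^ p.d)⁻¹) := by
  simp only [Params.ηs, hp.ωOf_eq, Params.mid_eq, div_eq_mul_inv]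

end Params.Valid

lemma awLin_comm (q Q g mx my mz : ℂ) : awLin q Q g mx my mz = awLin q Q g my mx mz := by
  unfold awLin; ring

section Diamond

variable {V : Type*} [AddCommGroup V] [Module ℂ V]

/-- The third operator `A^⋄`, an affine function of `[A^*, A]_q`. -/
def diamond (p : Params) (A As : Module.End ℂ V) : Module.End ℂ V :=
  (p.r₀ / (p.q ^ 2 - (p.q ^ 2)⁻¹)) • qComm p.q As A
    + (p.r₀ / (p.q ^ 2 - (p.q ^ 2)⁻¹) * p.ω / (p.q - p.q⁻¹)) • (1 : Module.End ℂ V)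

variable {p : Params} {A As : Module.End ℂ V}

lemma qComm_inv_qComm {q : ℂ} (hq : q ≠ 0) (X Y : Module.End ℂ V) :
    qComm q⁻¹ X (qComm q X Y)
      = X * (X * Y) - (q ^ 2 + (q ^ 2)⁻¹) • (X * (Y * X)) + Y * (X * X) := by
  simp only [qComm, mul_sub, sub_mul, smul_mul_assoc, mul_smul_comm, mul_assoc, inv_inv]
  match_scalars <;> field_simp <;> ring

/-- [A, [A^*, A]_q]_q is minus the left side of the first Askey-Wilson relation, and the scalar
shift in `diamond` is chosen to cancel the term ω A. With `diamond_qComm` and the definition of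
`diamond` this is the cyclic form of the relations. -/
lemma qComm_diamond (hp : p.Valid) (h : AskeyWilson p A As) :
    qComm p.q A (diamond p A As)
      = ((p.q ^ 2 - (p.q ^ 2)⁻¹) / p.r₀) • (As + (p.η / p.ρ) • (1 : Module.End ℂ V)) := by
  have hq := hp.q_ne
  have hr := hp.r₀_ne
  have h1 := hp.q_sq_sub_ne
  have h2 := hp.q_sub_ne
  have hρ := hp.ρ_ne
  have hρ' : p.ρ * p.r₀ ^ 2 = -(p.q ^ 2 - (p.q ^ 2)⁻¹) ^ 2 := by
    rw [p.ρ_eq]; field_simp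
  have aw := h.aw
  have e : qComm p.q A (qComm p.q As A) = -qComm p.q⁻¹ A (qComm p.q A As) := by
    simp only [qComm, mul_sub, sub_mul, smul_mul_assoc, mul_smul_comm, mul_assoc, inv_inv]
    match_scalars <;> field_simp <;> ring
  have e2 : qComm p.q A (diamond p A As)
      = (p.r₀ / (p.q ^ 2 - (p.q ^ 2)⁻¹)) • qComm p.q A (qComm p.q As A)
        + (p.r₀ / (p.q ^ 2 - (p.q ^ 2)⁻¹) * p.ω) • A := by
    have : p.r₀ / (p.q ^ 2 - (p.q ^ 2)⁻¹) * p.ω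
      = (p.r₀ / (p.q ^ 2 - (p.q ^ 2)⁻¹) * p.ω / (p.q - p.q⁻¹)) * (p.q - p.q⁻¹) :=
      (div_mul_cancel₀ _ h2).symm
    rw [this, diamond]
    generalize qComm p.q As A = K
    simp only [qComm, mul_add, add_mul, smul_mul_assoc, mul_smul_comm, mul_one, one_mul]
    module
  have e3 : (p.q ^ 2 - (p.q ^ 2)⁻¹) / p.r₀
      = -(p.r₀ / (p.q ^ 2 - (p.q ^ 2)⁻¹) * p.ρ) := by
    generalize p.q ^ 2 - (p.q ^ 2)⁻¹ = s at *
    field_simp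
    linear_combination hρ'
  rw [e2, e, aw, e3]
  match_scalars <;> field_simp <;> ring

lemma diamond_qComm (hp : p.Valid) (h : AskeyWilson p A As) :
    qComm p.q (diamond p A As) As
      = ((p.q ^ 2 - (p.q ^ 2)⁻¹) / p.r₀) • (A + (p.ηs / p.ρ) • (1 : Module.End ℂ V)) := by
  have hq := hp.q_ne
  have hr := hp.r₀_ne
  have h1 := hp.q_sq_sub_ne
  have h2 := hp.q_sub_ne
  have hρ := hp.ρ_ne
  have hρ' : p.ρ * p.r₀ ^ 2 = -(p.q ^ 2 - (p.q ^ 2)⁻¹) ^ 2 := by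
    rw [p.ρ_eq]; field_simp
  have aw := h.aws
  have e : qComm p.q (qComm p.q As A) As = -qComm p.q⁻¹ As (qComm p.q As A) := by
    simp only [qComm, mul_sub, sub_mul, smul_mul_assoc, mul_smul_comm, mul_assoc, inv_inv]
    match_scalars <;> field_simp <;> ring
  have e2 : qComm p.q (diamond p A As) As
      = (p.r₀ / (p.q ^ 2 - (p.q ^ 2)⁻¹)) • qComm p.q (qComm p.q As A) As
        + (p.r₀ / (p.q ^ 2 - (p.q ^ 2)⁻¹) * p.ω) • As := by
    have : p.r₀ / (p.q ^ 2 - (p.q ^ 2)⁻¹) * p.ω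
      = (p.r₀ / (p.q ^ 2 - (p.q ^ 2)⁻¹) * p.ω / (p.q - p.q⁻¹)) * (p.q - p.q⁻¹) :=
      (div_mul_cancel₀ _ h2).symm
    rw [this, diamond]
    generalize qComm p.q As A = K
    simp only [qComm, mul_add, add_mul, smul_mul_assoc, mul_smul_comm, mul_one, one_mul]
    module
  have e3 : (p.q ^ 2 - (p.q ^ 2)⁻¹) / p.r₀
      = -(p.r₀ / (p.q ^ 2 - (p.q ^ 2)⁻¹) * p.ρ) := by
    generalize p.q ^ 2 - (p.q ^ 2)⁻¹ = s at *
    field_simp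
    linear_combination hρ'
  rw [e2, e, aw, e3]
  match_scalars <;> field_simp <;> ring

lemma As_eq (hp : p.Valid) (h : AskeyWilson p A As) :
    As = (p.r₀ / (p.q ^ 2 - (p.q ^ 2)⁻¹)) • qComm p.q A (diamond p A As)
      - (p.η / p.ρ) • (1 : Module.End ℂ V) := by
  have hr := hp.r₀_ne
  have h1 := hp.q_sq_sub_ne
  rw [qComm_diamond hp h, smul_smul, div_mul_div_cancel₀ h1, div_self hr]
  module

/-- Obtained by eliminating A^* from `qComm_diamond` and `diamond_qComm`. The shift η/ρ of the first
produces the coefficient of D, because η is (q + q⁻¹)/r₀ times that coefficient. -/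
lemma diamond_relation (hp : p.Valid) (h : AskeyWilson p A As) :
    A * (diamond p A As * diamond p A As)
      = (p.q ^ 2 + (p.q ^ 2)⁻¹) • (diamond p A As * (A * diamond p A As))
        - diamond p A As * (diamond p A As * A) + p.ρ • A
        + awLin p.q (p.q ^ p.d) p.r₀⁻¹ (p.bd * p.q ^ p.d + p.cd * (p.q ^ p.d)⁻¹)
          (p.b * p.q ^ p.d + p.c * (p.q ^ p.d)⁻¹) (p.bs * p.q ^ p.d + p.cs * (p.q ^ p.d)⁻¹)
            • diamond p A As
        + p.ηs • (1 : Module.End ℂ V) := by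
  have hq := hp.q_ne
  have hr := hp.r₀_ne
  have h1 := hp.q_sq_sub_ne
  have h2 := hp.q_sub_ne
  have hρ := hp.ρ_ne
  have ha := qComm_diamond hp h
  have hb := diamond_qComm hp h
  have hη := hp.η_eq
  rw [awLin_comm] at hη ⊢
  rw [awLin_comm] at hη
  set w := awLin p.q (p.q ^ p.d) p.r₀⁻¹ (p.b * p.q ^ p.d + p.c * (p.q ^ p.d)⁻¹)
    (p.bd * p.q ^ p.d + p.cd * (p.q ^ p.d)⁻¹) (p.bs * p.q ^ p.d + p.cs * (p.q ^ p.d)⁻¹)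
  have hw : w = -((p.q ^ 2 - (p.q ^ 2)⁻¹) / p.r₀ * (p.η / p.ρ) * (p.q - p.q⁻¹)) := by
    have h3 := hp.q_add_ne
    have hs : p.q ^ 2 - (p.q ^ 2)⁻¹ = (p.q + p.q⁻¹) * (p.q - p.q⁻¹) := by field_simp; ring
    rw [hη, p.ρ_eq, hs]
    generalize p.q + p.q⁻¹ = s₁ at *
    generalize p.q - p.q⁻¹ = s₂ at *
    field_simp
  have hc : ((p.q ^ 2 - (p.q ^ 2)⁻¹) / p.r₀) ^ 2 = - p.ρ := by
    rw [p.ρ_eq]; field_simp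
  rw [sq] at hc
  rw [hw]
  generalize diamond p A As = D at *
  generalize (p.q ^ 2 - (p.q ^ 2)⁻¹) / p.r₀ = s at *
  have key : D * (D * A) - (p.q ^ 2 + (p.q ^ 2)⁻¹) • (D * (A * D)) + A * (D * D)
      = -(p.q • (D * qComm p.q A D) - p.q⁻¹ • (qComm p.q A D * D)) := by
    simp only [qComm, mul_sub, sub_mul, smul_mul_assoc, mul_smul_comm, mul_assoc]
    match_scalars <;> field_simp <;> ring
  have key2 : p.q • (D * qComm p.q A D) - p.q⁻¹ • (qComm p.q A D * D)
      = s • qComm p.q D As + (s * (p.η / p.ρ) * (p.q - p.q⁻¹)) • D := by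
    rw [ha]
    simp only [qComm, mul_add, add_mul, smul_mul_assoc, mul_smul_comm, mul_one, one_mul]
    module
  rw [key2, hb, smul_smul, hc] at key
  have e : p.ηs = p.ρ * (p.ηs / p.ρ) := by field_simp
  rw [e]
  linear_combination (norm := module) key

lemma star_relation (hp : p.Valid) (h : AskeyWilson p A As) :
    As * (A * A) = (p.q ^ 2 + (p.q ^ 2)⁻¹) • (A * (As * A)) - A * (A * As) + p.ρ • As
      + p.ω • A + p.η • (1 : Module.End ℂ V) := by
  have aw := h.aw
  rw [qComm_inv_qComm hp.q_ne] at aw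
  linear_combination (norm := module) aw

end Diamond

end QRacah

/-! ### Rational identities for the tridiagonal coefficients of A^*. -/

namespace QRacah

section Coefficients

variable {q Q b c bs cs e g m z : ℂ}

/-- Value of the subdiagonal coefficient in terms of `z = q^{2M}` and `e = b^⋄ r₀`. -/
def lowFun (q Q b c bs cs e z : ℂ) : ℂ :=
  q ^ 2 / Q ^ 2 * (1 - z) * (bs * e * (Q ^ 2 / q) + b * (z / q ^ 2))
    * (c * e⁻¹ * q⁻¹ + cs * (z / q ^ 2)) / (c - b * (z ^ 2 / q ^ 2))

/-- Value of the superdiagonal coefficient in terms of `z = q^{2M}` and `e = b^⋄ r₀`. -/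
def upFun (q Q b c bs cs e z : ℂ) : ℂ :=
  (1 - z / (Q ^ 2 * q ^ 2)) * (c + bs * e * (z * Q ^ 2 / q)) * (cs + b * e⁻¹ * (z / q))
    / (c - b * (z ^ 2 / q ^ 2))

/-- The generic case of `Params.Valid.star_linear`. The differences of neighbouring θ contain the
outer denominators of `lowFun` and `upFun`, which therefore cancel. The two ends of the spectrum
need separate identities: there the common factor c - b z² of numerator and denominator has been
cancelled, and it may vanish. -/
lemma low_up_linear (hq : q ≠ 0) (hQ : Q ≠ 0) (hbs : bs ≠ 0) (he : e ≠ 0) (hz : z ≠ 0)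
    (hs : bs * cs = b * c) (hgm : g * m = b * c * (e * Q + e⁻¹ * Q⁻¹))
    (h1 : c - b * (z ^ 2 / q ^ 2) ≠ 0) (h2 : c - b * z ^ 2 ≠ 0) (h3 : c - b * (z ^ 2 * q ^ 2) ≠ 0) :
    lowFun q Q b c bs cs e z * ((c - b * (z * Q ^ 2)) / (c - b * z ^ 2))
        * ((b * (z / q ^ 2) + c * (z / q ^ 2)⁻¹) - (b * z + c * z⁻¹))
      + upFun q Q b c bs cs e (z * q ^ 2) * ((c - b * z) / (c - b * z ^ 2))
        * ((b * (z * q ^ 2) + c * (z * q ^ 2)⁻¹) - (b * z + c * z⁻¹))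
      = ((bs * q ^ 2 + cs * (q ^ 2)⁻¹) - (bs + cs)) * ((b * z + c * z⁻¹) - (b + c))
        + splitFun q Q g b c bs cs m (q ^ 2) := by
  obtain rfl : cs = b * c / bs := by field_simp; linear_combination hs
  have e1 : splitFun q Q g b c bs (b * c / bs) m (q ^ 2)
      = q ^ 2 * ((q ^ 2) ^ 2)⁻¹ * (1 - q ^ 2) * (1 - q ^ 2 / (q ^ 2 * Q ^ 2)) *
    (c * (b * c / bs) + q ^ 2 * Q * (b * c * (e * Q + e⁻¹ * Q⁻¹)) / q
      + b * bs * (q ^ 2) ^ 2 * Q ^ 2 / q ^ 2) := by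
    rw [← hgm]; unfold splitFun; ring
  have e2 : (b * (z / q ^ 2) + c * (z / q ^ 2)⁻¹) - (b * z + c * z⁻¹)
      = (c - b * (z ^ 2 / q ^ 2)) * (q ^ 2 - 1) / z := by field_simp; ring
  have h3' : c - b * ((z * q ^ 2) ^ 2 / q ^ 2) ≠ 0 := by
    convert h3 using 3; field_simp
  have e3 : (b * (z * q ^ 2) + c * (z * q ^ 2)⁻¹) - (b * z + c * z⁻¹)
      = -(c - b * ((z * q ^ 2) ^ 2 / q ^ 2)) * (q ^ 2 - 1) / (z * q ^ 2) := by field_simp; ring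
  rw [e1, e2, e3]
  unfold lowFun upFun
  generalize hD1 : c - b * (z ^ 2 / q ^ 2) = D1 at *
  generalize hD3 : c - b * ((z * q ^ 2) ^ 2 / q ^ 2) = D3 at *
  generalize hD2 : c - b * z ^ 2 = D2 at *
  field_simp
  rw [← hD2]
  ring

lemma up_linear_zero (hq : q ≠ 0) (hQ : Q ≠ 0) (hbs : bs ≠ 0) (he : e ≠ 0)
    (hs : bs * cs = b * c) (hgm : g * m = b * c * (e * Q + e⁻¹ * Q⁻¹))
    (h3 : c - b * q ^ 2 ≠ 0) :
    upFun q Q b c bs cs e (q ^ 2) * ((b * q ^ 2 + c * (q ^ 2)⁻¹) - (b + c))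
      = splitFun q Q g b c bs cs m (q ^ 2) := by
  obtain rfl : cs = b * c / bs := by field_simp; linear_combination hs
  have e1 : splitFun q Q g b c bs (b * c / bs) m (q ^ 2)
      = q ^ 2 * ((q ^ 2) ^ 2)⁻¹ * (1 - q ^ 2) * (1 - q ^ 2 / (q ^ 2 * Q ^ 2)) *
    (c * (b * c / bs) + q ^ 2 * Q * (b * c * (e * Q + e⁻¹ * Q⁻¹)) / q
      + b * bs * (q ^ 2) ^ 2 * Q ^ 2 / q ^ 2) := by
    rw [← hgm]; unfold splitFun; ring
  have h3' : c - b * ((q ^ 2) ^ 2 / q ^ 2) ≠ 0 := by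
    convert h3 using 3; field_simp
  have e3 : (b * q ^ 2 + c * (q ^ 2)⁻¹) - (b + c)
      = -(c - b * ((q ^ 2) ^ 2 / q ^ 2)) * (q ^ 2 - 1) / q ^ 2 := by field_simp; ring
  rw [e1, e3]
  unfold upFun
  generalize hD3 : c - b * ((q ^ 2) ^ 2 / q ^ 2) = D3 at *
  field_simp
  ring

lemma low_linear_last (hq : q ≠ 0) (hQ : Q ≠ 0) (hbs : bs ≠ 0) (he : e ≠ 0)
    (hs : bs * cs = b * c) (hgm : g * m = b * c * (e * Q + e⁻¹ * Q⁻¹))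
    (h1 : c - b * ((Q ^ 2) ^ 2 / q ^ 2) ≠ 0) :
    lowFun q Q b c bs cs e (Q ^ 2)
        * ((b * (Q ^ 2 / q ^ 2) + c * (Q ^ 2 / q ^ 2)⁻¹) - (b * Q ^ 2 + c * (Q ^ 2)⁻¹))
      = ((bs * q ^ 2 + cs * (q ^ 2)⁻¹) - (bs + cs)) * ((b * Q ^ 2 + c * (Q ^ 2)⁻¹) - (b + c))
        + splitFun q Q g b c bs cs m (q ^ 2) := by
  obtain rfl : cs = b * c / bs := by field_simp; linear_combination hs
  have e1 : splitFun q Q g b c bs (b * c / bs) m (q ^ 2)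
      = q ^ 2 * ((q ^ 2) ^ 2)⁻¹ * (1 - q ^ 2) * (1 - q ^ 2 / (q ^ 2 * Q ^ 2)) *
    (c * (b * c / bs) + q ^ 2 * Q * (b * c * (e * Q + e⁻¹ * Q⁻¹)) / q
      + b * bs * (q ^ 2) ^ 2 * Q ^ 2 / q ^ 2) := by
    rw [← hgm]; unfold splitFun; ring
  have e2 : (b * (Q ^ 2 / q ^ 2) + c * (Q ^ 2 / q ^ 2)⁻¹) - (b * Q ^ 2 + c * (Q ^ 2)⁻¹)
      = (c - b * ((Q ^ 2) ^ 2 / q ^ 2)) * (q ^ 2 - 1) / Q ^ 2 := by field_simp; ring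
  rw [e1, e2]
  unfold lowFun
  generalize hD1 : c - b * ((Q ^ 2) ^ 2 / q ^ 2) = D1 at *
  field_simp
  ring

/-- The generic case of `Params.Valid.star_diag`. The two factors in front of the diagonal entry
are, up to monomials, the denominators of `upFun` and `lowFun`; again the ends of the spectrum are
treated apart. -/
lemma low_up_diag (hq : q ≠ 0) (hQ : Q ≠ 0) (hbs : bs ≠ 0) (he : e ≠ 0) (hz : z ≠ 0)
    (hs : bs * cs = b * c) (hgm : g * m = b * c * (e * Q + e⁻¹ * Q⁻¹)) (hg : g ^ 2 = b * c)
    (h1 : c - b * (z ^ 2 / q ^ 2) ≠ 0) (h2 : c - b * z ^ 2 ≠ 0) (h3 : c - b * (z ^ 2 * q ^ 2) ≠ 0) :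
    -(q - q⁻¹) ^ 2 * (b * z * q - c * (z * q)⁻¹) * (b * z * q⁻¹ - c * z⁻¹ * q)
      * ((bs + cs) - upFun q Q b c bs cs e (z * q ^ 2) * ((c - b * z) / (c - b * z ^ 2))
        - lowFun q Q b c bs cs e z * ((c - b * (z * Q ^ 2)) / (c - b * z ^ 2)))
      = awLin q Q g (b * Q + c * Q⁻¹) (bs * Q + cs * Q⁻¹) m * (b * z + c * z⁻¹)
        + (q + q⁻¹) * g * awLin q Q g (b * Q + c * Q⁻¹) m (bs * Q + cs * Q⁻¹) := by
  obtain rfl : cs = b * c / bs := by field_simp; linear_combination hs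
  have e1 : awLin q Q g (b * Q + c * Q⁻¹) (bs * Q + (b * c / bs) * Q⁻¹) m * (b * z + c * z⁻¹)
        + (q + q⁻¹) * g * awLin q Q g (b * Q + c * Q⁻¹) m (bs * Q + (b * c / bs) * Q⁻¹)
      = -(q - q⁻¹) ^ 2 * (((b * Q + c * Q⁻¹) * (bs * Q + (b * c / bs) * Q⁻¹)
          - (q * Q + (q * Q)⁻¹) * (g * m)) * (b * z + c * z⁻¹)
          + (q + q⁻¹) * ((b * Q + c * Q⁻¹) * (g * m)
            - g ^ 2 * (q * Q + (q * Q)⁻¹) * (bs * Q + (b * c / bs) * Q⁻¹))) := by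
    unfold awLin; ring
  rw [e1, hgm, hg]
  have h3' : c - b * ((z * q ^ 2) ^ 2 / q ^ 2) ≠ 0 := by
    convert h3 using 3; field_simp
  have e2 : (b * z * q - c * (z * q)⁻¹) = -(c - b * ((z * q ^ 2) ^ 2 / q ^ 2)) / (z * q) := by
    field_simp; ring
  have e3 : (b * z * q⁻¹ - c * z⁻¹ * q) = -(c - b * (z ^ 2 / q ^ 2)) * q / z := by
    field_simp; ring
  rw [e2, e3]
  have e4 : -(q - q⁻¹) ^ 2 * (-(c - b * ((z * q ^ 2) ^ 2 / q ^ 2)) / (z * q))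
      * (-(c - b * (z ^ 2 / q ^ 2)) * q / z)
      * ((bs + b * c / bs)
        - upFun q Q b c bs (b * c / bs) e (z * q ^ 2) * ((c - b * z) / (c - b * z ^ 2))
        - lowFun q Q b c bs (b * c / bs) e z * ((c - b * (z * Q ^ 2)) / (c - b * z ^ 2)))
    = -(q - q⁻¹) ^ 2 / z ^ 2 * ((bs + b * c / bs) * ((c - b * ((z * q ^ 2) ^ 2 / q ^ 2))
        * (c - b * (z ^ 2 / q ^ 2)))
      - (c - b * (z ^ 2 / q ^ 2)) * ((1 - z * q ^ 2 / (Q ^ 2 * q ^ 2))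
          * (c + bs * e * (z * q ^ 2 * Q ^ 2 / q)) * ((b * c / bs) + b * e⁻¹ * (z * q ^ 2 / q)))
          * ((c - b * z) / (c - b * z ^ 2))
      - (c - b * ((z * q ^ 2) ^ 2 / q ^ 2)) * (q ^ 2 / Q ^ 2 * (1 - z)
          * (bs * e * (Q ^ 2 / q) + b * (z / q ^ 2)) * (c * e⁻¹ * q⁻¹ + (b * c / bs) * (z / q ^ 2)))
          * ((c - b * (z * Q ^ 2)) / (c - b * z ^ 2))) := by
    unfold lowFun upFun
    generalize c - b * (z ^ 2 / q ^ 2) = D1 at *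
    generalize c - b * ((z * q ^ 2) ^ 2 / q ^ 2) = D3 at *
    field_simp
  rw [e4]
  generalize hD2 : c - b * z ^ 2 = D2 at *
  field_simp
  rw [← hD2]
  ring

lemma up_diag_zero (hq : q ≠ 0) (hQ : Q ≠ 0) (hbs : bs ≠ 0) (he : e ≠ 0)
    (hs : bs * cs = b * c) (hgm : g * m = b * c * (e * Q + e⁻¹ * Q⁻¹)) (hg : g ^ 2 = b * c)
    (h3 : c - b * q ^ 2 ≠ 0) :
    -(q - q⁻¹) ^ 2 * (b * q - c * q⁻¹) * (b * q⁻¹ - c * q)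
      * ((bs + cs) - upFun q Q b c bs cs e (q ^ 2))
      = awLin q Q g (b * Q + c * Q⁻¹) (bs * Q + cs * Q⁻¹) m * (b + c)
        + (q + q⁻¹) * g * awLin q Q g (b * Q + c * Q⁻¹) m (bs * Q + cs * Q⁻¹) := by
  obtain rfl : cs = b * c / bs := by field_simp; linear_combination hs
  have e1 : awLin q Q g (b * Q + c * Q⁻¹) (bs * Q + (b * c / bs) * Q⁻¹) m * (b + c)
        + (q + q⁻¹) * g * awLin q Q g (b * Q + c * Q⁻¹) m (bs * Q + (b * c / bs) * Q⁻¹)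
      = -(q - q⁻¹) ^ 2 * (((b * Q + c * Q⁻¹) * (bs * Q + (b * c / bs) * Q⁻¹)
          - (q * Q + (q * Q)⁻¹) * (g * m)) * (b + c)
          + (q + q⁻¹) * ((b * Q + c * Q⁻¹) * (g * m)
            - g ^ 2 * (q * Q + (q * Q)⁻¹) * (bs * Q + (b * c / bs) * Q⁻¹))) := by
    unfold awLin; ring
  rw [e1, hgm, hg]
  have h3' : c - b * ((q ^ 2) ^ 2 / q ^ 2) ≠ 0 := by
    convert h3 using 3; field_simp
  have e2 : upFun q Q b c bs (b * c / bs) e (q ^ 2) = (1 - q ^ 2 / (Q ^ 2 * q ^ 2))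
      * (c + bs * e * (q ^ 2 * Q ^ 2 / q)) * ((b * c / bs) + b * e⁻¹ * (q ^ 2 / q))
      / (c - b * q ^ 2) := by
    unfold upFun; congr 3; field_simp
  rw [e2]
  generalize hD2 : c - b * q ^ 2 = D2 at *
  field_simp
  rw [← hD2]
  ring

lemma low_diag_last (hq : q ≠ 0) (hQ : Q ≠ 0) (hbs : bs ≠ 0) (he : e ≠ 0)
    (hs : bs * cs = b * c) (hgm : g * m = b * c * (e * Q + e⁻¹ * Q⁻¹)) (hg : g ^ 2 = b * c)
    (h1 : c - b * ((Q ^ 2) ^ 2 / q ^ 2) ≠ 0) :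
    -(q - q⁻¹) ^ 2 * (b * Q ^ 2 * q - c * (Q ^ 2 * q)⁻¹) * (b * Q ^ 2 * q⁻¹ - c * (Q ^ 2)⁻¹ * q)
      * ((bs + cs) - lowFun q Q b c bs cs e (Q ^ 2))
      = awLin q Q g (b * Q + c * Q⁻¹) (bs * Q + cs * Q⁻¹) m * (b * Q ^ 2 + c * (Q ^ 2)⁻¹)
        + (q + q⁻¹) * g * awLin q Q g (b * Q + c * Q⁻¹) m (bs * Q + cs * Q⁻¹) := by
  obtain rfl : cs = b * c / bs := by field_simp; linear_combination hs
  have e1 : awLin q Q g (b * Q + c * Q⁻¹) (bs * Q + (b * c / bs) * Q⁻¹) m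
          * (b * Q ^ 2 + c * (Q ^ 2)⁻¹)
        + (q + q⁻¹) * g * awLin q Q g (b * Q + c * Q⁻¹) m (bs * Q + (b * c / bs) * Q⁻¹)
      = -(q - q⁻¹) ^ 2 * (((b * Q + c * Q⁻¹) * (bs * Q + (b * c / bs) * Q⁻¹)
          - (q * Q + (q * Q)⁻¹) * (g * m)) * (b * Q ^ 2 + c * (Q ^ 2)⁻¹)
          + (q + q⁻¹) * ((b * Q + c * Q⁻¹) * (g * m)
            - g ^ 2 * (q * Q + (q * Q)⁻¹) * (bs * Q + (b * c / bs) * Q⁻¹))) := by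
    unfold awLin; ring
  rw [e1, hgm, hg]
  have e3 : (b * Q ^ 2 * q⁻¹ - c * (Q ^ 2)⁻¹ * q) = -(c - b * ((Q ^ 2) ^ 2 / q ^ 2)) * q / Q ^ 2 := by
    field_simp; ring
  have e4 : -(q - q⁻¹) ^ 2 * (b * Q ^ 2 * q - c * (Q ^ 2 * q)⁻¹)
      * (-(c - b * ((Q ^ 2) ^ 2 / q ^ 2)) * q / Q ^ 2)
      * ((bs + b * c / bs) - lowFun q Q b c bs (b * c / bs) e (Q ^ 2))
    = (q - q⁻¹) ^ 2 * (b * Q ^ 2 * q - c * (Q ^ 2 * q)⁻¹) * q / Q ^ 2 *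
      ((bs + b * c / bs) * (c - b * ((Q ^ 2) ^ 2 / q ^ 2))
       - q ^ 2 / Q ^ 2 * (1 - Q ^ 2) * (bs * e * (Q ^ 2 / q) + b * (Q ^ 2 / q ^ 2))
          * (c * e⁻¹ * q⁻¹ + (b * c / bs) * (Q ^ 2 / q ^ 2))) := by
    unfold lowFun
    generalize c - b * ((Q ^ 2) ^ 2 / q ^ 2) = D1 at *
    field_simp
  rw [e3, e4]
  field_simp
  ring

end Coefficients

end QRacah

/-! ### The coefficients of A^* are forced by two families of linear equations. -/

namespace QRacah

namespace Params

/-- The coefficient `A^{(*,.)}_{M,M-1}`, extended by `0` to `M = 0`. -/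
def lowN (p : Params) (M : ℕ) : ℂ := if M = 0 then 0 else p.low M

/-- The coefficient `A^{(*,.)}_{M,M+1}`, extended by `0` to `M = d`. -/
def upN (p : Params) (M : ℕ) : ℂ := if M = p.d then 0 else p.up (M + 1)

/-- The factor of the diagonal entry `A^*_{M,M}` in the Askey-Wilson relation. -/
def diagFactor (p : Params) (M : ℕ) : ℂ :=
  -(p.q - p.q⁻¹) ^ 2 * (p.b * (p.q ^ 2) ^ M * p.q - p.c * ((p.q ^ 2) ^ M * p.q)⁻¹)
    * (p.b * (p.q ^ 2) ^ M * p.q⁻¹ - p.c * ((p.q ^ 2) ^ M)⁻¹ * p.q)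

/-- The first coefficient of the split form of `(A, A^*)`. -/
def starSplit (p : Params) (n : ℕ) : ℂ :=
  splitCoeff p.q (p.q ^ p.d) p.r₀⁻¹ p.b p.c p.bs p.cs (p.bd * p.q ^ p.d + p.cd * (p.q ^ p.d)⁻¹) n

end Params

namespace Params.Valid

variable {p : Params} (hp : p.Valid)
include hp

lemma e_ne : p.bd * p.r₀ ≠ 0 := mul_ne_zero hp.bd_ne hp.r₀_ne

lemma cd_mul_r₀ : p.cd * p.r₀ = (p.bd * p.r₀)⁻¹ := by
  have h := hp.bd_mul_cd
  have hr := hp.r₀_ne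
  have hb := hp.bd_ne
  field_simp at h ⊢
  linear_combination h

lemma bs_cs_eq : p.bs * p.cs = p.b * p.c := by rw [hp.bs_mul_cs, hp.b_mul_c]

/-- Replaces the data of A^⋄ by e = b^⋄ r₀, so that r₀⁻¹, a square root of b c, enters only through
its square. -/
lemma gm_eq : p.r₀⁻¹ * (p.bd * p.q ^ p.d + p.cd * (p.q ^ p.d)⁻¹)
    = p.b * p.c * (p.bd * p.r₀ * p.q ^ p.d + (p.bd * p.r₀)⁻¹ * (p.q ^ p.d)⁻¹) := by
  rw [← hp.cd_mul_r₀, hp.b_mul_c]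
  have hr := hp.r₀_ne
  field_simp

lemma low_eq {M : ℕ} : p.low M
    = lowFun p.q (p.q ^ p.d) p.b p.c p.bs p.cs (p.bd * p.r₀) ((p.q ^ 2) ^ M) *
      (if M = p.d then 1 else (p.c - p.b * ((p.q ^ 2) ^ M * (p.q ^ p.d) ^ 2))
        / (p.c - p.b * ((p.q ^ 2) ^ M) ^ 2)) := by
  have hq := hp.q_ne
  have hQ : p.q ^ (2 * (p.d : ℤ)) = (p.q ^ p.d) ^ 2 := by
    rw [mul_comm, zpow_mul]; norm_cast
  have hz : p.q ^ (2 * (M : ℤ)) = (p.q ^ 2) ^ M := by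
    rw [zpow_mul]; norm_cast
  have hz4 : p.q ^ (4 * (M : ℤ)) = ((p.q ^ 2) ^ M) ^ 2 := by
    rw [← hz, ← zpow_natCast, ← zpow_mul]; congr 1; push_cast; ring
  unfold Params.low lowFun
  rw [← hp.cd_mul_r₀]
  simp only [zpow_sub₀ hq, zpow_add₀ hq, hQ, hz, hz4, zpow_one]
  norm_cast
  ring_nf

lemma up_eq {M : ℕ} : p.up M
    = upFun p.q (p.q ^ p.d) p.b p.c p.bs p.cs (p.bd * p.r₀) ((p.q ^ 2) ^ M) *
      (if M = 1 then 1 else (p.c - p.b * ((p.q ^ 2) ^ M / p.q ^ 2))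
        / (p.c - p.b * (((p.q ^ 2) ^ M) ^ 2 / p.q ^ 4))) := by
  have hq := hp.q_ne
  have hQ : p.q ^ (2 * (p.d : ℤ)) = (p.q ^ p.d) ^ 2 := by
    rw [mul_comm, zpow_mul]; norm_cast
  have hz : p.q ^ (2 * (M : ℤ)) = (p.q ^ 2) ^ M := by
    rw [zpow_mul]; norm_cast
  have hz4 : p.q ^ (4 * (M : ℤ)) = ((p.q ^ 2) ^ M) ^ 2 := by
    rw [← hz, ← zpow_natCast, ← zpow_mul]; congr 1; push_cast; ring
  unfold Params.up upFun
  rw [← hp.cd_mul_r₀]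
  simp only [zpow_sub₀ hq, zpow_add₀ hq, hQ, hz, hz4, zpow_one]
  norm_cast
  ring_nf

variable (hθ : Function.Injective fun M : Fin (p.d + 1) => p.θ M)
include hθ

omit hp in
lemma θ_ne {i j : ℕ} (hi : i ≤ p.d) (hj : j ≤ p.d) (hij : i ≠ j) : p.θ i ≠ p.θ j := by
  intro h
  have := @hθ ⟨i, by omega⟩ ⟨j, by omega⟩ h
  exact hij (by simpa using this)

/-- θ_i - θ_j is divisible by c - b q^{2(i+j)}, so distinct eigenvalues keep the denominators of the
coefficients away from zero. -/
lemma c_sub_ne {i j : ℕ} (hi : i ≤ p.d) (hj : j ≤ p.d) (hij : i ≠ j) :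
    p.c - p.b * (p.q ^ 2) ^ (i + j) ≠ 0 := by
  intro h
  have hq := hp.q_ne
  refine θ_ne hθ hi hj hij ?_
  have hc : p.c = p.b * (p.q ^ 2) ^ (i + j) := by linear_combination h
  simp only [Params.θ_eq, racahSeq, hc, pow_add]
  field_simp
  ring

lemma c_sub_ne' {i j : ℕ} {x : ℂ} (hi : i ≤ p.d) (hj : j ≤ p.d) (hij : i ≠ j)
    (hx : x = (p.q ^ 2) ^ (i + j)) : p.c - p.b * x ≠ 0 := by
  rw [hx]; exact hp.c_sub_ne hθ hi hj hij

omit hθ in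
lemma racah_pred (x x' : ℂ) {M : ℕ} (hM : M ≠ 0) : racahSeq p.q x x' (M - 1)
    = x * ((p.q ^ 2) ^ M / p.q ^ 2) + x' * ((p.q ^ 2) ^ M / p.q ^ 2)⁻¹ := by
  obtain ⟨k, rfl⟩ := Nat.exists_eq_succ_of_ne_zero hM
  have hq := hp.q_ne
  have : (p.q ^ 2) ^ (k + 1) / p.q ^ 2 = (p.q ^ 2) ^ k := by rw [pow_succ (p.q ^ 2)]; field_simp
  simp only [Nat.succ_eq_add_one, this, racahSeq, Nat.add_sub_cancel]

omit hθ in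
lemma pow_pred {M : ℕ} (hM : M ≠ 0) : ((p.q ^ 2) ^ M) ^ 2 / p.q ^ 2 = (p.q ^ 2) ^ (M + (M - 1)) := by
  obtain ⟨k, rfl⟩ := Nat.exists_eq_succ_of_ne_zero hM
  have hq := hp.q_ne
  simp only [Nat.succ_eq_add_one, Nat.add_sub_cancel]
  field_simp
  ring

omit hθ in
lemma upN_eq {M : ℕ} (hM : M ≠ 0) (hMd : M ≠ p.d) : p.upN M
    = upFun p.q (p.q ^ p.d) p.b p.c p.bs p.cs (p.bd * p.r₀) ((p.q ^ 2) ^ M * p.q ^ 2) *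
      ((p.c - p.b * (p.q ^ 2) ^ M) / (p.c - p.b * ((p.q ^ 2) ^ M) ^ 2)) := by
  have hq := hp.q_ne
  rw [Params.upN, if_neg hMd, hp.up_eq, if_neg (by omega), pow_succ (p.q ^ 2)]
  congr 3
  · field_simp
  · congr 1; field_simp

/-- This is the |θ_M⟩-component of A^*(A - θ_0)w = θ^*_1 (A - θ_0)w + φ_1 w for w = ∑ |θ_M⟩, after
subtraction of the row sum θ^*_0. The out-of-range values θ (M - 1) at M = 0 and θ (M + 1) at M = d
carry the coefficient 0. -/
lemma star_linear (hd : p.d ≠ 0) {M : ℕ} (hM : M ≤ p.d) :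
    p.lowN M * (p.θ (M - 1) - p.θ M) + p.upN M * (p.θ (M + 1) - p.θ M)
      = (p.θs 1 - p.θs 0) * (p.θ M - p.θ 0) + p.starSplit 1 := by
  have hq := hp.q_ne
  have hz : (p.q ^ 2) ^ M ≠ 0 := by positivity
  have hS : p.starSplit 1 = splitFun p.q (p.q ^ p.d) p.r₀⁻¹ p.b p.c p.bs p.cs
      (p.bd * p.q ^ p.d + p.cd * (p.q ^ p.d)⁻¹) (p.q ^ 2) := by
    rw [Params.starSplit, splitCoeff, pow_one]
  have hQ : (p.q ^ 2) ^ p.d = (p.q ^ p.d) ^ 2 := by ring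
  rw [hS]
  rcases eq_or_ne M 0 with rfl | hM0
  · rw [← up_linear_zero hq hp.Q_ne hp.bs_ne hp.e_ne hp.bs_cs_eq hp.gm_eq
      (hp.c_sub_ne' hθ (i := 0) (j := 1) (by omega) (by omega) (by omega) (by ring))]
    rw [Params.lowN, Params.upN, if_pos rfl, if_neg (Ne.symm hd), hp.up_eq, if_pos rfl]
    simp [Params.θ_eq, racahSeq]
  rcases eq_or_ne M p.d with rfl | hMd
  · have := low_linear_last hq hp.Q_ne hp.bs_ne hp.e_ne hp.bs_cs_eq hp.gm_eq
      (hp.c_sub_ne' hθ (i := p.d) (j := p.d - 1) (by omega) (by omega) (by omega)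
        (by rw [← hp.pow_pred hM0, hQ]))
    rw [Params.lowN, Params.upN, if_pos rfl, if_neg hM0, hp.low_eq, if_pos rfl]
    simp only [Params.θ_eq, Params.θs_eq, hp.racah_pred _ _ hM0]
    simp only [racahSeq, hQ]
    simpa using this
  · have := low_up_linear hq hp.Q_ne hp.bs_ne hp.e_ne hz hp.bs_cs_eq hp.gm_eq
      (hp.c_sub_ne' hθ (i := M) (j := M - 1) (by omega) (by omega) (by omega)
        (by rw [← hp.pow_pred hM0]))
      (hp.c_sub_ne' hθ (i := M + 1) (j := M - 1) (by omega) (by omega) (by omega)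
        (by rw [← pow_mul]; congr 1; omega))
      (hp.c_sub_ne' hθ (i := M + 1) (j := M) (by omega) (by omega) (by omega) (by ring))
    rw [hp.upN_eq hM0 hMd, Params.lowN, if_neg hM0, hp.low_eq, if_neg hMd]
    simp only [Params.θ_eq, Params.θs_eq, hp.racah_pred _ _ hM0]
    simp only [racahSeq, pow_succ (p.q ^ 2), pow_zero, one_mul, mul_one, inv_one]
    exact this

/-- The diagonal entries of the first Askey-Wilson relation in an eigenbasis of A, verified for the
explicit coefficients. -/
lemma star_diag (hd : p.d ≠ 0) {M : ℕ} (hM : M ≤ p.d) :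
    p.diagFactor M * (p.θs 0 - p.upN M - p.lowN M) = p.ω * p.θ M + p.η := by
  have hq := hp.q_ne
  have hz : (p.q ^ 2) ^ M ≠ 0 := by positivity
  have hQ : (p.q ^ 2) ^ p.d = (p.q ^ p.d) ^ 2 := by ring
  have hg := hp.b_mul_c.symm
  rw [hp.ω_eq, hp.η_eq]
  rcases eq_or_ne M 0 with rfl | hM0
  · have := up_diag_zero hq hp.Q_ne hp.bs_ne hp.e_ne hp.bs_cs_eq hp.gm_eq hg
      (hp.c_sub_ne' hθ (i := 0) (j := 1) (by omega) (by omega) (by omega) (by ring))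
    rw [Params.lowN, Params.upN, if_pos rfl, if_neg (Ne.symm hd), hp.up_eq, if_pos rfl]
    simp only [Params.θ_eq, Params.θs_eq, racahSeq, Params.diagFactor, pow_zero, mul_one,
      inv_one, zero_add, pow_one, sub_zero, one_mul]
    exact this
  rcases eq_or_ne M p.d with rfl | hMd
  · have := low_diag_last hq hp.Q_ne hp.bs_ne hp.e_ne hp.bs_cs_eq hp.gm_eq hg
      (hp.c_sub_ne' hθ (i := p.d) (j := p.d - 1) (by omega) (by omega) (by omega)
        (by rw [← hp.pow_pred hM0, hQ]))
    rw [Params.lowN, Params.upN, if_pos rfl, if_neg hM0, hp.low_eq, if_pos rfl]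
    simp only [Params.θ_eq, Params.θs_eq, racahSeq, Params.diagFactor, pow_zero, mul_one,
      inv_one, sub_zero, hQ]
    exact this
  · have := low_up_diag hq hp.Q_ne hp.bs_ne hp.e_ne hz hp.bs_cs_eq hp.gm_eq hg
      (hp.c_sub_ne' hθ (i := M) (j := M - 1) (by omega) (by omega) (by omega)
        (by rw [← hp.pow_pred hM0]))
      (hp.c_sub_ne' hθ (i := M + 1) (j := M - 1) (by omega) (by omega) (by omega)
        (by rw [← pow_mul]; congr 1; omega))
      (hp.c_sub_ne' hθ (i := M + 1) (j := M) (by omega) (by omega) (by omega) (by ring))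
    rw [hp.upN_eq hM0 hMd, Params.lowN, if_neg hM0, hp.low_eq, if_neg hMd]
    simp only [Params.θ_eq, Params.θs_eq, racahSeq, Params.diagFactor, pow_zero, mul_one, inv_one]
    exact this

omit hθ in
lemma diagFactor_ne {M : ℕ} (h1 : p.c - p.b * (((p.q ^ 2) ^ M) ^ 2 * p.q ^ 2) ≠ 0)
    (h2 : p.c * p.q ^ 2 - p.b * ((p.q ^ 2) ^ M) ^ 2 ≠ 0) : p.diagFactor M ≠ 0 := by
  have hq := hp.q_ne
  have hz : (p.q ^ 2) ^ M ≠ 0 := by positivity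
  refine mul_ne_zero (mul_ne_zero (neg_ne_zero.2 (pow_ne_zero _ hp.q_sub_ne)) ?_) ?_
  · intro h
    apply h1
    field_simp at h
    linear_combination -h
  · intro h
    apply h2
    field_simp at h
    linear_combination -h

lemma diagFactor_ne_of_interior {M : ℕ} (h0 : M ≠ 0) (hM : M < p.d) : p.diagFactor M ≠ 0 := by
  have hq := hp.q_ne
  refine hp.diagFactor_ne (hp.c_sub_ne' hθ (i := M + 1) (j := M) (by omega) (by omega) (by omega)
    (by ring)) ?_
  have := hp.c_sub_ne' hθ (i := M) (j := M - 1) (by omega) (by omega) (by omega)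
        (by rw [← hp.pow_pred h0])
  intro h
  apply this
  field_simp
  linear_combination h

/-- The coefficients of `A^*` in an eigenbasis of `A` are determined by the relations. -/
lemma star_unique (hd : p.d ≠ 0) {B C : ℕ → ℂ} {φ : ℂ} (hB : B p.d = 0) (hC : C 0 = 0)
    (hdiag : ∀ M ≤ p.d, p.diagFactor M * (p.θs 0 - B M - C M) = p.ω * p.θ M + p.η)
    (hlin : ∀ M ≤ p.d, C M * (p.θ (M - 1) - p.θ M) + B M * (p.θ (M + 1) - p.θ M)
      = (p.θs 1 - p.θs 0) * (p.θ M - p.θ 0) + φ) :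
    ∀ M ≤ p.d, B M = p.upN M ∧ C M = p.lowN M := by
  have hq := hp.q_ne
  have hBu : p.upN p.d = 0 := by simp [Params.upN]
  have hCl : p.lowN 0 = 0 := by simp [Params.lowN]
  have hφ : φ = p.starSplit 1 := by
    -- The factor may vanish at one end of the spectrum but not at both: at M = 0 this means c q² =
    -- b, at M = d it means c = b q^{4d+2}, and together they give q^{4d+4} = 1. At an end where it
    -- does not vanish the diagonal equation yields the single off-diagonal coefficient, and the
    -- linear equation then yields φ.
    by_cases h0 : p.diagFactor 0 = 0
    · have hFd : p.diagFactor p.d ≠ 0 := by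
        have hc : p.c * p.q ^ 2 = p.b := by
          by_contra hne
          refine hp.diagFactor_ne (M := 0) ?_ ?_ h0
          · exact hp.c_sub_ne' hθ (i := 0) (j := 1) (by omega) (by omega) (by omega) (by ring)
          · simpa [sub_eq_zero] using hne
        refine hp.diagFactor_ne ?_ ?_
        · intro h
          refine hp.q_pow_ne (n := 4 * p.d + 4) (by omega) ?_
          rw [← hc] at h
          have h' : p.c * (1 - p.q ^ (4 * p.d + 4)) = 0 := by
            rw [← h]; ring
          have := (mul_eq_zero.1 h').resolve_left hp.c_ne
          linear_combination -this
        · have := hp.c_sub_ne' hθ (i := p.d) (j := p.d - 1) (by omega) (by omega) (by omega)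
            (by rw [← hp.pow_pred hd])
          intro h
          apply this
          field_simp
          linear_combination h
      have e1 := hdiag p.d le_rfl
      rw [← hp.star_diag hθ hd le_rfl] at e1
      have e2 := mul_left_cancel₀ hFd e1
      have e3 : C p.d = p.lowN p.d := by rw [hB, hBu] at e2; linear_combination -e2
      have e4 := hlin p.d le_rfl
      have e5 := hp.star_linear hθ hd (le_refl p.d)
      rw [hB, e3] at e4
      rw [hBu] at e5
      linear_combination e5 - e4
    · have e1 := hdiag 0 (Nat.zero_le _)
      rw [← hp.star_diag hθ hd (Nat.zero_le _)] at e1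
      have e2 := mul_left_cancel₀ h0 e1
      have e3 : B 0 = p.upN 0 := by rw [hC, hCl] at e2; linear_combination -e2
      have e4 := hlin 0 (Nat.zero_le _)
      have e5 := hp.star_linear hθ hd (Nat.zero_le _)
      rw [hC, e3] at e4
      rw [hCl] at e5
      linear_combination e5 - e4
  intro M hM
  have e4 := hlin M hM
  have e5 := hp.star_linear hθ hd hM
  rw [← hφ] at e5
  rcases eq_or_ne M 0 with rfl | hM0
  · refine ⟨?_, hC.trans hCl.symm⟩
    rw [hC] at e4
    rw [hCl] at e5
    refine mul_right_cancel₀ (sub_ne_zero.2 (θ_ne hθ (i := 0 + 1) (j := 0)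
      (by omega) (by omega) (by omega))) ?_
    linear_combination e4 - e5
  rcases eq_or_ne M p.d with rfl | hMd
  · refine ⟨hB.trans hBu.symm, ?_⟩
    rw [hB] at e4
    rw [hBu] at e5
    refine mul_right_cancel₀ (sub_ne_zero.2 (θ_ne hθ (i := p.d - 1) (j := p.d)
      (by omega) (by omega) (by omega))) ?_
    linear_combination e4 - e5
  · have hF := hp.diagFactor_ne_of_interior hθ hM0 (by omega)
    have e1 := hdiag M hM
    rw [← hp.star_diag hθ hd hM] at e1
    have e2 := mul_left_cancel₀ hF e1
    -- In the interior the diagonal equation determines B + C; together with the linear one it forms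
    -- a 2 × 2 system of determinant ±(θ_{M+1} - θ_{M-1}).
    have hB' : B M = p.upN M := by
      refine mul_right_cancel₀ (sub_ne_zero.2 (θ_ne hθ (i := M + 1) (j := M - 1)
        (by omega) (by omega) (by omega))) ?_
      linear_combination e4 - e5 + (p.θ (M - 1) - p.θ M) * e2
    exact ⟨hB', by rw [hB'] at e2; linear_combination -e2⟩

end Params.Valid

end QRacah

/-! ### Cyclic vectors and existence of the normalized eigenbasis. -/

namespace QRacah

open Polynomial

section Cyclic

variable {V : Type*} [AddCommGroup V] [Module ℂ V] {n : ℕ}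

/-- Each application of X raises the top index by exactly one; this triangularity is what makes the
first basis vector cyclic. -/
lemma repr_pow_apply (e : Module.Basis (Fin (n + 1)) ℂ V) (X : Module.End ℂ V)
    (h0 : ∀ i j : Fin (n + 1), (j : ℕ) + 1 < i → e.repr (X (e j)) i = 0)
    (h1 : ∀ i j : Fin (n + 1), (j : ℕ) + 1 = i → e.repr (X (e j)) i ≠ 0) (k : ℕ) :
    (∀ i : Fin (n + 1), k < i → e.repr ((X ^ k) (e 0)) i = 0) ∧
    (∀ i : Fin (n + 1), k = i → e.repr ((X ^ k) (e 0)) i ≠ 0) := by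
  induction k with
  | zero =>
    refine ⟨fun i hi => ?_, fun i hi => ?_⟩
    · have : (0 : Fin (n + 1)) ≠ i := by rintro rfl; simp at hi
      simp [this]
    · have : (0 : Fin (n + 1)) = i := Fin.ext hi
      simp [this]
  | succ k ih =>
    obtain ⟨ih0, ih1⟩ := ih
    have key : ∀ i, e.repr ((X ^ (k + 1)) (e 0)) i
        = ∑ j, e.repr ((X ^ k) (e 0)) j * e.repr (X (e j)) i := by
      intro i
      rw [pow_succ', Module.End.mul_apply]
      conv_lhs => rw [← e.sum_repr ((X ^ k) (e 0))]
      simp only [map_sum, map_smul, Finsupp.finsetSum_apply, Finsupp.smul_apply, smul_eq_mul]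
    refine ⟨fun i hi => ?_, fun i hi => ?_⟩
    · rw [key]
      refine Finset.sum_eq_zero fun j _ => ?_
      rcases lt_or_ge k j with hj | hj
      · rw [ih0 j hj, zero_mul]
      · rw [h0 i j (by omega), mul_zero]
    · rw [key, Finset.sum_eq_single ⟨k, by omega⟩]
      · exact mul_ne_zero (ih1 _ rfl) (h1 _ _ (by simpa using hi))
      · intro j _ hj
        have hj' : (j : ℕ) ≠ k := fun h => hj (Fin.ext h)
        rcases lt_or_ge k j with hj | hj
        · rw [ih0 j hj, zero_mul]
        · rw [h0 i j (by omega), mul_zero]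
      · simp

lemma aeval_apply_ne_zero (e : Module.Basis (Fin (n + 1)) ℂ V) (X : Module.End ℂ V)
    (h0 : ∀ i j : Fin (n + 1), (j : ℕ) + 1 < i → e.repr (X (e j)) i = 0)
    (h1 : ∀ i j : Fin (n + 1), (j : ℕ) + 1 = i → e.repr (X (e j)) i ≠ 0)
    {p : ℂ[X]} (hp : p ≠ 0) (hn : p.natDegree ≤ n) : aeval X p (e 0) ≠ 0 := by
  intro h
  have h2 : e.repr (aeval X p (e 0)) ⟨p.natDegree, by omega⟩ = 0 := by rw [h]; simp
  rw [aeval_eq_sum_range, Finset.sum_range_succ] at h2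
  simp only [LinearMap.add_apply, LinearMap.sum_apply, LinearMap.smul_apply, map_add, map_sum,
    map_smul, Finsupp.add_apply, Finsupp.finsetSum_apply, Finsupp.smul_apply] at h2
  rw [Finset.sum_eq_zero, zero_add] at h2
  · refine (smul_ne_zero ?_ ?_) h2
    · exact leadingCoeff_ne_zero.2 hp
    · exact (repr_pow_apply e X h0 h1 _).2 _ rfl
  · intro k hk
    rw [(repr_pow_apply e X h0 h1 k).1, smul_zero]
    simpa using hk

/-- On polynomials of degree at most n the map P ↦ P(X) e_0 is injective by `aeval_apply_ne_zero`,
hence surjective by dimension. -/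
lemma exists_aeval_apply_eq (e : Module.Basis (Fin (n + 1)) ℂ V) (X : Module.End ℂ V)
    (h0 : ∀ i j : Fin (n + 1), (j : ℕ) + 1 < i → e.repr (X (e j)) i = 0)
    (h1 : ∀ i j : Fin (n + 1), (j : ℕ) + 1 = i → e.repr (X (e j)) i ≠ 0) (v : V) :
    ∃ p : ℂ[X], aeval X p (e 0) = v := by
  let φ : degreeLT ℂ (n + 1) →ₗ[ℂ] V :=
    (LinearMap.applyₗ (e 0)) ∘ₗ (aeval X).toLinearMap ∘ₗ (degreeLT ℂ (n + 1)).subtype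
  have hφ : ∀ x, φ x = aeval X (x : ℂ[X]) (e 0) := fun _ => rfl
  have hinj : Function.Injective φ := by
    rw [injective_iff_map_eq_zero]
    rintro ⟨p, hp⟩ h
    by_contra hne
    have hp0 : p ≠ 0 := fun h => hne (by simp [h])
    refine aeval_apply_ne_zero e X h0 h1 hp0 ?_ (by simpa [hφ] using h)
    rw [mem_degreeLT, ← natDegree_lt_iff_degree_lt hp0] at hp
    omega
  have : FiniteDimensional ℂ V := Module.Basis.finiteDimensional_of_finite e
  have : FiniteDimensional ℂ (degreeLT ℂ (n + 1)) :=
    (degreeLTEquiv ℂ (n + 1)).symm.finiteDimensional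
  have hdim : Module.finrank ℂ (degreeLT ℂ (n + 1)) = Module.finrank ℂ V := by
    rw [(degreeLTEquiv ℂ (n + 1)).finrank_eq, Module.finrank_eq_card_basis e]
    simp
  obtain ⟨x, hx⟩ := (LinearMap.injective_iff_surjective_of_finrank_eq_finrank hdim).1 hinj v
  exact ⟨x, hx⟩

lemma aeval_apply_of_apply_eq_smul (X : Module.End ℂ V) {μ : ℂ} {v : V} (h : X v = μ • v)
    (p : ℂ[X]) : aeval X p v = p.eval μ • v := by
  rw [aeval_eq_sum_range, eval_eq_sum_range, Finset.sum_smul]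
  simp only [LinearMap.sum_apply, LinearMap.smul_apply]
  refine Finset.sum_congr rfl fun k _ => ?_
  have h' : (X ^ k) v = μ ^ k • v := by
    clear * - h
    induction k with
    | zero => simp
    | succ k ih => rw [pow_succ, Module.End.mul_apply, h, map_smul, ih, smul_smul, pow_succ']
  rw [h', smul_smul]

lemma repr_apply_eig {ι : Type*} [Fintype ι] (e : Module.Basis ι ℂ V) {X : Module.End ℂ V}
    {θ : ι → ℂ} (h : ∀ i, X (e i) = θ i • e i) (v : V) (i : ι) :
    e.repr (X v) i = θ i * e.repr v i := by
  classical
  conv_lhs => rw [← e.sum_repr v]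
  simp only [map_sum, map_smul, h, Finsupp.finsetSum_apply, Finsupp.smul_apply,
    Module.Basis.repr_self, smul_eq_mul]
  rw [Finset.sum_eq_single i]
  · simp [mul_comm]
  · intro j _ hj; simp [hj]
  · simp

end Cyclic

section Eigenbasis

variable {V : Type*} [AddCommGroup V] [Module ℂ V] {p : Params} {A As : Module.End ℂ V}

/-- In any eigenbasis of `A`, the operator `A^*` is irreducible tridiagonal. -/
lemma irredTridiagonal_of_eig (hA : IsQRacahPair p A As)
    (e : Module.Basis (Fin (p.d + 1)) ℂ V) (he : ∀ M, A (e M) = p.θ M • e M) :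
    IrredTridiagonal (LinearMap.toMatrix e e As) := by
  obtain ⟨l, hl, ht⟩ := hA.leonard.basis
  have hinj := hA.leonard.inj
  have h0 : ∀ M i, i ≠ M → l.repr (e M) i = 0 := by
    intro M i hi
    have h1 := repr_apply_eig l hl (e M) i
    rw [he, map_smul, Finsupp.smul_apply, smul_eq_mul] at h1
    have h2 : (p.θ M - p.θ i) * l.repr (e M) i = 0 := by rw [sub_mul, h1, sub_self]
    exact (mul_eq_zero.1 h2).resolve_left (sub_ne_zero.2 fun h => hi (hinj h).symm)
  have h1 : ∀ M, e M = l.repr (e M) M • l M := by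
    intro M
    conv_lhs => rw [← l.sum_repr (e M)]
    refine Finset.sum_eq_single M (fun j _ hj => by rw [h0 M j hj, zero_smul]) (by simp)
  have h2 : ∀ M, l.repr (e M) M ≠ 0 := by
    intro M h
    have := h1 M
    rw [h, zero_smul] at this
    exact e.ne_zero M this
  have h3 : ∀ v i, l.repr v i = l.repr (e i) i * e.repr v i := by
    intro v i
    conv_lhs => rw [← e.sum_repr v]
    simp only [map_sum, map_smul, Finsupp.finsetSum_apply, Finsupp.smul_apply, smul_eq_mul]
    rw [Finset.sum_eq_single i (fun j _ hj => by rw [h0 j i hj.symm, mul_zero]) (by simp),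
      mul_comm]
  have h4 : ∀ i j, l.repr (e i) i * LinearMap.toMatrix e e As i j
      = l.repr (e j) j * LinearMap.toMatrix l l As i j := by
    intro i j
    rw [LinearMap.toMatrix_apply, LinearMap.toMatrix_apply, ← h3]
    conv_lhs => rw [h1 j]
    simp
  constructor
  · intro i j hij
    have := h4 i j
    rw [ht.1 i j hij, mul_zero] at this
    exact (mul_eq_zero.1 this).resolve_left (h2 i)
  · intro i j hij h
    have := h4 i j
    rw [h, mul_zero] at this
    exact mul_ne_zero (h2 j) (ht.2 i j hij) this.symm

/-- The conditions B d = 0 and C 0 = 0 make the values of `f` outside the range irrelevant,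
including the truncated index i - 1 at i = 0, so sequences indexed by ℕ can be used. -/
lemma sum_tridiagonal {d : ℕ} {T : Matrix (Fin (d + 1)) (Fin (d + 1)) ℂ}
    (hT : ∀ i j : Fin (d + 1), (i : ℕ) + 1 < j ∨ (j : ℕ) + 1 < i → T i j = 0)
    {a B C : ℕ → ℂ} (ha : ∀ i, T i i = a i) (hB : ∀ i j : Fin (d + 1), (i : ℕ) + 1 = j → T i j = B i)
    (hC : ∀ i j : Fin (d + 1), (j : ℕ) + 1 = i → T i j = C i) (hBd : B d = 0) (hC0 : C 0 = 0)
    (f : ℕ → ℂ) (i : Fin (d + 1)) :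
    ∑ j, T i j * f j = C i * f (i - 1) + a i * f i + B i * f (i + 1) := by
  have h : ∀ j : Fin (d + 1), T i j * f j
      = (if (j : ℕ) + 1 = i then C i * f (i - 1) else 0) + (if (j : ℕ) = i then a i * f i else 0)
        + (if (j : ℕ) = i + 1 then B i * f (i + 1) else 0) := by
    intro j
    rcases lt_trichotomy (j : ℕ) i with hlt | heq | hgt
    · rcases eq_or_ne ((j : ℕ) + 1) i with h1 | h1
      · rw [hC i j h1]
        rw [if_pos h1, if_neg hlt.ne, if_neg (by omega), show (j : ℕ) = i - 1 by omega]
        ring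
      · rw [hT i j (by omega)]
        simp [h1, hlt.ne, show (j : ℕ) ≠ i + 1 by omega]
    · rw [show j = i from Fin.ext heq, ha]
      simp
    · rcases eq_or_ne (j : ℕ) (i + 1) with h1 | h1
      · rw [hB i j h1.symm]
        simp [h1, show ¬ ((i : ℕ) + 1 + 1 = i) by omega]
      · rw [hT i j (by omega)]
        simp [h1, hgt.ne', show (j : ℕ) + 1 ≠ i by omega]
  simp only [h, Finset.sum_add_distrib]
  congr 1
  · congr 1
    · rcases Nat.eq_zero_or_pos (i : ℕ) with h0 | h0
      · simp [h0, hC0]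
      · rw [Finset.sum_eq_single (⟨i - 1, by omega⟩ : Fin (d + 1))]
        · rw [if_pos (by simp; omega)]
        · intro j _ hj
          rw [if_neg]
          intro h; apply hj; ext; simp; omega
        · simp
    · rw [Finset.sum_eq_single i]
      · simp
      · intro j _ hj; rw [if_neg (fun h => hj (Fin.ext h))]
      · simp
  · rcases Nat.lt_or_ge (i : ℕ) d with h0 | h0
    · rw [Finset.sum_eq_single (⟨i + 1, by omega⟩ : Fin (d + 1))]
      · simp
      · intro j _ hj
        rw [if_neg]
        intro h; apply hj; ext; simp; omega
      · simp
    · have : (i : ℕ) = d := by omega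
      simp [this, hBd]

/-- The right side is the coefficient with which A^*_{MM} occurs in the diagonal entry of A² A^* -
(q² + q⁻²) A A^* A + A^* A² - ρ A^*. -/
lemma diagFactor_eq (hp : p.Valid) (M : ℕ) :
    p.diagFactor M = (2 - (p.q ^ 2 + (p.q ^ 2)⁻¹)) * p.θ M ^ 2 - p.ρ := by
  have hq := hp.q_ne
  have hz : (p.q ^ 2) ^ M ≠ 0 := by positivity
  rw [p.ρ_eq, ← hp.b_mul_c, Params.diagFactor, Params.θ_eq, racahSeq]
  generalize (p.q ^ 2) ^ M = z at *
  field_simp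
  ring

lemma starMatrix_eq (p : Params) (i j : Fin (p.d + 1)) : p.starMatrix i j =
    if (j : ℕ) + 1 = i then p.lowN i else if (i : ℕ) + 1 = j then p.upN i
    else if i = j then p.θs 0 - p.upN i - p.lowN i else 0 := by
  unfold Params.starMatrix Params.lowN Params.upN
  rcases eq_or_ne ((j : ℕ) + 1) i with h1 | h1
  · rw [if_pos h1.symm, if_pos h1, if_neg (by omega)]
  rw [if_neg h1.symm, if_neg h1]
  rcases eq_or_ne ((i : ℕ) + 1) j with h2 | h2
  · rw [if_pos h2.symm, if_pos h2, if_neg (by omega), h2]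
  rw [if_neg h2.symm, if_neg h2]

/-- The eigenvectors of A are scaled so that their sum is the θ^*_0-eigenvector of A^*. Then A^* has
constant row sums θ^*_0; the Askey-Wilson relation and the next eigenvector of A^* give the two
families of equations required by `Params.Valid.star_unique`. -/
theorem exists_eigenbasis (hp : p.Valid) (hA : IsQRacahPair p A As) :
    ∃ e : Module.Basis (Fin (p.d + 1)) ℂ V, IsEigenbasis p A As e := by
  obtain ⟨l, hl, -⟩ := hA.leonard.basis
  obtain ⟨es, hes, ht⟩ := hA.leonard.basiss
  have hinj := hA.leonard.inj
  -- The θ^*_0-eigenvector is cyclic for A; if one of its components vanished, that component would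
  -- vanish on the whole orbit.
  have hw : ∀ M, l.repr (es 0) M ≠ 0 := by
    intro M h
    obtain ⟨P, hP⟩ := exists_aeval_apply_eq es A
      (fun i j hij => by simpa [LinearMap.toMatrix_apply] using ht.1 i j (Or.inr hij))
      (fun i j hij => by simpa [LinearMap.toMatrix_apply] using ht.2 i j (Or.inr hij)) (l M)
    have h1 : ∀ v, l.repr (aeval A P v) M = P.eval (p.θ M) * l.repr v M := by
      intro v
      conv_lhs => rw [← l.sum_repr v]
      simp only [map_sum, map_smul, aeval_apply_of_apply_eq_smul A (hl _),
        Finsupp.finsetSum_apply, Finsupp.smul_apply, smul_eq_mul, Module.Basis.repr_self]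
      rw [Finset.sum_eq_single M]
      · simp [mul_comm]
      · intro j _ hj; simp [hj]
      · simp
    have h2 := h1 (es 0)
    rw [hP, h, mul_zero] at h2
    simp at h2
  let e : Module.Basis (Fin (p.d + 1)) ℂ V := l.unitsSMul fun M => Units.mk0 _ (hw M)
  have he : ∀ M, e M = l.repr (es 0) M • l M := by
    intro M
    simp only [e, Module.Basis.unitsSMul_apply]
    rfl
  have hAe : ∀ M, A (e M) = p.θ M • e M := by
    intro M
    rw [he, map_smul, hl, smul_comm]
  have hsum : es 0 = ∑ M, e M := by
    simp only [he]
    exact (l.sum_repr (es 0)).symm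
  have htri := irredTridiagonal_of_eig hA e hAe
  set T := LinearMap.toMatrix e e As with hT
  have hTe : ∀ i j, e.repr (As (e j)) i = T i j := fun i j => by
    rw [hT, LinearMap.toMatrix_apply]
  let a : ℕ → ℂ := fun i => if h : i < p.d + 1 then T ⟨i, h⟩ ⟨i, h⟩ else 0
  let B : ℕ → ℂ := fun i => if h : i + 1 < p.d + 1 then T ⟨i, by omega⟩ ⟨i + 1, h⟩ else 0
  let C : ℕ → ℂ := fun i => if h : i ≠ 0 ∧ i < p.d + 1 then T ⟨i, h.2⟩ ⟨i - 1, by omega⟩ else 0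
  have ha : ∀ i, T i i = a i := fun i => by simp only [a, dif_pos i.isLt]
  have hB : ∀ i j : Fin (p.d + 1), (i : ℕ) + 1 = j → T i j = B i := by
    intro i j hij
    have h' : (i : ℕ) + 1 < p.d + 1 := by omega
    simp only [B, dif_pos h']
    congr 1
    exact Fin.ext hij.symm
  have hC : ∀ i j : Fin (p.d + 1), (j : ℕ) + 1 = i → T i j = C i := by
    intro i j hij
    have h' : (i : ℕ) ≠ 0 ∧ (i : ℕ) < p.d + 1 := by omega
    simp only [C, dif_pos h']
    congr 1
    ext; simp; omega
  have hBd : B p.d = 0 := by simp [B]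
  have hC0 : C 0 = 0 := by simp [C]
  have hTs : ∀ (f : ℕ → ℂ) (i : Fin (p.d + 1)),
      e.repr (As (∑ j : Fin (p.d + 1), f j • e j)) i
        = C i * f (i - 1) + a i * f i + B i * f (i + 1) := by
    intro f i
    rw [← sum_tridiagonal htri.1 ha hB hC hBd hC0]
    simp [Finsupp.finsetSum_apply, hTe, mul_comm]
  have hrow : ∀ i : Fin (p.d + 1), C i + a i + B i = p.θs 0 := by
    intro i
    have h := hTs (fun _ => 1) i
    simp only [one_smul, ← hsum, mul_one] at h
    rw [hes 0] at h
    rw [← h, hsum]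
    simp [Finsupp.single_apply]
  have hdiag : ∀ i : Fin (p.d + 1), p.diagFactor i * a i = p.ω * p.θ i + p.η := by
    intro i
    have h := congrArg (fun X : Module.End ℂ V => e.repr (X (e i)) i)
      (star_relation hp hA.askeyWilson)
    simp only [Module.End.mul_apply, LinearMap.add_apply, LinearMap.sub_apply,
      LinearMap.smul_apply, Module.End.one_apply, map_add, map_sub, map_smul, Finsupp.add_apply,
      Finsupp.sub_apply, Finsupp.smul_apply, smul_eq_mul, hAe, repr_apply_eig e hAe, hTe, ha,
      Module.Basis.repr_self, Finsupp.single_eq_same, mul_one] at h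
    rw [diagFactor_eq hp]
    linear_combination h
  have hBC : ∀ M ≤ p.d, B M = p.upN M ∧ C M = p.lowN M := by
    rcases eq_or_ne p.d 0 with hd | hd
    · intro M hM
      obtain rfl : M = 0 := by omega
      refine ⟨?_, by simp [hC0, Params.lowN]⟩
      rw [show B 0 = B p.d by rw [hd], hBd]
      simp [Params.upN, hd]
    have h1 : (1 : ℕ) < p.d + 1 := by omega
    set x := es.repr (A (es 0)) 0
    set y := es.repr (A (es 0)) ⟨1, h1⟩
    have hx : A (es 0) = x • es 0 + y • es ⟨1, h1⟩ := by
      conv_lhs => rw [← es.sum_repr (A (es 0))]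
      have h01 : (0 : Fin (p.d + 1)) ≠ ⟨1, h1⟩ := by simp [Fin.ext_iff]
      rw [← Finset.sum_pair (f := fun i => es.repr (A (es 0)) i • es i) h01]
      symm
      refine Finset.sum_subset (Finset.subset_univ _) fun i _ hi => ?_
      have h3 : (i : ℕ) ≠ 0 := fun h => hi (by simp [Fin.ext_iff, h])
      have h4 : (i : ℕ) ≠ 1 := fun h => hi (by simp [Fin.ext_iff, h])
      have h2 := ht.1 i 0 (Or.inr (by rw [Fin.val_zero]; omega))
      rw [LinearMap.toMatrix_apply] at h2
      rw [h2, zero_smul]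
    -- A es_0 lies in the span of es_0 and es_1, so subtraction of its es_0 part leaves a multiple
    -- of es_1, the θ^*_1-eigenvector.
    have hAx : As (A (es 0) - x • es 0) = p.θs 1 • (A (es 0) - x • es 0) := by
      rw [hx, add_sub_cancel_left, map_smul, hes, smul_comm]
    have hv : A (es 0) - x • es 0
        = ∑ j : Fin (p.d + 1), ((fun M : ℕ => p.θ M - x) j) • e j := by
      rw [hsum, map_sum, Finset.smul_sum, ← Finset.sum_sub_distrib]
      simp [hAe, sub_smul]
    have hlin : ∀ i : Fin (p.d + 1), C i * (p.θ (i - 1) - x) + a i * (p.θ i - x)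
        + B i * (p.θ (i + 1) - x) = p.θs 1 * (p.θ i - x) := by
      intro i
      have h := hTs (fun M => p.θ M - x) i
      rw [← hv, hAx, hv] at h
      rw [← h]
      simp [Finsupp.single_apply]
    -- This φ turns (θ^*_1 - θ^*_0)(θ_M - θ_0) + φ into (θ^*_1 - θ^*_0)(θ_M - x), the form delivered
    -- by `hlin` minus a multiple of `hrow`.
    refine hp.star_unique hinj hd (φ := (p.θs 1 - p.θs 0) * (p.θ 0 - x)) hBd hC0 ?_ ?_
    · intro M hM
      have h2 := hrow ⟨M, by omega⟩
      have h3 := hdiag ⟨M, by omega⟩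
      simp only at h2 h3
      rw [← h3, ← h2]; ring
    · intro M hM
      have h2 := hrow ⟨M, by omega⟩
      have h3 := hlin ⟨M, by omega⟩
      simp only at h2 h3
      linear_combination h3 - (p.θ M - x) * h2
  refine ⟨e, hAe, fun M => ?_⟩
  rw [← e.sum_repr (As (e M))]
  refine Finset.sum_congr rfl fun i _ => ?_
  congr 1
  rw [hTe, starMatrix_eq]
  have hi := hBC i (by omega)
  split_ifs with h1 h2 h3
  · rw [hC i M h1, hi.2]
  · rw [hB i M h2, hi.1]
  · subst h3
    rw [ha, ← hi.1, ← hi.2, ← hrow i]; ring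
  · exact htri.1 i M (by
      have : (i : ℕ) ≠ M := fun h => h3 (Fin.ext h)
      omega)

end Eigenbasis

end QRacah

/-! ### Action of A^⋄ on the eigenbasis, and split forms from both ends of the spectrum. -/

namespace QRacah

open Polynomial

section BaseIdentities

variable {q Q b c bs cs bd cd r : ℂ}

lemma diamond_base_first (hq : q ≠ 0) (hQ : Q ≠ 0) (hb : b ≠ 0) (hbs : bs ≠ 0) (hbd : bd ≠ 0)
    (hr : r ≠ 0) (h1 : b * c = r⁻¹ ^ 2) (h2 : bs * cs = r⁻¹ ^ 2) (h3 : bd * cd = r⁻¹ ^ 2) :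
    r * ((b + c) * (((b + c) - (b * q ^ 2 + c * (q ^ 2)⁻¹)) * (bs + cs)
          + splitFun q Q r⁻¹ b c bs cs (bd * Q + cd * Q⁻¹) (q ^ 2))
        - ((b + c) - (b * q ^ 2 + c * (q ^ 2)⁻¹)) * ((b * Q + c * Q⁻¹) * (bs * Q + cs * Q⁻¹)
          - r⁻¹ * (q * Q + (q * Q)⁻¹) * (bd * Q + cd * Q⁻¹)))
      = (q + q⁻¹) * (((b + c) - (b * q ^ 2 + c * (q ^ 2)⁻¹)) * (bd + cd)
          + splitFun q Q r⁻¹ bd cd b c (bs * Q + cs * Q⁻¹) (q ^ 2)) := by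
  obtain rfl : c = r⁻¹ ^ 2 / b := by field_simp; field_simp at h1; linear_combination h1
  obtain rfl : cs = r⁻¹ ^ 2 / bs := by field_simp; field_simp at h2; linear_combination h2
  obtain rfl : cd = r⁻¹ ^ 2 / bd := by field_simp; field_simp at h3; linear_combination h3
  unfold splitFun
  field_simp
  ring

lemma diamond_base_last (hq : q ≠ 0) (hQ : Q ≠ 0) (hb : b ≠ 0) (hbs : bs ≠ 0) (hbd : bd ≠ 0)
    (hr : r ≠ 0) (h1 : b * c = r⁻¹ ^ 2) (h2 : bs * cs = r⁻¹ ^ 2) (h3 : bd * cd = r⁻¹ ^ 2) :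
    r * ((b * Q ^ 2 + c * (Q ^ 2)⁻¹)
          * (((b * Q ^ 2 + c * (Q ^ 2)⁻¹) - (b * (Q ^ 2 / q ^ 2) + c * (Q ^ 2 / q ^ 2)⁻¹)) * (bs + cs)
          + ((bs * q ^ 2 + cs * (q ^ 2)⁻¹) - (bs + cs)) * ((b * Q ^ 2 + c * (Q ^ 2)⁻¹) - (b + c))
          + splitFun q Q r⁻¹ b c bs cs (bd * Q + cd * Q⁻¹) (q ^ 2))
        - ((b * Q ^ 2 + c * (Q ^ 2)⁻¹) - (b * (Q ^ 2 / q ^ 2) + c * (Q ^ 2 / q ^ 2)⁻¹))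
          * ((b * Q + c * Q⁻¹) * (bs * Q + cs * Q⁻¹)
          - r⁻¹ * (q * Q + (q * Q)⁻¹) * (bd * Q + cd * Q⁻¹)))
      = (q + q⁻¹) * (((b * Q ^ 2 + c * (Q ^ 2)⁻¹) - (b * (Q ^ 2 / q ^ 2) + c * (Q ^ 2 / q ^ 2)⁻¹))
          * (bd + cd)
          + splitFun q Q r⁻¹ bd cd (c * (Q ^ 2)⁻¹) (b * Q ^ 2) (bs * Q + cs * Q⁻¹) (q ^ 2)) := by
  obtain rfl : c = r⁻¹ ^ 2 / b := by field_simp; field_simp at h1; linear_combination h1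
  obtain rfl : cs = r⁻¹ ^ 2 / bs := by field_simp; field_simp at h2; linear_combination h2
  obtain rfl : cd = r⁻¹ ^ 2 / bd := by field_simp; field_simp at h3; linear_combination h3
  unfold splitFun
  field_simp
  ring

end BaseIdentities

namespace Params

/-- The eigenvalue sequence of `A^⋄`. -/
def θd (p : Params) (n : ℕ) : ℂ := racahSeq p.q p.bd p.cd n

/-- The constant `-ω / (q - q⁻¹)²`. -/
def ωRed (p : Params) : ℂ :=
  (p.b * p.q ^ p.d + p.c * (p.q ^ p.d)⁻¹) * (p.bs * p.q ^ p.d + p.cs * (p.q ^ p.d)⁻¹)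
    - p.r₀⁻¹ * (p.q * p.q ^ p.d + (p.q * p.q ^ p.d)⁻¹) * (p.bd * p.q ^ p.d + p.cd * (p.q ^ p.d)⁻¹)

/-- The middle value of the eigenvalue sequence of `A^*`. -/
def midS (p : Params) : ℂ := p.bs * p.q ^ p.d + p.cs * (p.q ^ p.d)⁻¹

end Params

section DiamondAction

variable {V : Type*} [AddCommGroup V] [Module ℂ V] {p : Params} {A As : Module.End ℂ V}

lemma repr_star {e : Module.Basis (Fin (p.d + 1)) ℂ V} (he : IsEigenbasis p A As e)
    (i j : Fin (p.d + 1)) : e.repr (As (e j)) i = p.starMatrix i j := by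
  rw [he.tridiag]
  simp [Finsupp.single_apply]

lemma starMatrix_irred (hA : IsQRacahPair p A As) {e : Module.Basis (Fin (p.d + 1)) ℂ V}
    (he : IsEigenbasis p A As e) : IrredTridiagonal p.starMatrix := by
  have h := irredTridiagonal_of_eig hA e he.eig
  convert h using 1
  ext i j
  rw [LinearMap.toMatrix_apply, repr_star he]

lemma repr_diamond {e : Module.Basis (Fin (p.d + 1)) ℂ V}
    (he : IsEigenbasis p A As e) (i j : Fin (p.d + 1)) :
    e.repr (diamond p A As (e j)) i
      = p.r₀ / (p.q ^ 2 - (p.q ^ 2)⁻¹) * ((p.q * p.θ j - p.q⁻¹ * p.θ i) * p.starMatrix i j)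
        + if i = j then p.r₀ / (p.q ^ 2 - (p.q ^ 2)⁻¹) * p.ω / (p.q - p.q⁻¹) else 0 := by
  simp only [diamond, qComm, LinearMap.add_apply, LinearMap.smul_apply, LinearMap.sub_apply,
    Module.End.mul_apply, he.eig, map_smul, map_add, map_sub, Finsupp.add_apply,
    Finsupp.smul_apply, Finsupp.sub_apply, smul_eq_mul, repr_star he, repr_apply_eig e he.eig,
    Module.End.one_apply, Module.Basis.repr_self, Finsupp.single_apply, eq_comm (a := j)]
  split_ifs <;> ring

lemma repr_diamond_eq_zero (hA : IsQRacahPair p A As)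
    {e : Module.Basis (Fin (p.d + 1)) ℂ V} (he : IsEigenbasis p A As e) (i j : Fin (p.d + 1))
    (hij : (i : ℕ) + 1 < j ∨ (j : ℕ) + 1 < i) : e.repr (diamond p A As (e j)) i = 0 := by
  rw [repr_diamond he, (starMatrix_irred hA he).1 i j hij, if_neg (by rintro rfl; omega)]
  ring

/-- The off-diagonal entry contains q θ_j - q⁻¹ θ_i, which for neighbouring indices is a monomial in
b or in c times q² - q⁻² and cannot vanish. -/
lemma repr_diamond_ne_zero (hp : p.Valid) (hA : IsQRacahPair p A As)
    {e : Module.Basis (Fin (p.d + 1)) ℂ V} (he : IsEigenbasis p A As e) (i j : Fin (p.d + 1))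
    (hij : (i : ℕ) + 1 = j ∨ (j : ℕ) + 1 = i) : e.repr (diamond p A As (e j)) i ≠ 0 := by
  have hq := hp.q_ne
  rw [repr_diamond he, if_neg (by rintro rfl; omega), add_zero]
  refine mul_ne_zero (div_ne_zero hp.r₀_ne hp.q_sq_sub_ne)
    (mul_ne_zero ?_ ((starMatrix_irred hA he).2 i j hij))
  rcases hij with h | h
  · have : p.q * p.θ j - p.q⁻¹ * p.θ i
        = p.b * (p.q ^ 2) ^ (i : ℕ) * p.q * (p.q ^ 2 - (p.q ^ 2)⁻¹) := by
      rw [← h, p.θ_eq, p.θ_eq, racahSeq, racahSeq, pow_succ (p.q ^ 2)]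
      have hz : (p.q ^ 2) ^ (i : ℕ) ≠ 0 := by positivity
      generalize (p.q ^ 2) ^ (i : ℕ) = z at *
      field_simp
      ring
    rw [this]
    exact mul_ne_zero (mul_ne_zero (mul_ne_zero hp.b_ne (by positivity)) hq) hp.q_sq_sub_ne
  · have : p.q * p.θ j - p.q⁻¹ * p.θ i
        = p.c * ((p.q ^ 2) ^ (j : ℕ))⁻¹ * p.q⁻¹ * (p.q ^ 2 - (p.q ^ 2)⁻¹) := by
      rw [← h, p.θ_eq, p.θ_eq, racahSeq, racahSeq, pow_succ (p.q ^ 2)]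
      have hz : (p.q ^ 2) ^ (j : ℕ) ≠ 0 := by positivity
      generalize (p.q ^ 2) ^ (j : ℕ) = z at *
      field_simp
      ring
    rw [this]
    exact mul_ne_zero (mul_ne_zero (mul_ne_zero hp.c_ne (by positivity)) (inv_ne_zero hq))
      hp.q_sq_sub_ne

lemma repr_diamond_diag (hp : p.Valid) {e : Module.Basis (Fin (p.d + 1)) ℂ V}
    (he : IsEigenbasis p A As e) (k : Fin (p.d + 1)) :
    e.repr (diamond p A As (e k)) k
      = p.r₀ / (p.q + p.q⁻¹) * (p.θ k * p.starMatrix k k - p.ωRed) := by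
  have h1 := hp.q_sub_ne
  have h2 := hp.q_add_ne
  have hs : p.q ^ 2 - (p.q ^ 2)⁻¹ = (p.q + p.q⁻¹) * (p.q - p.q⁻¹) := by
    have hq := hp.q_ne
    field_simp; ring
  have hω : p.ω = -(p.q - p.q⁻¹) ^ 2 * p.ωRed := by rw [hp.ω_eq, awLin, Params.ωRed]
  rw [repr_diamond he, if_pos rfl, hω, hs,
    show p.q * p.θ k - p.q⁻¹ * p.θ k = (p.q - p.q⁻¹) * p.θ k by ring]
  generalize p.q - p.q⁻¹ = s at *
  generalize p.q + p.q⁻¹ = t at *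
  field_simp
  ring

/-- At an end of the spectrum D |θ_k⟩ has only one neighbour, so A - θ' removes it and only the
diagonal entry of D remains to be computed. -/
lemma apply_diamond_sub {e : Module.Basis (Fin (p.d + 1)) ℂ V}
    (he : IsEigenbasis p A As e) {k : Fin (p.d + 1)} {θ' t : ℂ}
    (h : ∀ i, i ≠ k → e.repr (diamond p A As (e k)) i ≠ 0 → p.θ i = θ') :
    A (diamond p A As (e k) - t • e k) = θ' • (diamond p A As (e k) - t • e k)
      + ((p.θ k - θ') * (e.repr (diamond p A As (e k)) k - t)) • e k := by
  apply e.repr.injective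
  ext i
  rw [repr_apply_eig e he.eig]
  simp only [map_sub, map_add, map_smul, Finsupp.sub_apply, Finsupp.add_apply,
    Finsupp.smul_apply, smul_eq_mul, Module.Basis.repr_self, Finsupp.single_apply]
  rcases eq_or_ne i k with rfl | hik
  · simp only [if_true]; ring
  · rw [if_neg hik.symm]
    rcases eq_or_ne (e.repr (diamond p A As (e k)) i) 0 with h0 | h0
    · rw [h0]; ring
    · rw [h i hik h0]; ring

/-- The split form of `(A^⋄, A)` starting from an eigenvector of `A`. -/
lemma diamond_split (hp : p.Valid) (hA : AskeyWilson p A As) {y y' : ℂ} {v : V} (hy0 : y ≠ 0)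
    (hy : y * y' = p.r₀⁻¹ ^ 2)
    (hmid : y * p.q ^ p.d + y' * (p.q ^ p.d)⁻¹ = p.b * p.q ^ p.d + p.c * (p.q ^ p.d)⁻¹)
    (h0 : A v = racahSeq p.q y y' 0 • v)
    (h1 : A (diamond p A As v - p.θd 0 • v)
      = racahSeq p.q y y' 1 • (diamond p A As v - p.θd 0 • v)
        + splitCoeff p.q (p.q ^ p.d) p.r₀⁻¹ p.bd p.cd y y' p.midS 1 • v) (n : ℕ) :
    A (aeval (diamond p A As) (newton p.θd (n + 1)) v)
      = racahSeq p.q y y' (n + 1) • aeval (diamond p A As) (newton p.θd (n + 1)) v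
        + splitCoeff p.q (p.q ^ p.d) p.r₀⁻¹ p.bd p.cd y y' p.midS (n + 1)
            • aeval (diamond p A As) (newton p.θd n) v := by
  have hX : ∀ P : ℂ[X], aeval (diamond p A As) (X * P) v
      = diamond p A As (aeval (diamond p A As) P v) := by
    intro P; rw [map_mul, aeval_X, Module.End.mul_apply]
  refine split_action (V' := V) (X' := diamond p A As) hp.q_ne hp.Q_ne hp.bd_ne hy0 hp.bd_mul_cd hy
    (i := LinearMap.applyₗ v ∘ₗ (aeval (diamond p A As)).toLinearMap)
    (Y := A ∘ₗ LinearMap.applyₗ v ∘ₗ (aeval (diamond p A As)).toLinearMap) hX ?_ ?_ ?_ n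
  · intro P
    simp only [LinearMap.comp_apply, AlgHom.toLinearMap_apply, LinearMap.applyₗ_apply_apply, hX]
    generalize aeval (diamond p A As) P v = w
    have h := congrArg (fun X : Module.End ℂ V => X w) (diamond_relation hp hA)
    simp only [Module.End.mul_apply, LinearMap.add_apply, LinearMap.sub_apply,
      LinearMap.smul_apply, Module.End.one_apply] at h
    rw [h, hmid, p.ρ_eq, hp.ηs_eq,
      awLin_comm p.q _ _ (p.bs * p.q ^ p.d + p.cs * (p.q ^ p.d)⁻¹)]
    rfl
  · simpa using h0
  · have e1 : newton (racahSeq p.q p.bd p.cd) 1 = X - C (p.θd 0) := by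
      simp [newton, Params.θd]
    rw [e1]
    simpa [Module.algebraMap_end_apply] using h1

/-- The factor 1 - z/(q² Q²) of `splitFun` vanishes at z = q^{2(d+1)}. This is what terminates the
split form; it also settles the case d = 0, in which the first coefficient is already the last. -/
lemma splitCoeff_last (hp : p.Valid) (x x' y y' m : ℂ) :
    splitCoeff p.q (p.q ^ p.d) p.r₀⁻¹ x x' y y' m (p.d + 1) = 0 := by
  have hq := hp.q_ne
  have : (p.q ^ 2) ^ (p.d + 1) / (p.q ^ 2 * (p.q ^ p.d) ^ 2) = 1 := by
    rw [pow_succ (p.q ^ 2)]; field_simp; ring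
  simp [splitCoeff, splitFun, this]

/-- The first step of the split form of (A^⋄, A) from |θ_0⟩. The diagonal entry of A^* at M = 0,
known from `Params.Valid.star_linear`, determines that of D. -/
lemma diamond_first (hp : p.Valid) (hA : IsQRacahPair p A As)
    {e : Module.Basis (Fin (p.d + 1)) ℂ V} (he : IsEigenbasis p A As e) :
    A (diamond p A As (e 0) - p.θd 0 • e 0)
      = racahSeq p.q p.b p.c 1 • (diamond p A As (e 0) - p.θd 0 • e 0)
        + splitCoeff p.q (p.q ^ p.d) p.r₀⁻¹ p.bd p.cd p.b p.c p.midS 1 • e 0 := by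
  have h := apply_diamond_sub he (k := 0) (θ' := p.θ 1) (t := p.θd 0) (by
    intro i hi h
    by_contra hne
    have h1 : (i : ℕ) ≠ 1 := by intro h; rw [h] at hne; exact hne rfl
    have h0 : (i : ℕ) ≠ 0 := fun h => hi (Fin.ext h)
    exact h (repr_diamond_eq_zero hA he _ _ (Or.inr (by rw [Fin.val_zero]; omega))))
  rw [h, p.θ_eq 1]
  congr 2
  rw [repr_diamond_diag hp he, Fin.val_zero]
  have hS : (p.θ 0 - p.θ 1) * p.starMatrix 0 0 = (p.θ 0 - p.θ 1) * p.θs 0 + p.starSplit 1 := by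
    rw [starMatrix_eq, if_neg (by simp), if_neg (by simp), if_pos rfl, Fin.val_zero]
    rcases eq_or_ne p.d 0 with hd | hd
    · have := splitCoeff_last hp p.b p.c p.bs p.cs (p.bd * p.q ^ p.d + p.cd * (p.q ^ p.d)⁻¹)
      rw [Params.starSplit, show (1 : ℕ) = p.d + 1 by omega, this]
      simp [Params.upN, Params.lowN, hd]
    · have := hp.star_linear hA.leonard.inj hd (Nat.zero_le _)
      simp only [Params.lowN, if_true, zero_add, sub_self, mul_zero] at this ⊢
      linear_combination this
  have key := diamond_base_first hp.q_ne hp.Q_ne hp.b_ne hp.bs_ne hp.bd_ne hp.r₀_ne hp.b_mul_c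
    hp.bs_mul_cs hp.bd_mul_cd
  have e1 : splitCoeff p.q (p.q ^ p.d) p.r₀⁻¹ p.bd p.cd p.b p.c p.midS 1
      = splitFun p.q (p.q ^ p.d) p.r₀⁻¹ p.bd p.cd p.b p.c p.midS (p.q ^ 2) := by
    rw [splitCoeff, pow_one]
  have e2 : p.starSplit 1 = splitFun p.q (p.q ^ p.d) p.r₀⁻¹ p.b p.c p.bs p.cs
      (p.bd * p.q ^ p.d + p.cd * (p.q ^ p.d)⁻¹) (p.q ^ 2) := by
    rw [Params.starSplit, splitCoeff, pow_one]
  have hadd := hp.q_add_ne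
  rw [e2] at hS
  rw [e1, ← p.θ_eq]
  simp only [Params.θ_eq, Params.θs_eq, Params.θd, racahSeq, pow_zero, pow_one, mul_one,
    inv_one] at hS ⊢
  refine mul_left_cancel₀ hadd ?_
  rw [Params.midS, Params.ωRed]
  generalize hsplit : splitFun p.q (p.q ^ p.d) p.r₀⁻¹ p.b p.c p.bs p.cs
      (p.bd * p.q ^ p.d + p.cd * (p.q ^ p.d)⁻¹) (p.q ^ 2) = sp at *
  generalize p.q + p.q⁻¹ = t at *
  rw [mul_sub, mul_sub, div_mul_eq_mul_div, mul_div_assoc', mul_div_assoc', mul_div_cancel_left₀ _ hadd]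
  linear_combination key + p.r₀ * (p.b + p.c) * hS

/-- The same from |θ_d⟩, with the reversed sequence n ↦ θ_{d-n}: its parameters are (c q^{-2d}, b
q^{2d}). -/
lemma diamond_last (hp : p.Valid) (hA : IsQRacahPair p A As)
    {e : Module.Basis (Fin (p.d + 1)) ℂ V} (he : IsEigenbasis p A As e) :
    A (diamond p A As (e (Fin.last _)) - p.θd 0 • e (Fin.last _))
      = racahSeq p.q (p.c * ((p.q ^ p.d) ^ 2)⁻¹) (p.b * (p.q ^ p.d) ^ 2) 1
          • (diamond p A As (e (Fin.last _)) - p.θd 0 • e (Fin.last _))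
        + splitCoeff p.q (p.q ^ p.d) p.r₀⁻¹ p.bd p.cd (p.c * ((p.q ^ p.d) ^ 2)⁻¹)
            (p.b * (p.q ^ p.d) ^ 2) p.midS 1 • e (Fin.last _) := by
  have hq := hp.q_ne
  have hQ := hp.Q_ne
  have hQ2 : (p.q ^ 2) ^ p.d = (p.q ^ p.d) ^ 2 := by ring
  set θ' : ℂ := p.b * ((p.q ^ p.d) ^ 2 / p.q ^ 2) + p.c * ((p.q ^ p.d) ^ 2 / p.q ^ 2)⁻¹ with hθ
  have hθd : p.d ≠ 0 → p.θ (p.d - 1) = θ' := by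
    intro hd
    rw [p.θ_eq, hp.racah_pred _ _ hd, hQ2]
  have h := apply_diamond_sub he (k := Fin.last _) (θ' := θ') (t := p.θd 0) (by
    intro i hi h
    have h0 : (i : ℕ) ≠ p.d := fun h => hi (Fin.ext h)
    by_contra hne
    have h1 : (i : ℕ) ≠ p.d - 1 := by
      intro h; rw [h] at hne; exact hne (hθd (by omega))
    exact h (repr_diamond_eq_zero hA he _ _ (Or.inl (by rw [Fin.val_last]; omega))))
  have hθ' : racahSeq p.q (p.c * ((p.q ^ p.d) ^ 2)⁻¹) (p.b * (p.q ^ p.d) ^ 2) 1 = θ' := by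
    rw [racahSeq, pow_one, hθ]
    field_simp
    ring
  rw [h, hθ']
  congr 2
  rw [repr_diamond_diag hp he, Fin.val_last]
  have hS : (p.θ p.d - θ') * p.starMatrix (Fin.last _) (Fin.last _)
      = (p.θ p.d - θ') * p.θs 0 + (p.θs 1 - p.θs 0) * (p.θ p.d - p.θ 0)
        + p.starSplit 1 := by
    rw [starMatrix_eq, if_neg (by simp), if_neg (by simp), if_pos rfl, Fin.val_last]
    rcases eq_or_ne p.d 0 with hd | hd
    · have := splitCoeff_last hp p.b p.c p.bs p.cs (p.bd * p.q ^ p.d + p.cd * (p.q ^ p.d)⁻¹)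
      rw [Params.starSplit, show (1 : ℕ) = p.d + 1 by omega, this]
      simp [Params.upN, Params.lowN, hd]
    · have := hp.star_linear hA.leonard.inj hd le_rfl
      rw [hθd hd] at this
      simp only [Params.upN, if_true, zero_mul, add_zero] at this ⊢
      linear_combination this
  have key := diamond_base_last hp.q_ne hp.Q_ne hp.b_ne hp.bs_ne hp.bd_ne hp.r₀_ne hp.b_mul_c
    hp.bs_mul_cs hp.bd_mul_cd
  have e1 : splitCoeff p.q (p.q ^ p.d) p.r₀⁻¹ p.bd p.cd (p.c * ((p.q ^ p.d) ^ 2)⁻¹)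
            (p.b * (p.q ^ p.d) ^ 2) p.midS 1
      = splitFun p.q (p.q ^ p.d) p.r₀⁻¹ p.bd p.cd (p.c * ((p.q ^ p.d) ^ 2)⁻¹)
            (p.b * (p.q ^ p.d) ^ 2) p.midS (p.q ^ 2) := by
    rw [splitCoeff, pow_one]
  have e2 : p.starSplit 1 = splitFun p.q (p.q ^ p.d) p.r₀⁻¹ p.b p.c p.bs p.cs
      (p.bd * p.q ^ p.d + p.cd * (p.q ^ p.d)⁻¹) (p.q ^ 2) := by
    rw [Params.starSplit, splitCoeff, pow_one]
  have hadd := hp.q_add_ne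
  rw [e2] at hS
  rw [e1]
  simp only [Params.θ_eq, Params.θs_eq, Params.θd] at hS ⊢
  simp only [racahSeq, hQ2, pow_zero, pow_one, mul_one, inv_one] at hS ⊢
  refine mul_left_cancel₀ hadd ?_
  rw [Params.midS, Params.ωRed]
  generalize splitFun p.q (p.q ^ p.d) p.r₀⁻¹ p.b p.c p.bs p.cs
      (p.bd * p.q ^ p.d + p.cd * (p.q ^ p.d)⁻¹) (p.q ^ 2) = sp at *
  generalize p.q + p.q⁻¹ = t at *
  rw [mul_sub, mul_sub, div_mul_eq_mul_div, mul_div_assoc', mul_div_assoc', mul_div_cancel_left₀ _ hadd]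
  linear_combination key + p.r₀ * (p.b * (p.q ^ p.d) ^ 2 + p.c * ((p.q ^ p.d) ^ 2)⁻¹) * hS

end DiamondAction

end QRacah

/-! ### The characteristic polynomial of A^⋄ on the reference state. -/

namespace QRacah

open Polynomial

section CharPoly

variable {V : Type*} [AddCommGroup V] [Module ℂ V] {p : Params} {A As : Module.End ℂ V}

lemma eq_zero_of_apply_eq_smul {ι : Type*} [Fintype ι] (e : Module.Basis ι ℂ V)
    {X : Module.End ℂ V} {θ : ι → ℂ} (h : ∀ i, X (e i) = θ i • e i) {μ : ℂ} {v : V}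
    (hv : X v = μ • v) (hμ : ∀ i, θ i ≠ μ) : v = 0 := by
  apply e.repr.injective
  ext i
  have h1 := repr_apply_eig e h v i
  rw [hv, map_smul, Finsupp.smul_apply, smul_eq_mul] at h1
  have h2 : (θ i - μ) * e.repr v i = 0 := by rw [sub_mul, h1, sub_self]
  simpa using (mul_eq_zero.1 h2).resolve_left (sub_ne_zero.2 (hμ i))

lemma racah_eq_iff {b c z w : ℂ} (hz : z ≠ 0) (hw : w ≠ 0) (hzw : z ≠ w)
    (h : b * z + c * z⁻¹ = b * w + c * w⁻¹) : c = b * (z * w) := by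
  refine mul_left_cancel₀ (sub_ne_zero.2 hzw) ?_
  field_simp at h
  linear_combination -h

/-- The characteristic polynomial of `A^⋄` annihilates the reference state. -/
theorem newton_diamond_apply (hp : p.Valid) (hA : IsQRacahPair p A As)
    {e : Module.Basis (Fin (p.d + 1)) ℂ V} (he : IsEigenbasis p A As e) :
    aeval (diamond p A As) (newton p.θd (p.d + 1)) (e 0) = 0 := by
  have hq := hp.q_ne
  have hQ := hp.Q_ne
  have hQ2 : (p.q ^ 2) ^ p.d = (p.q ^ p.d) ^ 2 := by ring
  have hpow : ∀ n : ℕ, (p.q ^ 2) ^ n ≠ 0 := fun n => by positivity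
  have hpinj : ∀ {m n : ℕ}, (p.q ^ 2) ^ m = (p.q ^ 2) ^ n → m = n := by
    intro m n h
    rw [← pow_mul, ← pow_mul] at h
    have := hp.q_pow_inj h
    omega
  by_contra hne
  -- Since the last split coefficient vanishes, the vector in question satisfies A v = θ_{d+1} v. It
  -- is zero unless θ_{d+1} coincides with some θ_j, which forces c = b q^{2(j+d+1)}.
  have h1 := diamond_split hp hA.askeyWilson hp.b_ne hp.b_mul_c rfl
    (v := e 0) (by rw [he.eig, p.θ_eq, Fin.val_zero]) (diamond_first hp hA he) p.d
  rw [splitCoeff_last hp, zero_smul, add_zero] at h1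
  have h2 : ∃ j : Fin (p.d + 1), p.θ j = racahSeq p.q p.b p.c (p.d + 1) := by
    by_contra hno
    push Not at hno
    exact hne (eq_zero_of_apply_eq_smul e he.eig h1 hno)
  obtain ⟨j, hj⟩ := h2
  rw [p.θ_eq] at hj
  have hc := racah_eq_iff (hpow j) (hpow (p.d + 1)) (fun h => by have := hpinj h; omega) hj
  rw [← pow_add] at hc
  -- In the coincident case the argument is repeated from |θ_d⟩, where the eigenvalue is b q^{-2} +
  -- c q², the term of index -1. A coincidence at both ends would give q^{2(j+d+2)} = q^{2j'} with
  -- j' ≤ d.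
  have h3 := diamond_split hp hA.askeyWilson (v := e (Fin.last _))
    (mul_ne_zero hp.c_ne (inv_ne_zero (pow_ne_zero 2 hQ)))
    (y' := p.b * (p.q ^ p.d) ^ 2)
    (by rw [← hp.b_mul_c]; field_simp) (by field_simp; ring)
    (by
      rw [he.eig, p.θ_eq, Fin.val_last, racahSeq, racahSeq, hQ2]; congr 1; simp; ring)
    (diamond_last hp hA he) p.d
  rw [splitCoeff_last hp, zero_smul, add_zero] at h3
  by_cases h4 : aeval (diamond p A As) (newton p.θd (p.d + 1)) (e (Fin.last _)) = 0
  · apply hne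
    -- With the order of the basis reversed, |θ_d⟩ is cyclic for D as well, so a polynomial in D
    -- that kills it kills |θ_0⟩ too.
    obtain ⟨P, hP⟩ := exists_aeval_apply_eq (e.reindex Fin.revPerm) (diamond p A As)
      (fun i j hij => by
        simp only [Module.Basis.reindex_apply, Module.Basis.repr_reindex_apply]
        exact repr_diamond_eq_zero hA he _ _ (by simp [Fin.val_rev]; omega))
      (fun i j hij => by
        simp only [Module.Basis.reindex_apply, Module.Basis.repr_reindex_apply]
        exact repr_diamond_ne_zero hp hA he _ _ (by simp [Fin.val_rev]; omega)) (e 0)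
    have h5 : (e.reindex Fin.revPerm) 0 = e (Fin.last _) := by simp
    rw [h5] at hP
    rw [← hP, ← Module.End.mul_apply, ← map_mul, mul_comm, map_mul, Module.End.mul_apply, h4,
      map_zero]
  · apply h4
    refine eq_zero_of_apply_eq_smul e he.eig h3 fun j' hj' => ?_
    have e1 : racahSeq p.q (p.c * ((p.q ^ p.d) ^ 2)⁻¹) (p.b * (p.q ^ p.d) ^ 2) (p.d + 1)
        = p.b * (p.q ^ 2)⁻¹ + p.c * ((p.q ^ 2)⁻¹)⁻¹ := by
      rw [racahSeq, pow_succ (p.q ^ 2), hQ2]; field_simp; ring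
    rw [e1, p.θ_eq] at hj'
    have hc' := racah_eq_iff (hpow j') (inv_ne_zero (pow_ne_zero 2 hq)) (fun h => by
      have : (p.q ^ 2) ^ ((j' : ℕ) + 1) = (p.q ^ 2) ^ 0 := by
        rw [pow_succ (p.q ^ 2), h]; field_simp
      have := hpinj this
      omega) hj'
    rw [hc] at hc'
    have h6 := mul_left_cancel₀ hp.b_ne hc'
    have h7 : (p.q ^ 2) ^ ((j : ℕ) + (p.d + 1) + 1) = (p.q ^ 2) ^ (j' : ℕ) := by
      rw [pow_succ (p.q ^ 2), h6]; field_simp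
    have := hpinj h7
    omega

end CharPoly

end QRacah

/-! ### The q-difference operator representing A. -/

namespace QRacah

open Polynomial

section DifferenceIdentities

variable {q Q b c e m w : ℂ}

/-- The numerator of the first coefficient of the difference operator, with `w = u²`. -/
def num₁ (q Q b c e m w : ℂ) : ℂ :=
  q⁻¹ * Q⁻¹ * (q ^ 2 * Q ^ 2 * w + w⁻¹ - q * (e * Q ^ 2 + e⁻¹)) * (w * c * Q⁻¹ + m + b * Q * w⁻¹)

/-- The numerator of the second coefficient of the difference operator, with `w = u²`. -/
def num₂ (q Q b c e m w : ℂ) : ℂ :=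
  q⁻¹ * Q⁻¹ * ((q ^ 2)⁻¹ * Q ^ 2 * w⁻¹ + w - q⁻¹ * (e * Q ^ 2 + e⁻¹))
    * (q ^ 4 * w * b * Q + q ^ 2 * m + w⁻¹ * c * Q⁻¹)

/-- The numerator of the diagonal coefficient of the difference operator, with `w = u²`. -/
def num₀ (q Q b c e m w : ℂ) : ℂ :=
  (q + q⁻¹) * ((e * Q + e⁻¹ * Q⁻¹) * m - (q * Q + (q * Q)⁻¹) * (b * Q + c * Q⁻¹))
    + (q * w + q⁻¹ * w⁻¹) * ((e * Q + e⁻¹ * Q⁻¹) * (b * Q + c * Q⁻¹) - (q * Q + (q * Q)⁻¹) * m)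

lemma difference_identity_zero (hq : q ≠ 0) (hQ : Q ≠ 0) (he : e ≠ 0) (hw : w ≠ 0) :
    num₁ q Q b c e m w * bb (q ^ 2 * w) + num₂ q Q b c e m w * bb w
        + num₀ q Q b c e m w * bb (q * w)
      = (b + c) * (bb w * bb (q * w) * bb (q ^ 2 * w)) := by
  unfold num₁ num₂ num₀ bb
  field_simp
  ring

lemma difference_identity_one (hq : q ≠ 0) (hQ : Q ≠ 0) (he : e ≠ 0) (hw : w ≠ 0) :
    num₁ q Q b c e m w * bb (q ^ 2 * w) * (w * q⁻¹ + q * w⁻¹)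
        + num₂ q Q b c e m w * bb w * (q ^ 3 * w + (q ^ 3)⁻¹ * w⁻¹)
        + num₀ q Q b c e m w * bb (q * w) * (q * w + q⁻¹ * w⁻¹)
      = ((b + c) * (e + e⁻¹) + (b * q ^ 2 + c * (q ^ 2)⁻¹) * ((q * w + q⁻¹ * w⁻¹) - (e + e⁻¹))
          + (q ^ 2)⁻¹ * (1 - q ^ 2) * (1 - (Q ^ 2)⁻¹)
            * (e⁻¹ * c + q * Q * m + e * b * q ^ 2 * Q ^ 2))
        * (bb w * bb (q * w) * bb (q ^ 2 * w)) := by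
  unfold num₁ num₂ num₀ bb
  field_simp
  ring

end DifferenceIdentities

namespace Params

/-- The eigenvalue coordinate `(q u² + q⁻¹ u⁻²) / r₀`. -/
def σ (p : Params) (u : ℂ) : ℂ := (p.q * u ^ 2 + p.q⁻¹ * (u ^ 2)⁻¹) / p.r₀

/-- Coefficients of the difference operator. -/
def coef₁ (p : Params) (u : ℂ) : ℂ := u⁻¹ * p.Λ₁ u / (bb (u ^ 2) * bb (p.q * u ^ 2))

def coef₂ (p : Params) (u : ℂ) : ℂ := u⁻¹ * p.Λ₂ u / (bb (u ^ 2) * bb (p.q ^ 2 * u ^ 2))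

def coef₀ (p : Params) (u : ℂ) : ℂ :=
  (p.q + p.q⁻¹) ^ 2 / (p.ρ * bb (u ^ 2) * bb (p.q ^ 2 * u ^ 2)) * (p.ηs + p.η * p.symU u)

/-- The difference operator representing `A` on polynomials in `A^⋄`, evaluated at `σ u`. -/
def diffOp (p : Params) (u : ℂ) : ℂ[X] →ₗ[ℂ] ℂ :=
  p.coef₁ u • leval (p.σ (u / p.q)) + p.coef₂ u • leval (p.σ (p.q * u))
    + p.coef₀ u • leval (p.σ u)

lemma diffOp_apply (p : Params) (u : ℂ) (P : ℂ[X]) :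
    p.diffOp u P = p.coef₁ u * P.eval (p.σ (u / p.q)) + p.coef₂ u * P.eval (p.σ (p.q * u))
      + p.coef₀ u * P.eval (p.σ u) := rfl

/-- The points at which the difference operator is defined. -/
structure GoodPoint (p : Params) (u : ℂ) : Prop where
  ne_zero : u ≠ 0
  bb_ne : bb (u ^ 2) ≠ 0
  bb_q_ne : bb (p.q * u ^ 2) ≠ 0
  bb_q_sq_ne : bb (p.q ^ 2 * u ^ 2) ≠ 0

/-- The coefficients of the split form of `(A^⋄, A)`. -/
def diamondSplit (p : Params) (n : ℕ) : ℂ :=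
  splitCoeff p.q (p.q ^ p.d) p.r₀⁻¹ p.bd p.cd p.b p.c p.midS n

end Params

section DifferenceOperator

variable {p : Params} {u : ℂ}

lemma Params.Valid.ζ_two_eq (hp : p.Valid) :
    p.ζ ^ 2 = (p.bd * p.r₀)⁻¹ * (p.q ^ p.d)⁻¹ := by
  have h := hp.ζ_two
  rw [← hp.cd_mul_r₀]
  simpa using h

lemma Params.Valid.ζ_inv_two_eq (hp : p.Valid) : p.ζ⁻¹ ^ 2 = p.bd * p.r₀ * p.q ^ p.d := by
  rw [inv_pow, hp.ζ_two_eq, mul_inv, inv_inv, inv_inv]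

/-- The two factors with ζ involve only ζ² + ζ⁻², known from e = b^⋄ r₀, and the two factors with
c^* involve c^* + b c/c^*, where b c/c^* = b^*. -/
lemma inv_mul_Λ₁ (hp : p.Valid) (hu : u ≠ 0) : u⁻¹ * p.Λ₁ u
    = num₁ p.q (p.q ^ p.d) p.b p.c (p.bd * p.r₀) p.midS (u ^ 2) := by
  have hq := hp.q_ne
  have hQ := hp.Q_ne
  have h1 := hp.ζ_two_eq
  have h2 := hp.ζ_inv_two_eq
  have hζ := hp.ζ_ne
  have hcs := hp.cs_ne
  have he := hp.e_ne
  have e1 : (p.q ^ p.d * p.q * u * p.ζ⁻¹ - u⁻¹ * p.ζ) * (p.q ^ p.d * p.q * u * p.ζ - u⁻¹ * p.ζ⁻¹)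
      = p.q ^ 2 * (p.q ^ p.d) ^ 2 * u ^ 2 + (u ^ 2)⁻¹
        - p.q * (p.bd * p.r₀ * (p.q ^ p.d) ^ 2 + (p.bd * p.r₀)⁻¹) := by
    have : (p.q ^ p.d * p.q * u * p.ζ⁻¹ - u⁻¹ * p.ζ) * (p.q ^ p.d * p.q * u * p.ζ - u⁻¹ * p.ζ⁻¹)
      = p.q ^ 2 * (p.q ^ p.d) ^ 2 * u ^ 2 + (u ^ 2)⁻¹
        - p.q * p.q ^ p.d * (p.ζ⁻¹ ^ 2 + p.ζ ^ 2) := by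
      field_simp
      ring
    rw [this, h1, h2]
    field_simp
  have e2 : (u * p.cs * (p.q ^ p.d)⁻¹ + u⁻¹ * p.b * p.q ^ p.d) * (u * (p.c / p.cs) + u⁻¹)
      = u ^ 2 * p.c * (p.q ^ p.d)⁻¹ + p.midS + p.b * p.q ^ p.d * (u ^ 2)⁻¹ := by
    have h3 : p.bs = p.b * p.c / p.cs := by
      rw [← hp.bs_cs_eq]; field_simp
    rw [Params.midS, h3]
    field_simp
    ring
  unfold Params.Λ₁ num₁
  rw [← e1, ← e2, zpow_sub₀ hq, zpow_neg, zpow_add₀ hq, zpow_natCast, zpow_one]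
  field_simp

lemma inv_mul_Λ₂ (hp : p.Valid) (hu : u ≠ 0) : u⁻¹ * p.Λ₂ u
    = bb (u ^ 2) / bb (p.q * u ^ 2)
      * num₂ p.q (p.q ^ p.d) p.b p.c (p.bd * p.r₀) p.midS (u ^ 2) := by
  have hq := hp.q_ne
  have hQ := hp.Q_ne
  have h1 := hp.ζ_two_eq
  have h2 := hp.ζ_inv_two_eq
  have hζ := hp.ζ_ne
  have hcs := hp.cs_ne
  have he := hp.e_ne
  have e1 : (p.q ^ p.d / p.q * u⁻¹ * p.ζ - u * p.ζ⁻¹) * (p.q ^ p.d / p.q * u⁻¹ * p.ζ⁻¹ - u * p.ζ)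
      = (p.q ^ 2)⁻¹ * (p.q ^ p.d) ^ 2 * (u ^ 2)⁻¹ + u ^ 2
        - p.q⁻¹ * (p.bd * p.r₀ * (p.q ^ p.d) ^ 2 + (p.bd * p.r₀)⁻¹) := by
    have : (p.q ^ p.d / p.q * u⁻¹ * p.ζ - u * p.ζ⁻¹) * (p.q ^ p.d / p.q * u⁻¹ * p.ζ⁻¹ - u * p.ζ)
      = (p.q ^ 2)⁻¹ * (p.q ^ p.d) ^ 2 * (u ^ 2)⁻¹ + u ^ 2
        - p.q⁻¹ * p.q ^ p.d * (p.ζ⁻¹ ^ 2 + p.ζ ^ 2) := by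
      field_simp
      ring
    rw [this, h1, h2]
    field_simp
  have e2 : (p.q ^ 2 * u * p.b * p.q ^ p.d + u⁻¹ * p.cs * (p.q ^ p.d)⁻¹)
        * (p.q ^ 2 * u + u⁻¹ * (p.c / p.cs))
      = p.q ^ 4 * u ^ 2 * p.b * p.q ^ p.d + p.q ^ 2 * p.midS + (u ^ 2)⁻¹ * p.c * (p.q ^ p.d)⁻¹ := by
    have h3 : p.bs = p.b * p.c / p.cs := by
      rw [← hp.bs_cs_eq]; field_simp
    rw [Params.midS, h3]
    field_simp
    ring
  have e3 : u ^ (2 : ℤ) - u ^ (-2 : ℤ) = bb (u ^ 2) := by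
    simp only [bb, zpow_neg]; norm_cast
  have e4 : p.q * u ^ (2 : ℤ) - p.q⁻¹ * u ^ (-2 : ℤ) = bb (p.q * u ^ 2) := by
    simp only [bb, zpow_neg, mul_inv]; norm_cast
  unfold Params.Λ₂ num₂
  rw [e3, e4, ← e1, ← e2, zpow_sub₀ hq, zpow_sub₀ hq, zpow_neg, zpow_natCast, zpow_one]
  field_simp

lemma coef₀_eq (hp : p.Valid) : p.coef₀ u
    = num₀ p.q (p.q ^ p.d) p.b p.c (p.bd * p.r₀) p.midS (u ^ 2)
      / (bb (u ^ 2) * bb (p.q ^ 2 * u ^ 2)) := by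
  have hr := hp.r₀_ne
  have hadd := hp.q_add_ne
  have hsub := hp.q_sub_ne
  have hs : p.q ^ 2 - (p.q ^ 2)⁻¹ = (p.q + p.q⁻¹) * (p.q - p.q⁻¹) := by
    have hq := hp.q_ne
    field_simp; ring
  have hn : (p.bd * p.r₀ * p.q ^ p.d + (p.bd * p.r₀)⁻¹ * (p.q ^ p.d)⁻¹)
      = p.r₀ * (p.bd * p.q ^ p.d + p.cd * (p.q ^ p.d)⁻¹) := by
    rw [← hp.cd_mul_r₀]; ring
  have key : (p.q + p.q⁻¹) ^ 2 / p.ρ * (p.ηs + p.η * p.symU u)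
      = num₀ p.q (p.q ^ p.d) p.b p.c (p.bd * p.r₀) p.midS (u ^ 2) := by
    rw [p.ρ_eq, hp.ηs_eq, hp.η_eq, hs, num₀, hn, Params.symU, Params.midS]
    unfold awLin
    generalize p.q * u ^ 2 + p.q⁻¹ * (u ^ 2)⁻¹ = S
    generalize p.q + p.q⁻¹ = s at *
    generalize p.q - p.q⁻¹ = t at *
    generalize p.bd * p.q ^ p.d + p.cd * (p.q ^ p.d)⁻¹ = m₁
    generalize p.b * p.q ^ p.d + p.c * (p.q ^ p.d)⁻¹ = m₂
    generalize p.bs * p.q ^ p.d + p.cs * (p.q ^ p.d)⁻¹ = m₃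
    generalize p.q * p.q ^ p.d + (p.q * p.q ^ p.d)⁻¹ = m₄
    field_simp
    ring
  rw [← key, Params.coef₀]
  have : p.ρ * bb (u ^ 2) * bb (p.q ^ 2 * u ^ 2) = p.ρ * (bb (u ^ 2) * bb (p.q ^ 2 * u ^ 2)) := by
    ring
  rw [this]
  generalize bb (u ^ 2) * bb (p.q ^ 2 * u ^ 2) = D
  rw [← div_div]
  ring

lemma coef₁_eq (hp : p.Valid) (hu : u ≠ 0) : p.coef₁ u
    = num₁ p.q (p.q ^ p.d) p.b p.c (p.bd * p.r₀) p.midS (u ^ 2)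
      / (bb (u ^ 2) * bb (p.q * u ^ 2)) := by
  rw [Params.coef₁, inv_mul_Λ₁ hp hu]

lemma coef₂_eq (hp : p.Valid) (hu : p.GoodPoint u) : p.coef₂ u
    = num₂ p.q (p.q ^ p.d) p.b p.c (p.bd * p.r₀) p.midS (u ^ 2)
      / (bb (p.q * u ^ 2) * bb (p.q ^ 2 * u ^ 2)) := by
  rw [Params.coef₂, inv_mul_Λ₂ hp hu.ne_zero]
  have h1 := hu.bb_ne
  have h2 := hu.bb_q_ne
  have h3 := hu.bb_q_sq_ne
  field_simp

lemma σ_div (hp : p.Valid) (hu : u ≠ 0) :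
    p.σ (u / p.q) = (u ^ 2 * p.q⁻¹ + p.q * (u ^ 2)⁻¹) / p.r₀ := by
  have hq := hp.q_ne
  rw [Params.σ]; congr 1; field_simp

lemma σ_mul (hp : p.Valid) (hu : u ≠ 0) :
    p.σ (p.q * u) = (p.q ^ 3 * u ^ 2 + (p.q ^ 3)⁻¹ * (u ^ 2)⁻¹) / p.r₀ := by
  have hq := hp.q_ne
  rw [Params.σ]; congr 1; field_simp

/-- The scalar counterpart of `diamond_split`: `split_action` is applied with V' = ℂ, D replaced by
multiplication by σ(u) and A by the difference operator. The initial values are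
`difference_identity_zero` and `difference_identity_one`. -/
lemma diffOp_newton (hp : p.Valid) (hu : p.GoodPoint u) (n : ℕ) :
    p.diffOp u (newton p.θd (n + 1)) = p.θ (n + 1) * (newton p.θd (n + 1)).eval (p.σ u)
      + p.diamondSplit (n + 1) * (newton p.θd n).eval (p.σ u) := by
  have hq := hp.q_ne
  have hr := hp.r₀_ne
  have h1 := hu.bb_ne
  have h2 := hu.bb_q_ne
  have h3 := hu.bb_q_sq_ne
  have hu0 := hu.ne_zero
  have hw : u ^ 2 ≠ 0 := pow_ne_zero 2 hu0
  have hθd0 : p.θd 0 = (p.bd * p.r₀ + (p.bd * p.r₀)⁻¹) / p.r₀ := by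
    rw [← hp.cd_mul_r₀, Params.θd, racahSeq]; field_simp
  have hsum : p.coef₁ u + p.coef₂ u + p.coef₀ u = p.b + p.c := by
    have := difference_identity_zero (q := p.q) (Q := p.q ^ p.d) (b := p.b) (c := p.c)
      (e := p.bd * p.r₀) (m := p.midS) hq hp.Q_ne hp.e_ne hw
    rw [coef₁_eq hp hu0, coef₂_eq hp hu, coef₀_eq hp]
    generalize bb (u ^ 2) = B₁ at *
    generalize bb (p.q * u ^ 2) = B₂ at *
    generalize bb (p.q ^ 2 * u ^ 2) = B₃ at *
    field_simp
    linear_combination this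
  have hone : p.coef₁ u * (u ^ 2 * p.q⁻¹ + p.q * (u ^ 2)⁻¹)
      + p.coef₂ u * (p.q ^ 3 * u ^ 2 + (p.q ^ 3)⁻¹ * (u ^ 2)⁻¹)
      + p.coef₀ u * (p.q * u ^ 2 + p.q⁻¹ * (u ^ 2)⁻¹)
      = ((p.b + p.c) * (p.bd * p.r₀ + (p.bd * p.r₀)⁻¹) + (p.b * p.q ^ 2 + p.c * (p.q ^ 2)⁻¹)
          * ((p.q * u ^ 2 + p.q⁻¹ * (u ^ 2)⁻¹) - (p.bd * p.r₀ + (p.bd * p.r₀)⁻¹))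
          + (p.q ^ 2)⁻¹ * (1 - p.q ^ 2) * (1 - ((p.q ^ p.d) ^ 2)⁻¹)
            * ((p.bd * p.r₀)⁻¹ * p.c + p.q * p.q ^ p.d * p.midS
              + p.bd * p.r₀ * p.b * p.q ^ 2 * (p.q ^ p.d) ^ 2)) := by
    have := difference_identity_one (q := p.q) (Q := p.q ^ p.d) (b := p.b) (c := p.c)
      (e := p.bd * p.r₀) (m := p.midS) hq hp.Q_ne hp.e_ne hw
    rw [coef₁_eq hp hu0, coef₂_eq hp hu, coef₀_eq hp]
    generalize bb (u ^ 2) = B₁ at *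
    generalize bb (p.q * u ^ 2) = B₂ at *
    generalize bb (p.q ^ 2 * u ^ 2) = B₃ at *
    rw [div_mul_eq_mul_div, div_mul_eq_mul_div, div_mul_eq_mul_div, div_add_div _ _ (by positivity)
      (by positivity), div_add_div _ _ (by positivity) (by positivity), div_eq_iff (by positivity)]
    linear_combination B₂ * B₁ * B₃ * this
  have h := split_action (V' := ℂ) (X' := LinearMap.mulLeft ℂ (p.σ u)) hq hp.Q_ne hp.bd_ne hp.b_ne
    hp.bd_mul_cd hp.b_mul_c (m := p.midS) (i := leval (p.σ u)) (Y := p.diffOp u)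
    (by intro P; simp) ?_ ?_ ?_ n
  · rw [Params.θ_eq]; exact h
  · intro P
    -- The unshifted term must absorb the lower order part of the Askey-Wilson relation; this
    -- determines `coef₀`.
    have hT : p.coef₀ u * ((2 - (p.q ^ 2 + (p.q ^ 2)⁻¹)) * p.σ u ^ 2
          + (p.q ^ 2 - (p.q ^ 2)⁻¹) ^ 2 * p.r₀⁻¹ ^ 2)
        = awLin p.q (p.q ^ p.d) p.r₀⁻¹ (p.bd * p.q ^ p.d + p.cd * (p.q ^ p.d)⁻¹)
            (p.b * p.q ^ p.d + p.c * (p.q ^ p.d)⁻¹) p.midS * p.σ u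
          + (p.q + p.q⁻¹) * p.r₀⁻¹ * awLin p.q (p.q ^ p.d) p.r₀⁻¹
            (p.bd * p.q ^ p.d + p.cd * (p.q ^ p.d)⁻¹) p.midS
              (p.b * p.q ^ p.d + p.c * (p.q ^ p.d)⁻¹) := by
      have e1 : (2 - (p.q ^ 2 + (p.q ^ 2)⁻¹)) * p.σ u ^ 2
          + (p.q ^ 2 - (p.q ^ 2)⁻¹) ^ 2 * p.r₀⁻¹ ^ 2
          = -(p.q - p.q⁻¹) ^ 2 * p.r₀⁻¹ ^ 2 * (bb (u ^ 2) * bb (p.q ^ 2 * u ^ 2)) := by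
        unfold bb Params.σ
        field_simp
        ring
      rw [e1, coef₀_eq hp]
      have hB : bb (u ^ 2) * bb (p.q ^ 2 * u ^ 2) ≠ 0 := mul_ne_zero h1 h3
      generalize bb (u ^ 2) * bb (p.q ^ 2 * u ^ 2) = D at *
      have hn : (p.bd * p.r₀ * p.q ^ p.d + (p.bd * p.r₀)⁻¹ * (p.q ^ p.d)⁻¹)
          = p.r₀ * (p.bd * p.q ^ p.d + p.cd * (p.q ^ p.d)⁻¹) := by
        rw [← hp.cd_mul_r₀]; ring
      rw [num₀, hn, Params.σ]
      unfold awLin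
      generalize p.q * u ^ 2 + p.q⁻¹ * (u ^ 2)⁻¹ = S
      generalize p.q + p.q⁻¹ = s at *
      generalize p.q - p.q⁻¹ = t at *
      generalize p.bd * p.q ^ p.d + p.cd * (p.q ^ p.d)⁻¹ = m₁
      generalize p.b * p.q ^ p.d + p.c * (p.q ^ p.d)⁻¹ = m₂
      generalize p.q * p.q ^ p.d + (p.q * p.q ^ p.d)⁻¹ = m₄
      field_simp
      ring
    -- σ(u) and σ(u q^{±1}) are related like consecutive terms of an eigenvalue sequence, so the
    -- shifted terms satisfy the relation without lower order part.
    have hA : p.σ (u / p.q) ^ 2 - (p.q ^ 2 + (p.q ^ 2)⁻¹) * (p.σ u * p.σ (u / p.q)) + p.σ u ^ 2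
        + (p.q ^ 2 - (p.q ^ 2)⁻¹) ^ 2 * p.r₀⁻¹ ^ 2 = 0 := by
      rw [σ_div hp hu0, Params.σ]; field_simp; ring
    have hB : p.σ (p.q * u) ^ 2 - (p.q ^ 2 + (p.q ^ 2)⁻¹) * (p.σ u * p.σ (p.q * u)) + p.σ u ^ 2
        + (p.q ^ 2 - (p.q ^ 2)⁻¹) ^ 2 * p.r₀⁻¹ ^ 2 = 0 := by
      rw [σ_mul hp hu0, Params.σ]; field_simp; ring
    simp only [Params.diffOp_apply, eval_mul, eval_X, LinearMap.mulLeft_apply, smul_eq_mul,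
      leval_apply]
    linear_combination p.coef₁ u * P.eval (p.σ (u / p.q)) * hA
      + p.coef₂ u * P.eval (p.σ (p.q * u)) * hB + P.eval (p.σ u) * hT
  · simp only [Params.diffOp_apply, eval_one, mul_one, racahSeq, pow_zero, inv_one, smul_eq_mul,
      leval_apply]
    linear_combination hsum
  · have e1 : newton (racahSeq p.q p.bd p.cd) 1 = X - C (p.θd 0) := by
      simp [newton, Params.θd]
    have e2 : splitCoeff p.q (p.q ^ p.d) p.r₀⁻¹ p.bd p.cd p.b p.c p.midS 1 * p.r₀
        = (p.q ^ 2)⁻¹ * (1 - p.q ^ 2) * (1 - ((p.q ^ p.d) ^ 2)⁻¹)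
            * ((p.bd * p.r₀)⁻¹ * p.c + p.q * p.q ^ p.d * p.midS
              + p.bd * p.r₀ * p.b * p.q ^ 2 * (p.q ^ p.d) ^ 2) := by
      rw [← hp.cd_mul_r₀, splitCoeff, splitFun, pow_one]
      have hQ := hp.Q_ne
      field_simp
    rw [← e2] at hone
    rw [e1]
    simp only [Params.diffOp_apply, eval_sub, eval_X, eval_C, eval_one, mul_one, racahSeq, pow_one,
      smul_eq_mul, leval_apply, σ_div hp hu0, σ_mul hp hu0, hθd0]
    rw [Params.σ]
    generalize p.bd * p.r₀ + (p.bd * p.r₀)⁻¹ = E at *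
    field_simp at hone ⊢
    linear_combination hone - u ^ 2 * p.q ^ 3 * E * hsum

end DifferenceOperator

end QRacah

/-! ### The polynomial model and the Belliard-Slavnov linear system. -/

namespace QRacah

open Polynomial

section ActRel

variable {V : Type*} [AddCommGroup V] [Module ℂ V] {p : Params} {A As : Module.End ℂ V} {v : V}

/-- `P'` represents the action of `A` on `P(A^⋄) v`, compatibly with the difference operator. -/
structure ActRel (p : Params) (A As : Module.End ℂ V) (v : V) (P P' : ℂ[X]) : Prop where
  act : A (aeval (diamond p A As) P v) = aeval (diamond p A As) P' v
  diff : ∀ u, p.GoodPoint u → p.diffOp u P = P'.eval (p.σ u)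

lemma ActRel.add {P P' R R' : ℂ[X]} (h : ActRel p A As v P P') (h' : ActRel p A As v R R') :
    ActRel p A As v (P + R) (P' + R') where
  act := by simp only [map_add, LinearMap.add_apply, h.act, h'.act]
  diff u hu := by rw [map_add, h.diff u hu, h'.diff u hu, eval_add]

lemma ActRel.smul {P P' : ℂ[X]} (c : ℂ) (h : ActRel p A As v P P') :
    ActRel p A As v (c • P) (c • P') where
  act := by simp only [map_smul, LinearMap.smul_apply, h.act]
  diff u hu := by rw [map_smul, h.diff u hu, eval_smul]

lemma actRel_zero : ActRel p A As v 0 0 where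
  act := by simp
  diff u _ := by simp

lemma actRel_newton (hp : p.Valid) (hA : IsQRacahPair p A As)
    {e : Module.Basis (Fin (p.d + 1)) ℂ V} (he : IsEigenbasis p A As e) (n : ℕ) :
    ActRel p A As (e 0) (newton p.θd (n + 1))
      (p.θ (n + 1) • newton p.θd (n + 1) + p.diamondSplit (n + 1) • newton p.θd n) where
  act := by
    rw [diamond_split hp hA.askeyWilson hp.b_ne hp.b_mul_c rfl
      (v := e 0) (by rw [he.eig, p.θ_eq, Fin.val_zero]) (diamond_first hp hA he) n, ← p.θ_eq]
    simp [Params.diamondSplit]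
  diff u hu := by
    rw [diffOp_newton hp hu]
    simp [eval_smul]

lemma diffOp_one (hp : p.Valid) {u : ℂ} (hu : p.GoodPoint u) : p.diffOp u 1 = p.θ 0 := by
  have h1 := hu.bb_ne
  have h2 := hu.bb_q_ne
  have h3 := hu.bb_q_sq_ne
  have := difference_identity_zero (q := p.q) (Q := p.q ^ p.d) (b := p.b) (c := p.c)
    (e := p.bd * p.r₀) (m := p.midS) hp.q_ne hp.Q_ne hp.e_ne (pow_ne_zero 2 hu.ne_zero)
  simp only [Params.diffOp_apply, eval_one, mul_one]
  rw [coef₁_eq hp hu.ne_zero, coef₂_eq hp hu, coef₀_eq hp, p.θ_eq, racahSeq]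
  generalize bb (u ^ 2) = B₁ at *
  generalize bb (p.q * u ^ 2) = B₂ at *
  generalize bb (p.q ^ 2 * u ^ 2) = B₃ at *
  simp only [pow_zero, mul_one, inv_one]
  field_simp
  linear_combination this

lemma actRel_newton_zero (hp : p.Valid) {e : Module.Basis (Fin (p.d + 1)) ℂ V}
    (he : IsEigenbasis p A As e) :
    ActRel p A As (e 0) (newton p.θd 0) (p.θ 0 • newton p.θd 0) where
  act := by simp [newton_zero, he.eig]
  diff u hu := by rw [newton_zero, diffOp_one hp hu]; simp

lemma degree_sub_newton {t : ℕ → ℂ} {n : ℕ} {P : ℂ[X]} (hP : P.degree < (n + 1 : ℕ)) :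
    (P - P.coeff n • newton t n).degree < (n : ℕ) := by
  rw [degree_lt_iff_coeff_zero] at hP ⊢
  intro m hm
  rw [coeff_sub, coeff_smul, smul_eq_mul]
  rcases hm.eq_or_lt with rfl | hlt
  · have := (newton_monic t n).coeff_natDegree
    rw [newton_natDegree] at this
    rw [this]; ring
  · have h0 : (newton t n).coeff m = 0 :=
      coeff_eq_zero_of_natDegree_lt (by rwa [newton_natDegree])
    rw [hP m hlt, h0]
    ring

lemma newton_degree_lt {t : ℕ → ℂ} {m n : ℕ} (h : m < n) : (newton t m).degree < (n : ℕ) := by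
  rw [degree_eq_natDegree (newton_monic t m).ne_zero, newton_natDegree]
  exact_mod_cast h

/-- Both actions have the same bidiagonal form on the Newton basis, so one image polynomial serves
both, and the degree bound is preserved. Induction on the bound, splitting off the top Newton
polynomial. -/
lemma exists_actRel (hp : p.Valid) (hA : IsQRacahPair p A As)
    {e : Module.Basis (Fin (p.d + 1)) ℂ V} (he : IsEigenbasis p A As e) (n : ℕ) :
    ∀ P : ℂ[X], P.degree < (n : ℕ) →
      ∃ P' : ℂ[X], P'.degree < (n : ℕ) ∧ ActRel p A As (e 0) P P' := by
  induction n with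
  | zero =>
    intro P hP
    obtain rfl : P = 0 := by simpa using hP
    exact ⟨0, hP, actRel_zero⟩
  | succ n ih =>
    intro P hP
    obtain ⟨R, hR, hR'⟩ := ih _ (degree_sub_newton (t := p.θd) hP)
    have hN : ∃ N' : ℂ[X], N'.degree < ((n + 1 : ℕ)) ∧ ActRel p A As (e 0) (newton p.θd n) N' := by
      cases n with
      | zero =>
        exact ⟨_, (degree_smul_le _ _).trans_lt (newton_degree_lt (by omega)),
          actRel_newton_zero hp he⟩
      | succ n =>
        exact ⟨_, (degree_add_le _ _).trans_lt (max_lt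
          ((degree_smul_le _ _).trans_lt (newton_degree_lt (by omega)))
          ((degree_smul_le _ _).trans_lt (newton_degree_lt (by omega)))), actRel_newton hp hA he n⟩
    obtain ⟨N', hN, hN'⟩ := hN
    refine ⟨R + P.coeff n • N', (degree_add_le _ _).trans_lt (max_lt
      (hR.trans (by exact_mod_cast Nat.lt_succ_self n)) ((degree_smul_le _ _).trans_lt hN)), ?_⟩
    have := hR'.add (hN'.smul (P.coeff n))
    rwa [sub_add_cancel] at this

end ActRel

section RootPoly

/-- The polynomial with roots `σ(v_i)`. -/
def rootPoly (p : Params) {n : ℕ} (v : Fin n → ℂ) : ℂ[X] := ∏ i, (X - C (p.σ (v i)))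

variable {p : Params} {n : ℕ} {v : Fin n → ℂ}

lemma rootPoly_monic : (rootPoly p v).Monic := monic_prod_of_monic _ _ fun _ _ => monic_X_sub_C _

lemma rootPoly_natDegree : (rootPoly p v).natDegree = n := by
  simp [rootPoly, natDegree_prod_of_monic _ _ fun k _ => monic_X_sub_C (p.σ (v k))]

lemma rootPoly_degree_lt : (rootPoly p v).degree < (n + 1 : ℕ) := by
  rw [degree_eq_natDegree rootPoly_monic.ne_zero, rootPoly_natDegree]
  exact_mod_cast Nat.lt_succ_self n

lemma rootPoly_eval (x : ℂ) : (rootPoly p v).eval x = ∏ i, (x - p.σ (v i)) := by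
  simp [rootPoly, eval_prod]

/-- The source of all factors b(u/v) b(quv): with it `Params.g` and `Params.Y` become values of root
polynomials at σ(u) and at the shifted points. -/
lemma σ_sub (hp : p.Valid) {u w : ℂ} (hu : u ≠ 0) (hw : w ≠ 0) :
    p.σ u - p.σ w = bb (u / w) * bb (p.q * u * w) / p.r₀ := by
  have hq := hp.q_ne
  have hr := hp.r₀_ne
  unfold Params.σ bb
  field_simp
  ring

lemma σ_eq_iff (hp : p.Valid) {u w : ℂ} (hu : u ≠ 0) (hw : w ≠ 0) :
    p.σ u = p.σ w ↔ bb (u / w) * bb (p.q * u * w) = 0 := by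
  rw [← sub_eq_zero, σ_sub hp hu hw, div_eq_zero_iff, or_iff_left hp.r₀_ne]

lemma Params.Regular.good {y : Fin (p.d + 1) → ℂ} (hy : p.Regular y) (i : Fin (p.d + 1)) :
    p.GoodPoint (y i) :=
  ⟨hy.ne_zero i, hy.bb_ne i, hy.bb_q_ne i, hy.bb_q_sq_ne i⟩

lemma Params.Regular.σ_injective (hp : p.Valid) {y : Fin (p.d + 1) → ℂ} (hy : p.Regular y) :
    Function.Injective fun i => p.σ (y i) := by
  intro i j hij
  by_contra hne
  rw [σ_eq_iff hp (hy.ne_zero i) (hy.ne_zero j)] at hij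
  exact mul_ne_zero (hy.bb_div_ne i j hne) (hy.bb_mul_ne i j hne) hij

lemma rootPoly_dropAt_eval_eq_zero {d : ℕ} {y : Fin (d + 1) → ℂ} {j k : Fin (d + 1)}
    (h : k ≠ j) : (rootPoly p (Params.dropAt y j)).eval (p.σ (y k)) = 0 := by
  obtain ⟨i, hi⟩ := Fin.exists_succAbove_eq h
  rw [rootPoly_eval]
  exact Finset.prod_eq_zero (Finset.mem_univ i) (by rw [Params.dropAt, hi, sub_self])

lemma rootPoly_eval_self (hp : p.Valid) {n : ℕ} {u : ℂ} {w : Fin n → ℂ} (hu : u ≠ 0)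
    (hw : ∀ i, w i ≠ 0) : (rootPoly p w).eval (p.σ u) = (p.g u w)⁻¹ / p.r₀ ^ n := by
  rw [rootPoly_eval, Params.g, Finset.prod_inv_distrib, inv_inv]
  simp only [σ_sub hp hu (hw _), Finset.prod_div_distrib]
  simp

lemma diffOp_rootPoly (hp : p.Valid) {n : ℕ} {u : ℂ} {w : Fin n → ℂ} (hu : u ≠ 0)
    (hw : ∀ i, w i ≠ 0) : p.diffOp u (rootPoly p w)
      = p.Y u w / p.r₀ ^ n + p.coef₀ u * (rootPoly p w).eval (p.σ u) := by
  have hq := hp.q_ne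
  rw [Params.diffOp_apply, Params.Y, rootPoly_eval, rootPoly_eval]
  have h1 : ∀ i, p.σ (u / p.q) - p.σ (w i) = bb (u / (p.q * w i)) * bb (u * w i) / p.r₀ := by
    intro i
    rw [σ_sub hp (div_ne_zero hu hq) (hw i), div_div, mul_div_cancel₀ _ hq]
  have h2 : ∀ i, p.σ (p.q * u) - p.σ (w i)
      = bb (p.q * u / w i) * bb (p.q ^ 2 * u * w i) / p.r₀ := by
    intro i
    rw [σ_sub hp (mul_ne_zero hq hu) (hw i)]
    congr 3
    ring
  simp only [h1, h2, Finset.prod_div_distrib, Params.coef₁, Params.coef₂]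
  simp only [Finset.prod_const, Finset.card_univ, Fintype.card_fin]
  ring

lemma g_ne_zero {y : Fin (p.d + 1) → ℂ} (hy : p.Regular y) (k : Fin (p.d + 1)) :
    p.g (y k) (Params.dropAt y k) ≠ 0 :=
  Finset.prod_ne_zero_iff.2 fun i _ => inv_ne_zero (mul_ne_zero
    (hy.bb_div_ne _ _ (Fin.succAbove_ne k i).symm) (hy.bb_mul_ne _ _ (Fin.succAbove_ne k i).symm))

end RootPoly

section LinearSystem

variable {V : Type*} [AddCommGroup V] [Module ℂ V] {p : Params} {A As : Module.End ℂ V}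

/-- The interpolation coefficients of the action of `A` on the root polynomials. -/
def interpCoeff (p : Params) (y : Fin (p.d + 1) → ℂ) (j k : Fin (p.d + 1)) : ℂ :=
  p.diffOp (y k) (rootPoly p (Params.dropAt y j))
    / (rootPoly p (Params.dropAt y k)).eval (p.σ (y k))

/-- The image of a root polynomial has degree at most d, hence is determined by its values at the d
+ 1 distinct nodes σ(y_k), where it is given by the difference operator. The root polynomials with
one node omitted form the Lagrange basis up to scale. -/
lemma act_rootPoly (hp : p.Valid) (hA : IsQRacahPair p A As)
    {e : Module.Basis (Fin (p.d + 1)) ℂ V} (he : IsEigenbasis p A As e)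
    {y : Fin (p.d + 1) → ℂ} (hy : p.Regular y) (j : Fin (p.d + 1)) :
    A (aeval (diamond p A As) (rootPoly p (Params.dropAt y j)) (e 0))
      = ∑ k, interpCoeff p y j k
        • aeval (diamond p A As) (rootPoly p (Params.dropAt y k)) (e 0) := by
  obtain ⟨P', hP', h⟩ := exists_actRel hp hA he (p.d + 1) (rootPoly p (Params.dropAt y j))
    rootPoly_degree_lt
  have key : P' = ∑ k, interpCoeff p y j k • rootPoly p (Params.dropAt y k) := by
    refine eq_of_degrees_lt_of_eval_index_eq (s := Finset.univ) (v := fun i => p.σ (y i))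
      ((hy.σ_injective hp).injOn) (by simpa using hP') ?_ ?_
    · refine (degree_sum_le _ _).trans_lt ?_
      rw [Finset.sup_lt_iff (by simp)]
      intro k _
      exact (degree_smul_le _ _).trans_lt (by simpa using rootPoly_degree_lt)
    · intro k _
      rw [← h.diff _ (hy.good k), eval_finsetSum, Finset.sum_eq_single k]
      · rw [eval_smul, interpCoeff, smul_eq_mul, div_mul_cancel₀]
        rw [rootPoly_eval_self (w := Params.dropAt y k) hp (hy.ne_zero k) fun i => hy.ne_zero _]
        exact div_ne_zero (inv_ne_zero (g_ne_zero hy k)) (pow_ne_zero _ hp.r₀_ne)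
      · intro i _ hi
        rw [eval_smul, rootPoly_dropAt_eval_eq_zero hi.symm, smul_zero]
      · simp
  rw [h.act, key]
  simp [LinearMap.sum_apply]

/-- The weight `∏ v_i b(v_i²)`. -/
def weight {n : ℕ} (v : Fin n → ℂ) : ℂ := ∏ i, (v i * bb (v i ^ 2))

/-- `Params.L` is the interpolation matrix conjugated by the diagonal matrix of the weights. -/
lemma L_mul_weight (hp : p.Valid) {y : Fin (p.d + 1) → ℂ} (hy : p.Regular y)
    (j k : Fin (p.d + 1)) : p.L y j k * weight (Params.dropAt y k)
      = interpCoeff p y j k * weight (Params.dropAt y j) := by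
  have hr := hp.r₀_ne
  have hw : ∀ i, weight (Params.dropAt y i) * (y i * bb (y i ^ 2)) = weight y := by
    intro i
    rw [weight, weight, Fin.prod_univ_succAbove _ i, mul_comm]
    rfl
  have hβ : ∀ i, y i * bb (y i ^ 2) ≠ 0 := fun i => mul_ne_zero (hy.ne_zero i) (hy.bb_ne i)
  have hg := g_ne_zero hy k
  have h1 : interpCoeff p y j k = p.g (y k) (Params.dropAt y k) * p.Y (y k) (Params.dropAt y j)
      + if j = k then p.coef₀ (y k) else 0 := by
    rw [interpCoeff, diffOp_rootPoly (w := Params.dropAt y j) hp (hy.ne_zero k)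
      fun i => hy.ne_zero _]
    rw [rootPoly_eval_self (w := Params.dropAt y k) hp (hy.ne_zero k) fun i => hy.ne_zero _]
    split_ifs with hjk
    · subst hjk
      rw [rootPoly_eval_self (w := Params.dropAt y j) hp (hy.ne_zero j) fun i => hy.ne_zero _]
      field_simp
    · rw [rootPoly_dropAt_eval_eq_zero (Ne.symm hjk)]
      field_simp
      simp
  have hk := hβ k
  have hj := hβ j
  refine mul_right_cancel₀ hk (mul_right_cancel₀ hj ?_)
  have e1 : p.L y j k * weight (Params.dropAt y k) * (y k * bb (y k ^ 2)) * (y j * bb (y j ^ 2))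
      = p.L y j k * (y j * bb (y j ^ 2)) * weight y := by rw [← hw k]; ring
  have e2 : interpCoeff p y j k * weight (Params.dropAt y j) * (y k * bb (y k ^ 2))
      * (y j * bb (y j ^ 2)) = interpCoeff p y j k * (y k * bb (y k ^ 2)) * weight y := by
    rw [← hw j]; ring
  rw [e1, e2, h1]
  congr 1
  have hyj := hy.ne_zero j
  have hyk := hy.ne_zero k
  have hbj := hy.bb_ne j
  have hbk := hy.bb_ne k
  rw [Params.L, add_mul, add_mul]
  congr 1
  · field_simp
  · split_ifs with hjk
    · subst hjk; rfl
    · ring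

/-- The |θ_i⟩-component of `act_rootPoly`, since A acts on it by θ_i. For i = M this is the
homogeneous linear system. -/
lemma bsMatrix_mulVec (hp : p.Valid) (hA : IsQRacahPair p A As)
    {e : Module.Basis (Fin (p.d + 1)) ℂ V} (he : IsEigenbasis p A As e)
    {y : Fin (p.d + 1) → ℂ} (hy : p.Regular y) (M i j : Fin (p.d + 1)) :
    ∑ k, p.bsMatrix M y j k * (weight (Params.dropAt y k)
        * e.repr (aeval (diamond p A As) (rootPoly p (Params.dropAt y k)) (e 0)) i)
      = (p.θ i - p.θ M) * (weight (Params.dropAt y j)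
        * e.repr (aeval (diamond p A As) (rootPoly p (Params.dropAt y j)) (e 0)) i) := by
  have h := congrArg (fun v => e.repr v i) (act_rootPoly hp hA he hy j)
  simp only [repr_apply_eig e he.eig, map_sum, map_smul, Finsupp.finsetSum_apply,
    Finsupp.smul_apply, smul_eq_mul] at h
  have h2 : ∀ k, p.bsMatrix M y j k * (weight (Params.dropAt y k)
        * e.repr (aeval (diamond p A As) (rootPoly p (Params.dropAt y k)) (e 0)) i)
      = weight (Params.dropAt y j) * (interpCoeff p y j k
        * e.repr (aeval (diamond p A As) (rootPoly p (Params.dropAt y k)) (e 0)) i)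
        - if j = k then p.θ M * (weight (Params.dropAt y k)
          * e.repr (aeval (diamond p A As) (rootPoly p (Params.dropAt y k)) (e 0)) i) else 0 := by
    intro k
    rw [Params.bsMatrix, Matrix.of_apply, sub_mul, ← mul_assoc, L_mul_weight hp hy]
    split_ifs <;> ring
  simp only [h2, Finset.sum_sub_distrib, ← Finset.mul_sum, ← h, Finset.sum_ite_eq,
    Finset.mem_univ, if_true]
  ring

end LinearSystem

end QRacah

/-! ### Bethe states as polynomials in A^⋄ applied to the reference state. -/

namespace QRacah

open Polynomial

section BetheState

variable {V : Type*} [AddCommGroup V] [Module ℂ V] {p : Params} {A As : Module.End ℂ V}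

lemma qComm_eq_diamond (hp : p.Valid) : qComm p.q As A
    = ((p.q ^ 2 - (p.q ^ 2)⁻¹) / p.r₀) • diamond p A As
      - (p.ω / (p.q - p.q⁻¹)) • (1 : Module.End ℂ V) := by
  have hr := hp.r₀_ne
  have h := hp.q_sq_sub_ne
  have h1 : (p.q ^ 2 - (p.q ^ 2)⁻¹) / p.r₀ * (p.r₀ / (p.q ^ 2 - (p.q ^ 2)⁻¹) * p.ω / (p.q - p.q⁻¹))
      = p.ω / (p.q - p.q⁻¹) := by
    generalize p.q ^ 2 - (p.q ^ 2)⁻¹ = x at h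
    generalize p.q - p.q⁻¹ = y
    rw [mul_div_assoc, ← mul_assoc, div_mul_div_cancel₀ hr, div_self h, one_mul]
  rw [diamond, smul_add, smul_smul, smul_smul, div_mul_div_cancel₀ hr, div_self h, one_smul, h1,
    add_sub_cancel_right]

/-- The part of the coefficient of the dynamical operator that does not depend on `u`. -/
def dynCoeff (p : Params) (α χ : ℂ) (m : ℤ) : ℂ :=
  p.q ^ (2 * m + 1) / (α * p.q ^ (-2 : ℤ)) * (χ * p.q ^ (-m - 1) / p.ρ)
    * ((p.q ^ 2 - (p.q ^ 2)⁻¹) / p.r₀)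

lemma dynCoeff_ne_zero (hp : p.Valid) {α χ : ℂ} (hα : α ≠ 0) (hχ : χ ≠ 0) (m : ℤ) :
    dynCoeff p α χ m ≠ 0 := by
  have hq := hp.q_ne
  exact mul_ne_zero (mul_ne_zero (div_ne_zero (zpow_ne_zero _ hq)
    (mul_ne_zero hα (zpow_ne_zero _ hq))) (div_ne_zero (mul_ne_zero hχ (zpow_ne_zero _ hq)) hp.ρ_ne))
    (div_ne_zero hp.q_sq_sub_ne hp.r₀_ne)

/-- At β = 0 only [A^*, A]_q and a scalar survive, and the scalar part is exactly what turns the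
bracket into a multiple of D - σ(u). -/
lemma dynB_eq (hp : p.Valid) {α χ u : ℂ} (hχ : χ ≠ 0) (hu : u ≠ 0) (m : ℤ) :
    dynB p A As α 0 χ u m
      = aeval (diamond p A As) (C (dynCoeff p α χ m * (u * bb (u ^ 2))) * (X - C (p.σ u))) := by
  have hq := hp.q_ne
  have hr := hp.r₀_ne
  have hρ := hp.ρ_ne
  have h1 := hp.q_sub_ne
  have h2 := hp.q_sq_sub_ne
  have hz : p.q ^ (-m - 4) = p.q ^ (-m - 1) * (p.q ^ 3)⁻¹ := by
    rw [← zpow_natCast, ← zpow_neg, ← zpow_add₀ hq]; congr 1; norm_num; ring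
  have hb : bb (p.q ^ 2) = p.q ^ 2 - (p.q ^ 2)⁻¹ := rfl
  rw [dynB, qComm_eq_diamond hp, hz, hb]
  simp only [map_mul, map_sub, aeval_C, aeval_X, Algebra.algebraMap_eq_smul_one, smul_mul_assoc,
    one_mul, zero_mul, ne_eq, OfNat.ofNat_ne_zero, not_false_eq_true, zero_pow, zero_div, zero_smul,
    sub_zero, add_zero, smul_sub, smul_smul, sub_sub, ← add_smul, dynCoeff]
  generalize p.q ^ (-m - 1) = Q
  congr 2
  · field_simp
  · rw [Params.σ]
    have h1' : p.q ^ 2 - 1 ≠ 0 := by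
      intro h; apply h1; field_simp; linear_combination h
    have h2' : p.q ^ 4 - 1 ≠ 0 := by
      intro h; apply h2; field_simp; linear_combination h
    have e1 : p.q - p.q⁻¹ = (p.q ^ 2 - 1) / p.q := by field_simp
    have e2 : p.q ^ 2 - (p.q ^ 2)⁻¹ = (p.q ^ 4 - 1) / p.q ^ 2 := by field_simp
    rw [p.ρ_eq, e1, e2]
    field_simp
    ring

/-- The part of the coefficient of the Bethe state that does not depend on the points. -/
def betheCoeff (p : Params) (α χ : ℂ) (m : ℤ) (n : ℕ) : ℂ :=
  ∏ i : Fin n, dynCoeff p α χ (m + 2 * ((n : ℤ) - 1 - (i : ℤ)))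

lemma betheState_eq (hp : p.Valid) {α χ : ℂ} (hχ : χ ≠ 0) (m : ℤ) (v : V)
    {n : ℕ} {u : Fin n → ℂ} (hu : ∀ i, u i ≠ 0) :
    betheState p A As α χ m v u
      = (betheCoeff p α χ m n * weight u) • aeval (diamond p A As) (rootPoly p u) v := by
  have h : (fun i : Fin n => dynB p A As α 0 χ (u i) (m + 2 * ((n : ℤ) - 1 - (i : ℤ))))
      = fun i : Fin n => aeval (diamond p A As) (C (dynCoeff p α χ (m + 2 * ((n : ℤ) - 1 - (i : ℤ)))
        * (u i * bb (u i ^ 2))) * (X - C (p.σ (u i)))) :=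
    funext fun i => dynB_eq hp hχ (hu i) _
  rw [betheState, h, ← LinearMap.smul_apply, ← map_smul]
  congr 1
  have h2 := List.map_ofFn (f := fun i : Fin n => C (dynCoeff p α χ (m + 2 * ((n : ℤ) - 1 - (i : ℤ)))
        * (u i * bb (u i ^ 2))) * (X - C (p.σ (u i))))
    (g := aeval (diamond p A As))
  rw [Function.comp_def] at h2
  rw [← h2, ← map_list_prod, List.prod_ofFn, Finset.prod_mul_distrib, smul_eq_C_mul, rootPoly,
    ← map_prod, Finset.prod_mul_distrib, betheCoeff, weight]

/-- The components of the Bethe states, up to the constant `betheCoeff`. -/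
def component (p : Params) (A As : Module.End ℂ V) (e : Module.Basis (Fin (p.d + 1)) ℂ V)
    (M : Fin (p.d + 1)) {n : ℕ} (u : Fin n → ℂ) : ℂ :=
  e.repr (aeval (diamond p A As) (rootPoly p u) (e 0)) M

lemma dual_apply {e : Module.Basis (Fin (p.d + 1)) ℂ V} {f : Fin (p.d + 1) → Module.Dual ℂ V}
    (hf : IsDualFamily p A e f) (M : Fin (p.d + 1)) (v : V) :
    f M v / f M (e M) = e.repr v M := by
  rw [div_eq_iff (hf.norm_ne M)]
  conv_lhs => rw [← e.sum_repr v]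
  rw [map_sum, Finset.sum_eq_single M]
  · simp
  · intro i _ hi
    rw [map_smul, hf.orth M i hi.symm, smul_zero]
  · simp

lemma scalarX_eq (hp : p.Valid) {α χ : ℂ} (hχ : χ ≠ 0) (m : ℤ)
    {e : Module.Basis (Fin (p.d + 1)) ℂ V} {f : Fin (p.d + 1) → Module.Dual ℂ V}
    (hf : IsDualFamily p A e f) (M : Fin (p.d + 1)) {u : Fin p.d → ℂ} (hu : ∀ i, u i ≠ 0) :
    scalarX p A As α χ m e f M u
      = betheCoeff p α χ m p.d * (weight u * component p A As e M u) := by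
  rw [scalarX, dual_apply hf, betheState_eq hp hχ m _ hu, map_smul, Finsupp.smul_apply, smul_eq_mul,
    component, mul_assoc]

lemma betheCoeff_ne_zero (hp : p.Valid) {α χ : ℂ} (hα : α ≠ 0) (hχ : χ ≠ 0) (m : ℤ) (n : ℕ) :
    betheCoeff p α χ m n ≠ 0 :=
  Finset.prod_ne_zero_iff.2 fun _ _ => dynCoeff_ne_zero hp hα hχ _

end BetheState

section Lagrange

variable {V : Type*} [AddCommGroup V] [Module ℂ V] {p : Params} {A As : Module.End ℂ V}

/-- The Bethe state vectors at a regular point, up to the constant `betheCoeff`. -/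
def betheMatrix (p : Params) (A As : Module.End ℂ V) (e : Module.Basis (Fin (p.d + 1)) ℂ V)
    (y : Fin (p.d + 1) → ℂ) : Matrix (Fin (p.d + 1)) (Fin (p.d + 1)) ℂ :=
  Matrix.of fun k i => weight (Params.dropAt y k) * component p A As e i (Params.dropAt y k)

lemma weight_ne_zero {y : Fin (p.d + 1) → ℂ} (hy : p.Regular y) (k : Fin (p.d + 1)) :
    weight (Params.dropAt y k) ≠ 0 :=
  Finset.prod_ne_zero_iff.2 fun _ _ => mul_ne_zero (hy.ne_zero _) (hy.bb_ne _)

lemma bsMatrix_mul_betheMatrix (hp : p.Valid) (hA : IsQRacahPair p A As)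
    {e : Module.Basis (Fin (p.d + 1)) ℂ V} (he : IsEigenbasis p A As e)
    {y : Fin (p.d + 1) → ℂ} (hy : p.Regular y) (M : Fin (p.d + 1)) :
    p.bsMatrix M y * betheMatrix p A As e y
      = betheMatrix p A As e y * Matrix.diagonal fun i : Fin (p.d + 1) => p.θ i - p.θ M := by
  ext j i
  rw [Matrix.mul_diagonal, Matrix.mul_apply]
  simp only [betheMatrix, Matrix.of_apply, component]
  rw [bsMatrix_mulVec hp hA he hy, mul_comm]

/-- A linear relation between the rows is a polynomial R of degree at most d with R(D)|θ_0⟩ = 0.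
Cyclicity gives R = 0, and evaluation at σ(y_k) isolates each coefficient. -/
lemma betheMatrix_det_ne_zero (hp : p.Valid) (hA : IsQRacahPair p A As)
    {e : Module.Basis (Fin (p.d + 1)) ℂ V} (he : IsEigenbasis p A As e)
    {y : Fin (p.d + 1) → ℂ} (hy : p.Regular y) : (betheMatrix p A As e y).det ≠ 0 := by
  intro h
  obtain ⟨v, hv, hv0⟩ := Matrix.exists_vecMul_eq_zero_iff.2 h
  set R : ℂ[X] := ∑ k, (v k * weight (Params.dropAt y k)) • rootPoly p (Params.dropAt y k) with hR
  have hR0 : R ≠ 0 := by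
    intro h0
    apply hv
    ext k
    have := congrArg (eval (p.σ (y k))) h0
    rw [hR, eval_finsetSum, Finset.sum_eq_single k, eval_smul, eval_zero,
      rootPoly_eval_self (w := Params.dropAt y k) hp (hy.ne_zero k) fun i => hy.ne_zero _,
      smul_eq_mul] at this
    · have h3 := (mul_eq_zero.1 this).resolve_right
        (div_ne_zero (inv_ne_zero (g_ne_zero hy k)) (pow_ne_zero _ hp.r₀_ne))
      exact (mul_eq_zero.1 h3).resolve_right (weight_ne_zero hy k)
    · intro i _ hi
      rw [eval_smul, rootPoly_dropAt_eval_eq_zero hi.symm, smul_zero]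
    · simp
  refine aeval_apply_ne_zero e (diamond p A As)
    (fun i j hij => repr_diamond_eq_zero hA he i j (Or.inr hij))
    (fun i j hij => repr_diamond_ne_zero hp hA he i j (Or.inr hij)) hR0 ?_ ?_
  · refine natDegree_sum_le_of_forall_le _ _ fun k _ => ?_
    exact (natDegree_smul_le _ _).trans rootPoly_natDegree.le
  · apply e.repr.injective
    ext i
    have := congrFun hv0 i
    simp only [Matrix.vecMul, dotProduct, betheMatrix, Matrix.of_apply, component] at this
    simp only [hR, map_sum, map_smul, LinearMap.sum_apply, LinearMap.smul_apply,
      Finsupp.finsetSum_apply, Finsupp.smul_apply, smul_eq_mul, map_zero, Finsupp.zero_apply]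
    rw [Pi.zero_apply] at this
    rw [← this]
    exact Finset.sum_congr rfl fun k _ => by ring

end Lagrange

end QRacah

/-! ### Signed minors and existence of reductions. -/

namespace QRacah

open Polynomial

section Minors

variable {d : ℕ}

lemma det_updateRow_last (T : Matrix (Fin (d + 1)) (Fin (d + 1)) ℂ) (r : Fin (d + 1) → ℂ) :
    (T.updateRow (Fin.last d) r).det
      = (-1) ^ d * ∑ k : Fin (d + 1), r k * ((-1) ^ (k : ℕ) * (deleteLast T k).det) := by
  rw [Matrix.det_succ_row _ (Fin.last d), Finset.mul_sum]
  refine Finset.sum_congr rfl fun k _ => ?_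
  rw [Matrix.submatrix_updateRow_succAbove, Matrix.updateRow_self, Fin.val_last, pow_add, deleteLast]
  ring

/-- If the last row of `T` vanishes and the kernel of `T` is spanned by `x`, then the signed minors
of `T` are proportional to `x`. -/
lemma exists_minors_eq {T : Matrix (Fin (d + 1)) (Fin (d + 1)) ℂ} {x : Fin (d + 1) → ℂ}
    (hT : ∀ k, T (Fin.last d) k = 0) (hx : x ≠ 0)
    (hker : ∀ v, T.mulVec v = 0 → ∃ c : ℂ, v = c • x) :
    ∃ l : ℂ, l ≠ 0 ∧ ∀ k : Fin (d + 1), (-1) ^ (k : ℕ) * (deleteLast T k).det = l * x k := by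
  -- The signed minors lie in the kernel: pairing them with row i is, up to sign, the determinant of
  -- T with its last row replaced by row i, which has a repeated row for i ≠ last.
  obtain ⟨l, hl⟩ := hker (fun k => (-1) ^ (k : ℕ) * (deleteLast T k).det) (by
    ext i
    rw [Matrix.mulVec, dotProduct, Pi.zero_apply]
    have h := det_updateRow_last T (T i)
    rcases eq_or_ne i (Fin.last d) with rfl | hi
    · simp [hT]
    · rw [Matrix.det_zero_of_row_eq hi (by
        rw [Matrix.updateRow_self, Matrix.updateRow_ne hi])] at h
      exact (mul_eq_zero.1 h.symm).resolve_left (pow_ne_zero _ (by norm_num)))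
  refine ⟨l, ?_, fun k => congrFun hl k⟩
  -- If all minors vanished, T with its last row replaced by the k-th unit vector would be singular.
  -- That gives a non-zero kernel vector with vanishing k-th entry, although the kernel is spanned
  -- by x with x_k ≠ 0.
  rintro rfl
  obtain ⟨k, hk⟩ := Function.ne_iff.1 hx
  have h := det_updateRow_last T (Pi.single k 1)
  simp only [fun j => congrFun hl j, zero_smul, Pi.zero_apply, mul_zero, Finset.sum_const_zero] at h
  obtain ⟨v, hv, hv0⟩ := Matrix.exists_mulVec_eq_zero_iff.2 h
  have hTv : T.mulVec v = 0 := by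
    ext i
    rcases eq_or_ne i (Fin.last d) with rfl | hi
    · simp [Matrix.mulVec, dotProduct, hT]
    · have := congrFun hv0 i
      rwa [Matrix.mulVec, Matrix.updateRow_ne hi] at this
  obtain ⟨c, rfl⟩ := hker v hTv
  have := congrFun hv0 (Fin.last d)
  rw [Matrix.mulVec, Matrix.updateRow_self, single_dotProduct, Pi.zero_apply, one_mul,
    Pi.smul_apply, smul_eq_mul] at this
  rw [(mul_eq_zero.1 this).resolve_right hk, zero_smul] at hv
  exact hv rfl

/-- Row 0 is scaled. For d ≠ 0 it differs from the last row and therefore enters every minor exactly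
once. -/
lemma exists_scaling (hd : d ≠ 0) {c : ℂ} (hc : c ≠ 0) :
    ∃ D : Matrix (Fin (d + 1)) (Fin (d + 1)) ℂ, D.det ≠ 0 ∧
      ∀ T : Matrix (Fin (d + 1)) (Fin (d + 1)) ℂ,
        (∀ k, (D * T) (Fin.last d) k = T (Fin.last d) k) ∧
        ∀ k, (deleteLast (D * T) k).det = c * (deleteLast T k).det := by
  obtain ⟨n, rfl⟩ := Nat.exists_eq_succ_of_ne_zero hd
  refine ⟨Matrix.diagonal fun i => if i = 0 then c else 1, ?_, fun T => ⟨fun k => ?_, fun k => ?_⟩⟩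
  · rw [Matrix.det_diagonal]
    refine Finset.prod_ne_zero_iff.2 fun i _ => ?_
    split_ifs
    exacts [hc, one_ne_zero]
  · rw [Matrix.diagonal_mul, if_neg (by simp [Fin.ext_iff]), one_mul]
  · have : deleteLast ((Matrix.diagonal fun i : Fin (n + 1 + 1) => if i = 0 then c else 1) * T) k
        = (Matrix.diagonal fun i : Fin (n + 1) => if i = 0 then c else 1) * deleteLast T k := by
      ext i j
      rw [Matrix.diagonal_mul, deleteLast, deleteLast, Matrix.submatrix_apply, Matrix.diagonal_mul,
        Matrix.submatrix_apply, Fin.succAbove_last]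
      simp only [Fin.castSucc_eq_zero_iff]
    rw [this, Matrix.det_mul, Matrix.det_diagonal]
    simp

lemma det_deleteLast_of_eq_zero (hd : d = 0) (T : Matrix (Fin (d + 1)) (Fin (d + 1)) ℂ)
    (k : Fin (d + 1)) : (deleteLast T k).det = 1 := by
  subst hd
  exact Matrix.det_isEmpty

end Minors

section Reduction

variable {V : Type*} [AddCommGroup V] [Module ℂ V] {p : Params} {A As : Module.End ℂ V}

lemma bsMatrix_ker (hp : p.Valid) (hA : IsQRacahPair p A As)
    {e : Module.Basis (Fin (p.d + 1)) ℂ V} (he : IsEigenbasis p A As e)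
    {y : Fin (p.d + 1) → ℂ} (hy : p.Regular y) (M : Fin (p.d + 1)) {v : Fin (p.d + 1) → ℂ}
    (hv : (p.bsMatrix M y).mulVec v = 0) :
    ∃ c : ℂ, v = c • fun k => betheMatrix p A As e y k M := by
  have hG := (betheMatrix_det_ne_zero hp hA he hy).isUnit
  set G := betheMatrix p A As e y
  set z := G⁻¹.mulVec v with hz
  have hvz : v = G.mulVec z := by
    rw [hz, Matrix.mulVec_mulVec, Matrix.mul_nonsing_inv _ hG, Matrix.one_mulVec]
  rw [hvz, Matrix.mulVec_mulVec, bsMatrix_mul_betheMatrix hp hA he hy, ← Matrix.mulVec_mulVec] at hv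
  have hD := Matrix.eq_zero_of_mulVec_eq_zero (betheMatrix_det_ne_zero hp hA he hy) hv
  have h0 : ∀ i, i ≠ M → z i = 0 := by
    intro i hi
    have := congrFun hD i
    rw [Matrix.mulVec_diagonal, Pi.zero_apply] at this
    exact (mul_eq_zero.1 this).resolve_left (sub_ne_zero.2 fun h => hi (hA.leonard.inj h))
  refine ⟨z M, ?_⟩
  rw [hvz]
  ext k
  rw [Matrix.mulVec, dotProduct, Finset.sum_eq_single M]
  · simp [mul_comm, G]
  · intro i _ hi
    rw [h0 i hi, mul_zero]
  · simp

lemma exists_minor_eq (hp : p.Valid) (hA : IsQRacahPair p A As)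
    {e : Module.Basis (Fin (p.d + 1)) ℂ V} (he : IsEigenbasis p A As e)
    {y : Fin (p.d + 1) → ℂ} (hy : p.Regular y) (M : Fin (p.d + 1))
    {W : Matrix (Fin (p.d + 1)) (Fin (p.d + 1)) ℂ} (hW : W.det ≠ 0)
    (hlast : ∀ k, (W * p.bsMatrix M y) (Fin.last p.d) k = 0) :
    ∃ l : ℂ, l ≠ 0 ∧ ∀ k : Fin (p.d + 1), (-1) ^ (k : ℕ) * (deleteLast (W * p.bsMatrix M y) k).det
      = l * betheMatrix p A As e y k M := by
  refine exists_minors_eq hlast (fun h => ?_) fun v hv => ?_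
  · exact betheMatrix_det_ne_zero hp hA he hy
      (Matrix.det_eq_zero_of_column_eq_zero M fun k => congrFun h k)
  · rw [← Matrix.mulVec_mulVec] at hv
    exact bsMatrix_ker hp hA he hy M (Matrix.eq_zero_of_mulVec_eq_zero hW hv)

/-- With G the matrix of Bethe components, G⁻¹ ℳ = diag(θ_i - θ_M) G⁻¹ has a vanishing M-th row,
which a transposition moves to the bottom. A row scaling then makes the signed minors equal to the
Bethe components, and the k-th of these depends only on the points other than y_k. For d = 0 every
minor is the empty determinant 1 and no scaling is possible or needed. -/
lemma exists_reduction_at (hp : p.Valid) (hA : IsQRacahPair p A As)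
    {e : Module.Basis (Fin (p.d + 1)) ℂ V} (he : IsEigenbasis p A As e)
    (M : Fin (p.d + 1)) {y : Fin (p.d + 1) → ℂ} (hy : p.Regular y) :
    ∃ W : Matrix (Fin (p.d + 1)) (Fin (p.d + 1)) ℂ, W.det ≠ 0 ∧
      (∀ k, (W * p.bsMatrix M y) (Fin.last p.d) k = 0) ∧
      (p.d ≠ 0 → ∀ k : Fin (p.d + 1), (-1) ^ (k : ℕ) * (deleteLast (W * p.bsMatrix M y) k).det
        = betheMatrix p A As e y k M) := by
  have hG := betheMatrix_det_ne_zero hp hA he hy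
  have hB : (betheMatrix p A As e y)⁻¹ * p.bsMatrix M y
      = (Matrix.diagonal fun i : Fin (p.d + 1) => p.θ i - p.θ M) * (betheMatrix p A As e y)⁻¹ := by
    have h := congrArg (fun T => (betheMatrix p A As e y)⁻¹ * T * (betheMatrix p A As e y)⁻¹)
      (bsMatrix_mul_betheMatrix hp hA he hy M)
    simp only [← mul_assoc, Matrix.nonsing_inv_mul _ hG.isUnit, one_mul] at h
    rw [← h, mul_assoc, Matrix.mul_nonsing_inv _ hG.isUnit, mul_one]
  set S : Equiv.Perm (Fin (p.d + 1)) := Equiv.swap M (Fin.last p.d)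
  set W := S.permMatrix ℂ * (betheMatrix p A As e y)⁻¹ with hWdef
  have hW : W.det ≠ 0 := by
    rw [hWdef, Matrix.det_mul, Matrix.det_permutation]
    refine mul_ne_zero (by simp) ?_
    exact (Matrix.isUnit_nonsing_inv_det _ hG.isUnit).ne_zero
  have hlast : ∀ k, (W * p.bsMatrix M y) (Fin.last p.d) k = 0 := by
    intro k
    rw [hWdef, mul_assoc, hB, Equiv.Perm.permMatrix, PEquiv.toMatrix_toPEquiv_mul,
      Matrix.submatrix_apply, Matrix.diagonal_mul]
    simp [S]
  obtain ⟨l, hl, h⟩ := exists_minor_eq hp hA he hy M hW hlast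
  by_cases hd : p.d = 0
  · exact ⟨W, hW, hlast, fun h => (h hd).elim⟩
  obtain ⟨D, hD, hDT⟩ := exists_scaling hd (inv_ne_zero hl)
  refine ⟨D * W, by rw [Matrix.det_mul]; exact mul_ne_zero hD hW, fun k => ?_, fun _ k => ?_⟩
  · rw [mul_assoc, (hDT _).1, hlast]
  · rw [mul_assoc, (hDT _).2, mul_left_comm, h, inv_mul_cancel_left₀ hl]

theorem exists_reduction (hp : p.Valid) (hA : IsQRacahPair p A As) (M : Fin (p.d + 1)) :
    ∃ W, IsReduction p M {y | p.Regular y} W := by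
  classical
  obtain ⟨e, he⟩ := exists_eigenbasis hp hA
  choose! W h1 h2 h3 using fun y hy => exists_reduction_at hp hA he M (y := y) hy
  refine ⟨W, h1, h2, fun k y hy y' hy' hyy' => ?_⟩
  by_cases hd : p.d = 0
  · rw [Params.minor, Params.minor, det_deleteLast_of_eq_zero hd, det_deleteLast_of_eq_zero hd]
  have e1 := h3 y hy hd k
  have hdrop : Params.dropAt y k = Params.dropAt y' k :=
    funext fun i => hyy' _ (Fin.succAbove_ne k i)
  rw [betheMatrix, Matrix.of_apply, hdrop] at e1
  exact mul_left_cancel₀ (pow_ne_zero _ (by norm_num)) (e1.trans (h3 y' hy' hd k).symm)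

end Reduction

end QRacah

/-! ### Generic points and constancy of the factor of proportionality. -/

namespace QRacah

open Polynomial Filter

section Generic

variable {p : Params} {n : ℕ}

lemma eventually_pow_ne {n : ℕ} (hn : 0 < n) (a : ℂ) : ∀ᶠ t : ℂ in cofinite, t ^ n ≠ a := by
  rw [eventually_cofinite]
  simp only [not_not]
  refine ((nthRoots n a).toFinset.finite_toSet).subset fun t ht => ?_
  simpa [mem_nthRoots hn] using ht

lemma bb_eq_zero_iff {x : ℂ} (hx : x ≠ 0) : bb x = 0 ↔ x ^ 2 = 1 := by
  rw [bb, sub_eq_zero, ← mul_eq_one_iff_eq_inv₀ hx, sq]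

lemma eventually_bb_mul_pow_ne {c : ℂ} (hc : c ≠ 0) {n : ℕ} (hn : 0 < n) :
    ∀ᶠ t : ℂ in cofinite, bb (c * t ^ n) ≠ 0 := by
  filter_upwards [eventually_pow_ne (n := n * 2) (by omega) ((c ^ 2)⁻¹),
    eventually_pow_ne one_pos 0] with t ht ht0
  rw [pow_one] at ht0
  rw [Ne, bb_eq_zero_iff (mul_ne_zero hc (pow_ne_zero _ ht0)), mul_pow, ← pow_mul]
  intro h
  exact ht (eq_inv_of_mul_eq_one_right h)

lemma eventually_bb_div_ne {c : ℂ} (hc : c ≠ 0) : ∀ᶠ t : ℂ in cofinite, bb (c / t) ≠ 0 := by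
  filter_upwards [eventually_pow_ne (n := 2) (by omega) (c ^ 2),
    eventually_pow_ne one_pos 0] with t ht ht0
  rw [pow_one] at ht0
  rw [Ne, bb_eq_zero_iff (div_ne_zero hc ht0), div_pow, div_eq_one_iff_eq (pow_ne_zero _ ht0)]
  exact fun h => ht h.symm

/-- The regularity conditions that involve only the coordinates in `S`. -/
def RegularOn (p : Params) (S : Finset (Fin (p.d + 1))) (y : Fin (p.d + 1) → ℂ) : Prop :=
  ∀ i ∈ S, y i ≠ 0 ∧ bb (y i ^ 2) ≠ 0 ∧ bb (p.q * y i ^ 2) ≠ 0 ∧ bb (p.q ^ 2 * y i ^ 2) ≠ 0 ∧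
    ∀ j ∈ S, i ≠ j → bb (y i / y j) ≠ 0 ∧ bb (p.q * y i * y j) ≠ 0

lemma regularOn_univ {y : Fin (p.d + 1) → ℂ} : RegularOn p Finset.univ y ↔ p.Regular y := by
  constructor
  · intro h
    refine ⟨fun i => (h i (by simp)).1, fun i => (h i (by simp)).2.1, fun i => (h i (by simp)).2.2.1,
      fun i => (h i (by simp)).2.2.2.1, fun i j hij => ((h i (by simp)).2.2.2.2 j (by simp) hij).1,
      fun i j hij => ((h i (by simp)).2.2.2.2 j (by simp) hij).2⟩
  · intro h i _
    exact ⟨h.ne_zero i, h.bb_ne i, h.bb_q_ne i, h.bb_q_sq_ne i, fun j _ hij =>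
      ⟨h.bb_div_ne i j hij, h.bb_mul_ne i j hij⟩⟩

lemma RegularOn.eventually_insert (hp : p.Valid) {S : Finset (Fin (p.d + 1))}
    {y : Fin (p.d + 1) → ℂ} (hy : RegularOn p S y) {k : Fin (p.d + 1)} (hk : k ∉ S) :
    ∀ᶠ t : ℂ in cofinite, RegularOn p (insert k S) (Function.update y k t) := by
  have hq := hp.q_ne
  have hS : ∀ᶠ t : ℂ in cofinite, ∀ j ∈ S, bb (t / y j) ≠ 0 ∧ bb (p.q * t * y j) ≠ 0 ∧
      bb (y j / t) ≠ 0 ∧ bb (p.q * y j * t) ≠ 0 := by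
    refine (Filter.eventually_all_finset S).2 fun j hj => ?_
    have hj0 := (hy j hj).1
    filter_upwards [eventually_bb_mul_pow_ne (inv_ne_zero hj0) one_pos,
      eventually_bb_mul_pow_ne (mul_ne_zero hq hj0) one_pos, eventually_bb_div_ne hj0]
      with t h1 h2 h3
    rw [pow_one] at h1 h2
    exact ⟨by rwa [div_eq_inv_mul], by rwa [mul_right_comm], h3, h2⟩
  filter_upwards [hS, eventually_pow_ne one_pos 0,
    eventually_bb_mul_pow_ne one_ne_zero (n := 2) (by omega),
    eventually_bb_mul_pow_ne hq (n := 2) (by omega),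
    eventually_bb_mul_pow_ne (pow_ne_zero 2 hq) (n := 2) (by omega)] with t h0 h1 h2 h3 h4
  rw [pow_one] at h1
  rw [one_mul] at h2
  have hne : ∀ j ∈ S, j ≠ k := fun j hj h => hk (h ▸ hj)
  intro i hi
  rcases Finset.mem_insert.1 hi with rfl | hiS
  · rw [Function.update_self]
    refine ⟨h1, h2, h3, h4, fun j hj hij => ?_⟩
    have hj := (Finset.mem_insert.1 hj).resolve_left hij.symm
    rw [Function.update_of_ne hij.symm]
    exact ⟨(h0 j hj).1, (h0 j hj).2.1⟩
  · rw [Function.update_of_ne (hne i hiS)]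
    obtain ⟨g1, g2, g3, g4, g5⟩ := hy i hiS
    refine ⟨g1, g2, g3, g4, fun j hj hij => ?_⟩
    rcases Finset.mem_insert.1 hj with rfl | hj
    · rw [Function.update_self]
      exact ⟨(h0 i hiS).2.2.1, (h0 i hiS).2.2.2⟩
    · rw [Function.update_of_ne (hne j hj)]
      exact g5 j hj hij

lemma RegularOn.mono {S T : Finset (Fin (p.d + 1))} {y : Fin (p.d + 1) → ℂ}
    (hy : RegularOn p S y) (h : T ⊆ S) : RegularOn p T y := by
  intro i hi
  obtain ⟨g1, g2, g3, g4, g5⟩ := hy i (h hi)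
  exact ⟨g1, g2, g3, g4, fun j hj => g5 j (h hj)⟩

lemma Params.Regular.eventually_update (hp : p.Valid) {y : Fin (p.d + 1) → ℂ} (hy : p.Regular y)
    (k : Fin (p.d + 1)) : ∀ᶠ t : ℂ in cofinite, p.Regular (Function.update y k t) := by
  have h := ((regularOn_univ.2 hy).mono (Finset.erase_subset k _)).eventually_insert hp
    (Finset.notMem_erase k _)
  rw [Finset.insert_erase (Finset.mem_univ k)] at h
  simpa only [regularOn_univ] using h

lemma eventually_eval_ne {R : ℂ[X]} (hR : R ≠ 0) : ∀ᶠ t : ℂ in cofinite, R.eval t ≠ 0 := by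
  rw [eventually_cofinite]
  simp only [not_not]
  exact (R.roots.toFinset.finite_toSet).subset fun t ht => by simpa [hR] using ht

lemma eventually_eval_update_ne {σ : Type*} [DecidableEq σ] {P : MvPolynomial σ ℂ} {y : σ → ℂ}
    (hy : MvPolynomial.eval y P ≠ 0) (k : σ) :
    ∀ᶠ t : ℂ in cofinite, MvPolynomial.eval (Function.update y k t) P ≠ 0 := by
  -- P as a polynomial in the k-th coordinate alone; it is non-zero because its value at y k is.
  set R : ℂ[X] := MvPolynomial.aeval (Function.update (fun i => C (y i)) k X) P with hR
  have h : ∀ t, R.eval t = MvPolynomial.eval (Function.update y k t) P := by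
    intro t
    rw [hR, ← Polynomial.coe_aeval_eq_eval, ← MvPolynomial.aeval_eq_eval]
    change (Polynomial.aeval t) _ = _
    rw [← AlgHom.comp_apply]
    congr 1
    ext i
    rcases eq_or_ne i k with rfl | hi
    · simp
    · simp [Function.update_of_ne hi]
  have hR0 : R ≠ 0 := by
    intro h0
    apply hy
    rw [← Function.update_eq_self k y, ← h, h0, eval_zero]
  simpa only [h] using eventually_eval_ne hR0

lemma generic_eventually_update (hp : p.Valid) {P : MvPolynomial (Fin (p.d + 1)) ℂ}
    {y : Fin (p.d + 1) → ℂ} (hy : y ∈ p.generic P) (k : Fin (p.d + 1)) :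
    ∀ᶠ t : ℂ in cofinite, Function.update y k t ∈ p.generic P :=
  (hy.1.eventually_update hp k).and (eventually_eval_update_ne hy.2 k)

/-- Starting from a point with P ≠ 0, the coordinates are moved one at a time; each step excludes
only finitely many values. -/
lemma generic_nonempty (hp : p.Valid) {P : MvPolynomial (Fin (p.d + 1)) ℂ} (hP : P ≠ 0) :
    (p.generic P).Nonempty := by
  have h : ∀ S : Finset (Fin (p.d + 1)), ∃ y, RegularOn p S y ∧ MvPolynomial.eval y P ≠ 0 := by
    intro S
    induction S using Finset.induction_on with
    | empty =>
      by_contra! h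
      exact hP (MvPolynomial.funext fun y => by rw [h y (by simp [RegularOn]), map_zero])
    | insert k S hk ih =>
      obtain ⟨y, hy, hyP⟩ := ih
      obtain ⟨t, ht⟩ := ((hy.eventually_insert hp hk).and (eventually_eval_update_ne hyP k)).exists
      exact ⟨_, ht⟩
  obtain ⟨y, hy, hyP⟩ := h Finset.univ
  exact ⟨y, regularOn_univ.1 hy, hyP⟩

lemma quartic_ne_zero {a b c : ℂ} (h : b ≠ 0 ∨ c ≠ 0) :
    C a * X ^ 4 + C b * X ^ 2 + C c ≠ (0 : ℂ[X]) := by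
  intro h'
  have h0 := congrArg (coeff · 0) h'
  have h2 := congrArg (coeff · 2) h'
  simp [coeff_X_pow, coeff_C] at h0 h2
  tauto

lemma eventually_σ_ne (hp : p.Valid) {a b : ℂ} (hab : a ≠ 0 ∨ b ≠ 0) :
    ∀ᶠ t : ℂ in cofinite, a - p.σ t * b ≠ 0 := by
  have hq := hp.q_ne
  have hr := hp.r₀_ne
  have hR : C (-(p.q * b)) * X ^ 4 + C (p.r₀ * a) * X ^ 2 + C (-(p.q⁻¹ * b)) ≠ 0 := by
    refine quartic_ne_zero ?_
    rcases hab with hab | hab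
    · exact Or.inl (mul_ne_zero hr hab)
    · exact Or.inr (neg_ne_zero.2 (mul_ne_zero (inv_ne_zero hq) hab))
  filter_upwards [eventually_eval_ne hR, eventually_pow_ne one_pos 0] with t ht ht0
  rw [pow_one] at ht0
  intro h
  apply ht
  simp only [eval_add, eval_mul, eval_C, eval_pow, eval_X]
  rw [Params.σ] at h
  field_simp at h ⊢
  linear_combination h

end Generic

section Connect

variable {V : Type*} [AddCommGroup V] [Module ℂ V] {p : Params} {A As : Module.End ℂ V}

lemma rootPoly_dropAt (y : Fin (p.d + 1) → ℂ) (k : Fin (p.d + 1)) :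
    rootPoly p (Params.dropAt y k) = ∏ j ∈ Finset.univ.erase k, (X - C (p.σ (y j))) := by
  have h : Finset.univ.erase k = Finset.univ.map k.succAboveEmb := by
    ext j
    simp only [Finset.mem_erase, Finset.mem_univ, and_true, Finset.mem_map, true_and,
      Fin.coe_succAboveEmb]
    exact Fin.exists_succAbove_eq_iff.symm
  rw [h, Finset.prod_map]
  rfl

lemma dropAt_update_self {d : ℕ} (y : Fin (d + 1) → ℂ) (k : Fin (d + 1)) (t : ℂ) :
    Params.dropAt (Function.update y k t) k = Params.dropAt y k :=
  funext fun i => Function.update_of_ne (Fin.succAbove_ne k i) _ _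

/-- If one component at `y` is non-zero, then after a generic change of the omitted coordinate all
components are non-zero. -/
lemma eventually_component_ne (hp : p.Valid) {e : Module.Basis (Fin (p.d + 1)) ℂ V}
    {M : Fin (p.d + 1)} {y : Fin (p.d + 1) → ℂ} {k : Fin (p.d + 1)}
    (h : component p A As e M (Params.dropAt y k) ≠ 0) (i : Fin (p.d + 1)) :
    ∀ᶠ t : ℂ in cofinite,
      component p A As e M (Params.dropAt (Function.update y k t) i) ≠ 0 := by
  rcases eq_or_ne i k with rfl | hi
  · simpa only [dropAt_update_self] using Eventually.of_forall fun _ => h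
  set R : ℂ[X] := ∏ j ∈ (Finset.univ.erase k).erase i, (X - C (p.σ (y j)))
  set φ : ℂ[X] → ℂ := fun Q => e.repr (aeval (diamond p A As) Q (e 0)) M with hφ
  have hadd : ∀ c : ℂ, φ ((X - C c) * R) = φ (X * R) - c * φ R := by
    intro c
    rw [sub_mul, ← smul_eq_C_mul]
    simp [φ]
  have h1 : component p A As e M (Params.dropAt y k) = φ (X * R) - p.σ (y i) * φ R := by
    rw [component, rootPoly_dropAt,
      ← Finset.mul_prod_erase _ _ (Finset.mem_erase.2 ⟨hi, Finset.mem_univ i⟩)]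
    exact hadd _
  -- The component at index i depends on the moved coordinate k through an affine function of σ(t).
  -- Its two coefficients cannot both vanish, since at the value y_i it equals the given non-zero
  -- component.
  have h2 : ∀ t, component p A As e M (Params.dropAt (Function.update y k t) i)
      = φ (X * R) - p.σ t * φ R := by
    intro t
    have h3 : ∏ j ∈ (Finset.univ.erase i).erase k, (X - C (p.σ (Function.update y k t j))) = R := by
      rw [Finset.erase_right_comm]
      refine Finset.prod_congr rfl fun j hj => ?_
      rw [Function.update_of_ne]
      rintro rfl
      simp at hj
    rw [component, rootPoly_dropAt,
      ← Finset.mul_prod_erase _ _ (Finset.mem_erase.2 ⟨hi.symm, Finset.mem_univ k⟩), h3,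
      Function.update_self]
    exact hadd _
  simp only [h2]
  refine eventually_σ_ne hp ?_
  by_contra! hc
  rw [h1, hc.1, hc.2] at h
  simp at h

/-- A function on the generic points that does not change when a coordinate is moved at which the
component of the Bethe state does not vanish is constant. -/
lemma const_on_generic (hp : p.Valid) (hA : IsQRacahPair p A As)
    {e : Module.Basis (Fin (p.d + 1)) ℂ V} (he : IsEigenbasis p A As e) (M : Fin (p.d + 1))
    {P : MvPolynomial (Fin (p.d + 1)) ℂ} {l : (Fin (p.d + 1) → ℂ) → ℂ}
    (hl : ∀ k, ∀ y ∈ p.generic P, ∀ t, Function.update y k t ∈ p.generic P →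
      component p A As e M (Params.dropAt y k) ≠ 0 → l y = l (Function.update y k t)) :
    ∀ y ∈ p.generic P, ∀ y' ∈ p.generic P, l y = l y' := by
  set S : Set (Fin (p.d + 1) → ℂ) :=
    {y | y ∈ p.generic P ∧ ∀ i, component p A As e M (Params.dropAt y i) ≠ 0} with hS
  have hmove : ∀ y ∈ p.generic P, ∀ k, component p A As e M (Params.dropAt y k) ≠ 0 →
      ∀ᶠ t : ℂ in cofinite, Function.update y k t ∈ S ∧ l y = l (Function.update y k t) := by
    intro y hy k hk
    filter_upwards [generic_eventually_update hp hy k,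
      eventually_all.2 (eventually_component_ne hp hk)] with t h1 h2
    exact ⟨⟨h1, h2⟩, hl k y hy t h1 hk⟩
  -- Some component at y is non-zero because the matrix of Bethe components has no zero column; one
  -- move along that coordinate then makes all of them non-zero.
  have hstart : ∀ y ∈ p.generic P, ∃ z ∈ S, l y = l z := by
    intro y hy
    obtain ⟨k, hk⟩ : ∃ k, component p A As e M (Params.dropAt y k) ≠ 0 := by
      by_contra! h
      refine betheMatrix_det_ne_zero hp hA he hy.1
        (Matrix.det_eq_zero_of_column_eq_zero M fun k => ?_)
      rw [betheMatrix, Matrix.of_apply, h, mul_zero]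
    obtain ⟨t, ht⟩ := (hmove y hy k hk).exists
    exact ⟨_, ht⟩
  -- Both points are moved, coordinate by coordinate, to common values. Each cofinite condition
  -- holds for both points at once, so the two paths meet.
  have hpath : ∀ T : Finset (Fin (p.d + 1)), ∀ y ∈ S, ∀ y' ∈ S,
      ∃ z ∈ S, ∃ z' ∈ S, l y = l z ∧ l y' = l z' ∧ ∀ i ∈ T, z i = z' i := by
    intro T y hy y' hy'
    induction T using Finset.induction_on with
    | empty => exact ⟨y, hy, y', hy', rfl, rfl, by simp⟩
    | insert k T hk ih =>
      obtain ⟨z, hz, z', hz', h1, h2, h3⟩ := ih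
      obtain ⟨t, ⟨h4, h5⟩, h6, h7⟩ :=
        ((hmove z hz.1 k (hz.2 k)).and (hmove z' hz'.1 k (hz'.2 k))).exists
      refine ⟨_, h4, _, h6, h1.trans h5, h2.trans h7, fun i hi => ?_⟩
      rcases eq_or_ne i k with rfl | hik
      · simp
      · rw [Function.update_of_ne hik, Function.update_of_ne hik,
          h3 i ((Finset.mem_insert.1 hi).resolve_left hik)]
  intro y hy y' hy'
  obtain ⟨z, hz, h1⟩ := hstart y hy
  obtain ⟨z', hz', h2⟩ := hstart y' hy'
  obtain ⟨w, -, w', -, h3, h4, h5⟩ := hpath Finset.univ z hz z' hz'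
  rw [h1, h2, h3, h4, funext fun i => h5 i (Finset.mem_univ i)]

/-- The signed minors of a reduction are the components of the Bethe states, up to a constant. -/
lemma exists_minor_eq_const (hp : p.Valid) (hA : IsQRacahPair p A As)
    {e : Module.Basis (Fin (p.d + 1)) ℂ V} (he : IsEigenbasis p A As e) (M : Fin (p.d + 1))
    {P : MvPolynomial (Fin (p.d + 1)) ℂ}
    {W : (Fin (p.d + 1) → ℂ) → Matrix (Fin (p.d + 1)) (Fin (p.d + 1)) ℂ}
    (hW : IsReduction p M (p.generic P) W) :
    ∃ l : ℂ, l ≠ 0 ∧ ∀ y ∈ p.generic P, ∀ k : Fin (p.d + 1),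
      (-1) ^ (k : ℕ) * p.minor M W k y = l * betheMatrix p A As e y k M := by
  classical
  choose! l hl0 hl using fun y (hy : y ∈ p.generic P) =>
    exists_minor_eq hp hA he hy.1 M (hW.nondegenerate y hy) (hW.last_row y hy)
  have hc := const_on_generic hp hA he M (P := P) (l := l) (by
    intro k y hy t ht hk
    have h1 := hl y hy k
    have h2 := hl _ ht k
    have h3 := hW.indep k y hy _ ht fun i hi => (Function.update_of_ne hi _ _).symm
    rw [Params.minor, Params.minor] at h3
    rw [← h3, h1, betheMatrix, betheMatrix, Matrix.of_apply, Matrix.of_apply,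
      dropAt_update_self] at h2
    exact mul_right_cancel₀ (mul_ne_zero (weight_ne_zero hy.1 k) hk) h2)
  rcases (p.generic P).eq_empty_or_nonempty with h | ⟨y₀, hy₀⟩
  · exact ⟨1, one_ne_zero, by simp [h]⟩
  · refine ⟨l y₀, hl0 y₀ hy₀, fun y hy k => ?_⟩
    rw [hc y₀ hy₀ y hy, ← hl y hy k, Params.minor]

theorem existsUnique_psi (hp : p.Valid) (hA : IsQRacahPair p A As)
    {e : Module.Basis (Fin (p.d + 1)) ℂ V} (he : IsEigenbasis p A As e)
    {f : Fin (p.d + 1) → Module.Dual ℂ V} (hf : IsDualFamily p A e f) {α χ : ℂ} (m : ℤ)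
    (hχ : χ ≠ 0) {P : MvPolynomial (Fin (p.d + 1)) ℂ} (hP : P ≠ 0)
    {W : Fin (p.d + 1) → (Fin (p.d + 1) → ℂ) → Matrix (Fin (p.d + 1)) (Fin (p.d + 1)) ℂ}
    (hW : ∀ M, IsReduction p M (p.generic P) (W M)) :
    ∃! ψ : Fin (p.d + 1) → ℂ, ∀ M, ∀ y ∈ p.generic P, ∀ k : Fin (p.d + 1),
      scalarX p A As α χ m e f M (Params.dropAt y k)
        = ψ M * (-1) ^ ((k : ℕ) + 1) * p.minor M (W M) k y := by
  choose l hl0 hl using fun M => exists_minor_eq_const hp hA he M (hW M)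
  have key : ∀ M, ∀ y ∈ p.generic P, ∀ k : Fin (p.d + 1),
      scalarX p A As α χ m e f M (Params.dropAt y k)
        = betheCoeff p α χ m p.d * betheMatrix p A As e y k M := fun M y hy k => by
    rw [scalarX_eq (u := Params.dropAt y k) hp hχ m hf M fun i => hy.1.ne_zero _, betheMatrix,
      Matrix.of_apply]
  -- The minus sign compensates between the exponent (k : ℕ) + 1, which is the 1-based position, and
  -- the exponent k of the signed minors.
  refine ⟨fun M => -(betheCoeff p α χ m p.d / l M), fun M y hy k => ?_, fun ψ hψ => ?_⟩
  · have h := hl M y hy k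
    have h0 := hl0 M
    rw [key M y hy]
    have : betheMatrix p A As e y k M = (l M)⁻¹ * ((-1) ^ (k : ℕ) * p.minor M (W M) k y) := by
      rw [h, inv_mul_cancel_left₀ h0]
    rw [this]
    ring
  · funext M
    obtain ⟨y, hy⟩ := generic_nonempty hp hP
    obtain ⟨k, hk⟩ : ∃ k, betheMatrix p A As e y k M ≠ 0 := by
      by_contra! h
      exact betheMatrix_det_ne_zero hp hA he hy.1 (Matrix.det_eq_zero_of_column_eq_zero M h)
    have h1 := hψ M y hy k
    have h2 := hl M y hy k
    have h0 := hl0 M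
    rw [key M y hy] at h1
    refine mul_right_cancel₀ (mul_ne_zero h0 hk) ?_
    rw [← h2]
    have : -(betheCoeff p α χ m p.d / l M) * ((-1) ^ (k : ℕ) * p.minor M (W M) k y)
      = -(betheCoeff p α χ m p.d * betheMatrix p A As e y k M) := by rw [h2]; field_simp
    rw [this, h1]
    ring

end Connect

end QRacah

/-! ### Inhomogeneous Bethe equations and eigenvectors of A^*. -/

namespace QRacah

open Polynomial

section Identity

lemma eigenvalue_identity {q Q b c x x' r m : ℂ} (hq : q ≠ 0) (hQ : Q ≠ 0) (hb : b ≠ 0)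
    (hx : x ≠ 0) (hr : r ≠ 0) (h1 : b * c = r⁻¹ ^ 2) (h2 : x * x' = r⁻¹ ^ 2)
    (hq1 : q ^ 2 - 1 ≠ 0) (hq2 : q ^ 4 - 1 ≠ 0) :
    r / (q ^ 2 - (q ^ 2)⁻¹) * ((q - q⁻¹) * ((x * Q ^ 2 + x' * (Q ^ 2)⁻¹) * (b * Q ^ 2 + c * (Q ^ 2)⁻¹))
        - q⁻¹ * splitFun q Q r⁻¹ x x' b c m (Q ^ 2))
      + (q + q⁻¹) * r * awLin q Q r⁻¹ (b * Q + c * Q⁻¹) (x * Q + x' * Q⁻¹) m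
        / (q ^ 2 - (q ^ 2)⁻¹) ^ 2
      + r * b * Q ^ 2 * q⁻¹ * ((x * Q + x' * Q⁻¹ * q ^ 2) * q⁻¹ * ((Q - Q⁻¹) / (q - q⁻¹)))
      = Q ^ 2 * (b * (x' * r * Q⁻¹ + x * r * Q) * ((Q - Q⁻¹) / (q - q⁻¹)) + Q⁻¹ * m) := by
  obtain rfl : c = r⁻¹ ^ 2 / b := by field_simp; field_simp at h1; linear_combination h1
  obtain rfl : x' = r⁻¹ ^ 2 / x := by field_simp; field_simp at h2; linear_combination h2
  have e1 : q - q⁻¹ = (q ^ 2 - 1) / q := by field_simp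
  have e2 : q ^ 2 - (q ^ 2)⁻¹ = (q ^ 4 - 1) / q ^ 2 := by field_simp
  unfold splitFun awLin
  rw [e1, e2]
  field_simp
  ring

lemma leading_identity {q b c r z : ℂ} {n : ℕ} (hq : q ≠ 0) (h2 : q ^ 2 - (q ^ 2)⁻¹ ≠ 0)
    (hz : (q ^ 2) ^ (n + 1) = z) (hz0 : z ≠ 0) :
    r / (q ^ 2 - (q ^ 2)⁻¹) * (q * (b * (q ^ 2) ^ (n + 1 + 1) + c * ((q ^ 2) ^ (n + 1 + 1))⁻¹)
      - q⁻¹ * (b * (q ^ 2) ^ (n + 1) + c * ((q ^ 2) ^ (n + 1))⁻¹)) = q * z * b * r := by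
  rw [pow_succ _ (n + 1), hz]
  have e : q * (b * (z * q ^ 2) + c * (z * q ^ 2)⁻¹) - q⁻¹ * (b * z + c * z⁻¹)
      = (q ^ 2 - (q ^ 2)⁻¹) * (q * z * b) := by
    field_simp
    ring
  rw [e]
  generalize q ^ 2 - (q ^ 2)⁻¹ = y at *
  field_simp

end Identity

section BetheEquations

variable {p : Params}

/-- The inhomogeneous term is the characteristic polynomial of A^⋄ at σ(u). The factor with ζ⁻¹ at k
is paired with the factor with ζ at d - k: the product of the two powers of q^{1/2} is q, and the
pair gives r₀ (σ(u) - θ^⋄_k). -/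
lemma prod_bb_eq (hp : p.Valid) {u : ℂ} (hu : u ≠ 0) :
    ∏ k ∈ Finset.range (p.d + 1), (bb (p.qh ^ (1 + 2 * (k : ℤ) - (p.d : ℤ)) * p.ζ * u)
        * bb (p.qh ^ (1 + 2 * (k : ℤ) - (p.d : ℤ)) * p.ζ⁻¹ * u))
      = p.r₀ ^ (p.d + 1) * (newton p.θd (p.d + 1)).eval (p.σ u) := by
  have hq := hp.q_ne
  have hr := hp.r₀_ne
  have hζ := hp.ζ_ne
  have hqh : p.qh ≠ 0 := fun h => hq (by rw [← hp.qh_sq, h]; simp)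
  have h1 : ∀ k ∈ Finset.range (p.d + 1),
      bb (p.qh ^ (1 + 2 * (k : ℤ) - (p.d : ℤ)) * p.ζ⁻¹ * u)
        * bb (p.qh ^ (1 + 2 * ((p.d + 1 - 1 - k : ℕ) : ℤ) - (p.d : ℤ)) * p.ζ * u)
      = p.r₀ * (p.σ u - p.θd k) := by
    intro k hk
    have hkd : k ≤ p.d := by simpa [Nat.lt_succ_iff] using hk
    have e1 : p.qh ^ (1 + 2 * ((p.d + 1 - 1 - k : ℕ) : ℤ) - (p.d : ℤ))
        = p.q * (p.qh ^ (1 + 2 * (k : ℤ) - (p.d : ℤ)))⁻¹ := by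
      rw [← hp.qh_sq, ← zpow_natCast, ← zpow_neg, ← zpow_add₀ hqh]
      congr 1
      push_cast [Nat.add_sub_cancel, Nat.cast_sub hkd]
      ring
    have e2 : (p.qh ^ (1 + 2 * (k : ℤ) - (p.d : ℤ))) ^ 2 = p.q * (p.q ^ 2) ^ k * (p.q ^ p.d)⁻¹ := by
      rw [← hp.qh_sq, ← pow_mul, ← pow_mul, ← pow_mul, ← zpow_natCast, ← zpow_mul, ← zpow_natCast,
        ← zpow_natCast, ← zpow_natCast, ← zpow_neg, ← zpow_add₀ hqh, ← zpow_add₀ hqh]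
      congr 1
      push_cast
      ring
    have e3 := hp.ζ_inv_two_eq
    have hz : (p.q ^ 2) ^ k ≠ 0 := by positivity
    have ha : p.qh ^ (1 + 2 * (k : ℤ) - (p.d : ℤ)) ≠ 0 := zpow_ne_zero _ hqh
    rw [e1, Params.θd, racahSeq]
    generalize p.qh ^ (1 + 2 * (k : ℤ) - (p.d : ℤ)) = a at *
    have e4 : bb (a * p.ζ⁻¹ * u) * bb (p.q * a⁻¹ * p.ζ * u)
        = p.q * u ^ 2 + p.q⁻¹ * (u ^ 2)⁻¹ - a ^ 2 * p.ζ⁻¹ ^ 2 * p.q⁻¹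
          - (a ^ 2 * p.ζ⁻¹ ^ 2 * p.q⁻¹)⁻¹ := by
      unfold bb
      field_simp
      ring
    have e5 : a ^ 2 * p.ζ⁻¹ ^ 2 * p.q⁻¹ = p.bd * p.r₀ * (p.q ^ 2) ^ k := by
      have hQ := hp.Q_ne
      rw [e2, e3]
      field_simp
    have e6 : (a ^ 2 * p.ζ⁻¹ ^ 2 * p.q⁻¹)⁻¹ = p.cd * p.r₀ * ((p.q ^ 2) ^ k)⁻¹ := by
      rw [e5, hp.cd_mul_r₀, mul_inv]
    rw [e4, e6, e5, Params.σ]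
    field_simp
    ring
  rw [Finset.prod_mul_distrib, mul_comm, ← Finset.prod_range_reflect
    (fun k => bb (p.qh ^ (1 + 2 * (k : ℤ) - (p.d : ℤ)) * p.ζ * u)), ← Finset.prod_mul_distrib,
    Finset.prod_congr rfl h1, Finset.prod_mul_distrib, newton, eval_prod]
  simp

lemma bb_neg_inv (x : ℂ) : bb x⁻¹ = -bb x := by rw [bb, bb, inv_inv]; ring

lemma f_mul (p : Params) {u v : ℂ} (h : bb (u * v⁻¹) * bb (p.q * u * v) ≠ 0) :
    p.f u v * (bb (u * v⁻¹) * bb (p.q * u * v)) = bb (u / (p.q * v)) * bb (u * v) := by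
  have e1 : bb (v / u) = -bb (u * v⁻¹) := by rw [← bb_neg_inv]; congr 1; rw [mul_inv, inv_inv]; ring
  have e2 : bb (p.q * v / u) = -bb (u / (p.q * v)) := by rw [← bb_neg_inv, inv_div]
  have h1 := left_ne_zero_of_mul h
  have h2 := right_ne_zero_of_mul h
  rw [Params.f, e1, e2]
  generalize bb (u * v⁻¹) = x at *
  generalize bb (p.q * u * v) = y at *
  generalize bb (u / (p.q * v)) = z at *
  field_simp

lemma h_mul (p : Params) {u v : ℂ} (h : bb (u * v⁻¹) * bb (p.q * u * v) ≠ 0) :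
    p.h u v * (bb (u * v⁻¹) * bb (p.q * u * v)) = bb (p.q * u / v) * bb (p.q ^ 2 * u * v) := by
  have h1 := left_ne_zero_of_mul h
  have h2 := right_ne_zero_of_mul h
  rw [Params.h, div_eq_mul_inv u v]
  generalize bb (u * v⁻¹) = x at *
  generalize bb (p.q * u * v) = y at *
  field_simp

/-- The index j = i contributes b(q⁻¹) b(u_i²), the source of the prefactor; the other indices give
the functions `Params.f`. The upward shift in `rootPoly_eval_mul` gives `Params.h` in the same way.
-/
lemma rootPoly_eval_div (hp : p.Valid) {n : ℕ} {u : Fin n → ℂ} (hu : ∀ i, u i ≠ 0) (i : Fin n)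
    (h : ∀ j, j ≠ i → bb (u i * (u j)⁻¹) * bb (p.q * u i * u j) ≠ 0) :
    (rootPoly p u).eval (p.σ (u i / p.q)) * p.r₀ ^ n
      = -bb p.q * bb (u i ^ 2) * ((∏ j ∈ Finset.univ.erase i, p.f (u i) (u j))
        * ∏ j ∈ Finset.univ.erase i, bb (u i * (u j)⁻¹) * bb (p.q * u i * u j)) := by
  have hq := hp.q_ne
  have hr := hp.r₀_ne
  have h1 : ∀ j, (p.σ (u i / p.q) - p.σ (u j)) * p.r₀ = bb (u i / (p.q * u j)) * bb (u i * u j) := by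
    intro j
    rw [σ_sub hp (div_ne_zero (hu i) hq) (hu j), div_div, mul_div_cancel₀ _ hq, div_mul_cancel₀ _ hr]
  have h2 : ∏ j : Fin n, p.r₀ = p.r₀ ^ n := by simp
  rw [rootPoly_eval, ← h2, ← Finset.prod_mul_distrib,
    ← Finset.mul_prod_erase _ _ (Finset.mem_univ i), h1, ← Finset.prod_mul_distrib]
  congr 1
  · rw [← bb_neg_inv, sq]
    have : u i / (p.q * u i) = p.q⁻¹ := by have := hu i; field_simp
    rw [this]
  · refine Finset.prod_congr rfl fun j hj => ?_
    rw [h1, f_mul p (h j (Finset.ne_of_mem_erase hj))]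

lemma rootPoly_eval_mul (hp : p.Valid) {n : ℕ} {u : Fin n → ℂ} (hu : ∀ i, u i ≠ 0) (i : Fin n)
    (h : ∀ j, j ≠ i → bb (u i * (u j)⁻¹) * bb (p.q * u i * u j) ≠ 0) :
    (rootPoly p u).eval (p.σ (p.q * u i)) * p.r₀ ^ n
      = bb p.q * bb (p.q ^ 2 * u i ^ 2) * ((∏ j ∈ Finset.univ.erase i, p.h (u i) (u j))
        * ∏ j ∈ Finset.univ.erase i, bb (u i * (u j)⁻¹) * bb (p.q * u i * u j)) := by
  have hq := hp.q_ne
  have hr := hp.r₀_ne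
  have h1 : ∀ j, (p.σ (p.q * u i) - p.σ (u j)) * p.r₀
      = bb (p.q * u i / u j) * bb (p.q ^ 2 * u i * u j) := by
    intro j
    rw [σ_sub hp (mul_ne_zero hq (hu i)) (hu j), div_mul_cancel₀ _ hr]
    congr 2
    ring
  have h2 : ∏ j : Fin n, p.r₀ = p.r₀ ^ n := by simp
  rw [rootPoly_eval, ← h2, ← Finset.prod_mul_distrib,
    ← Finset.mul_prod_erase _ _ (Finset.mem_univ i), h1, ← Finset.prod_mul_distrib]
  congr 1
  · rw [mul_div_cancel_right₀ _ (hu i), mul_assoc, ← sq]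
  · refine Finset.prod_congr rfl fun j hj => ?_
    rw [h1, h_mul p (h j (Finset.ne_of_mem_erase hj))]

/-- The inhomogeneous Bethe equation in terms of the polynomial of the Bethe roots. -/
lemma bethe_eval (hp : p.Valid) {u : Fin p.d → ℂ} (hu : ∀ i, p.GoodPoint (u i)) {i : Fin p.d}
    (h : ∀ j, j ≠ i → bb (u i * (u j)⁻¹) * bb (p.q * u i * u j) ≠ 0) (hE : p.inhomE u i = 0) :
    p.coef₁ (u i) * (u i ^ 2)⁻¹ * (rootPoly p u).eval (p.σ (u i / p.q))
      + p.coef₂ (u i) * (p.q ^ 2 * u i ^ 2) * (rootPoly p u).eval (p.σ (p.q * u i))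
      = p.νMinus * p.r₀ * (newton p.θd (p.d + 1)).eval (p.σ (u i)) := by
  have hr := hp.r₀_ne
  have hq := hp.q_ne
  have hbq : bb p.q ≠ 0 := hp.q_sub_ne
  have e1 := rootPoly_eval_div hp (fun i => (hu i).ne_zero) i h
  have e2 := rootPoly_eval_mul hp (fun i => (hu i).ne_zero) i h
  have hD : ∏ j ∈ Finset.univ.erase i, bb (u i * (u j)⁻¹) * bb (p.q * u i * u j) ≠ 0 :=
    Finset.prod_ne_zero_iff.2 fun j hj => h j (Finset.ne_of_mem_erase hj)
  rw [Params.inhomE, prod_bb_eq hp (hu i).ne_zero] at hE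
  obtain ⟨g1, g2, g3, g4⟩ := hu i
  rw [Params.coef₁, Params.coef₂]
  generalize (rootPoly p u).eval (p.σ (u i / p.q)) = F₁ at *
  generalize (rootPoly p u).eval (p.σ (p.q * u i)) = F₂ at *
  generalize (newton p.θd (p.d + 1)).eval (p.σ (u i)) = N at *
  generalize ∏ j ∈ Finset.univ.erase i, bb (u i * (u j)⁻¹) * bb (p.q * u i * u j) = D at *
  generalize ∏ j ∈ Finset.univ.erase i, p.f (u i) (u j) = f at *
  generalize ∏ j ∈ Finset.univ.erase i, p.h (u i) (u j) = k at *
  generalize p.Λ₁ (u i) = L₁ at *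
  generalize p.Λ₂ (u i) = L₂ at *
  generalize u i = x at *
  have hrd : p.r₀ ^ p.d ≠ 0 := pow_ne_zero _ hr
  rw [pow_succ p.r₀] at hE
  generalize p.r₀ ^ p.d = R at *
  obtain rfl : F₁ = -bb p.q * bb (x ^ 2) * (f * D) / R := by rw [eq_div_iff hrd, e1]
  obtain rfl : F₂ = bb p.q * bb (p.q ^ 2 * x ^ 2) * (k * D) / R := by rw [eq_div_iff hrd, e2]
  generalize bb p.q = B at *
  generalize bb (x ^ 2) = B₁ at *
  generalize bb (p.q * x ^ 2) = B₂ at *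
  generalize bb (p.q ^ 2 * x ^ 2) = B₃ at *
  field_simp at hE ⊢
  linear_combination -hE

end BetheEquations

section Eigenvector

variable {V : Type*} [AddCommGroup V] [Module ℂ V] {p : Params} {A As : Module.End ℂ V}

lemma star_aeval_apply (hp : p.Valid) (hA : AskeyWilson p A As) {v : V} {F F' G : ℂ[X]}
    (hF : ActRel p A As v F F') (hG : ActRel p A As v (X * F) G) :
    As (aeval (diamond p A As) F v) = aeval (diamond p A As)
      ((p.r₀ / (p.q ^ 2 - (p.q ^ 2)⁻¹)) • (p.q • G - p.q⁻¹ • (X * F')) - (p.η / p.ρ) • F) v := by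
  refine (congrArg (fun T : Module.End ℂ V => T (aeval (diamond p A As) F v))
    (As_eq hp hA)).trans ?_
  have h1 := hG.act
  rw [map_mul, aeval_X, Module.End.mul_apply] at h1
  simp only [qComm, map_sub, map_smul, LinearMap.sub_apply, LinearMap.smul_apply, map_mul, aeval_X,
    Module.End.mul_apply, hF.act, h1, Module.End.one_apply]

lemma actRel_newton_lower (hp : p.Valid) (hA : IsQRacahPair p A As)
    {e : Module.Basis (Fin (p.d + 1)) ℂ V} (he : IsEigenbasis p A As e) (n : ℕ) :
    ∃ R : ℂ[X], R.degree < (n : ℕ) ∧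
      ActRel p A As (e 0) (newton p.θd n) (p.θ n • newton p.θd n + R) := by
  cases n with
  | zero => exact ⟨0, by simp, by simpa using actRel_newton_zero hp he⟩
  | succ n => exact ⟨_, (degree_smul_le _ _).trans_lt (newton_degree_lt (by omega)),
      actRel_newton hp hA he n⟩

/-- The subleading Newton coefficient is the difference of the sums of roots. The equation `hm` lets
the statement be used with m = p.d. -/
lemma rootPoly_expand (p : Params) (t : ℕ → ℂ) {m n : ℕ} (hm : m = n + 1) (u : Fin m → ℂ) :
    (rootPoly p u - newton t (n + 1)
      - (∑ k ∈ Finset.range (n + 1), t k - ∑ j, p.σ (u j)) • newton t n).degree < (n : ℕ) := by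
  subst hm
  have h1 : (rootPoly p u - newton t (n + 1)).degree < (n + 1 : ℕ) := by
    have := degree_sub_newton (t := t) (n := n + 1) (rootPoly_degree_lt (p := p) (v := u))
    have hc : (rootPoly p u).coeff (n + 1) = 1 := by
      have := (rootPoly_monic (p := p) (v := u)).coeff_natDegree
      rwa [rootPoly_natDegree] at this
    rwa [hc, one_smul] at this
  have h2 : (rootPoly p u - newton t (n + 1)).coeff n
      = ∑ k ∈ Finset.range (n + 1), t k - ∑ j, p.σ (u j) := by
    have e1 := prod_X_sub_C_coeff_card_pred (R := ℂ) Finset.univ (fun j : Fin (n + 1) => p.σ (u j))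
      (by simp)
    have e2 := prod_X_sub_C_coeff_card_pred (R := ℂ) (Finset.range (n + 1)) t (by simp)
    simp only [Finset.card_univ, Fintype.card_fin, Finset.card_range, Nat.add_sub_cancel] at e1 e2
    rw [coeff_sub, rootPoly, newton, e1, e2]
    ring
  have h3 := degree_sub_newton (t := t) h1
  rwa [h2] at h3

/-- These are the factors that [A, D]_q attaches to the two shifts, and hence the additional powers
of u in the Bethe function. -/
lemma r₀_mul_bb_q (hp : p.Valid) {u : ℂ} (hu : u ≠ 0) :
    p.r₀ / (p.q ^ 2 - (p.q ^ 2)⁻¹) * (p.q * p.σ (u / p.q) - p.q⁻¹ * p.σ u) = (u ^ 2)⁻¹ ∧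
    p.r₀ / (p.q ^ 2 - (p.q ^ 2)⁻¹) * (p.q * p.σ (p.q * u) - p.q⁻¹ * p.σ u) = p.q ^ 2 * u ^ 2 := by
  have hq := hp.q_ne
  have hr := hp.r₀_ne
  have h2 := hp.q_sq_sub_ne
  have h2' : p.q ^ 4 - 1 ≠ 0 := by
    intro h; apply h2; field_simp; linear_combination h
  have e2 : p.q ^ 2 - (p.q ^ 2)⁻¹ = (p.q ^ 4 - 1) / p.q ^ 2 := by field_simp
  rw [e2]
  unfold Params.σ
  constructor <;> field_simp <;> ring

/-- The eigenvalue of `A^*` on the Bethe state as a function of the subleading coefficient. -/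
def betheEig (p : Params) (n : ℕ) (ξ : ℂ) : ℂ :=
  p.r₀ / (p.q ^ 2 - (p.q ^ 2)⁻¹) * (p.q * ((p.θd (n + 1) + ξ) * p.θ (n + 1))
      - p.q⁻¹ * (p.θ (n + 1) * p.θd (n + 1) + p.diamondSplit (n + 1) + ξ * p.θ n)) - p.η / p.ρ

/-- The Bethe state at a solution of the inhomogeneous Bethe equations is an eigenvector of `A^*`. -/
theorem star_bethe (hp : p.Valid) (hA : IsQRacahPair p A As)
    {e : Module.Basis (Fin (p.d + 1)) ℂ V} (he : IsEigenbasis p A As e) {n : ℕ} (hn : p.d = n + 1)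
    {u : Fin p.d → ℂ} (hu : ∀ i, p.GoodPoint (u i))
    (h : ∀ i j, j ≠ i → bb (u i * (u j)⁻¹) * bb (p.q * u i * u j) ≠ 0)
    (hE : ∀ i, p.inhomE u i = 0) :
    As (aeval (diamond p A As) (rootPoly p u) (e 0))
      = betheEig p n (∑ k ∈ Finset.range (n + 1), p.θd k - ∑ j, p.σ (u j))
        • aeval (diamond p A As) (rootPoly p u) (e 0) := by
  set ξ := ∑ k ∈ Finset.range (n + 1), p.θd k - ∑ j, p.σ (u j)
  set δ := p.r₀ / (p.q ^ 2 - (p.q ^ 2)⁻¹) with hδ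
  set F := rootPoly p u with hF
  set N := newton p.θd with hN
  have hNd : newton p.θd (p.d + 1) = N (n + 1 + 1) := by rw [hn]
  obtain ⟨l, hl⟩ : ∃ l, l = F - N (n + 1) - ξ • N n := ⟨_, rfl⟩
  have hldeg : l.degree < (n : ℕ) := hl ▸ rootPoly_expand p p.θd hn u
  have hFl : F = N (n + 1) + ξ • N n + l := by rw [hl]; ring
  obtain ⟨l', hl'deg, hl'⟩ := exists_actRel hp hA he n l hldeg
  obtain ⟨R, hRdeg, hR⟩ := actRel_newton_lower hp hA he n
  have hF' : ActRel p A As (e 0) F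
      (p.θ (n + 1) • N (n + 1) + p.diamondSplit (n + 1) • N n + ξ • (p.θ n • N n + R) + l') := by
    rw [hFl]
    exact ((actRel_newton hp hA he n).add (hR.smul ξ)).add hl'
  have hXdeg : ∀ {m : ℕ} {S : ℂ[X]}, S.degree < (m : ℕ) → (X * S).degree < ((m + 1 : ℕ) : WithBot ℕ) := by
    intro m S hS
    rw [degree_lt_iff_coeff_zero] at hS ⊢
    intro k hk
    obtain ⟨k, rfl⟩ := Nat.exists_eq_succ_of_ne_zero (by omega : k ≠ 0)
    rw [Nat.succ_eq_add_one, coeff_X_mul]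
    exact hS k (by omega)
  have hadd : ∀ {m : ℕ} {S T : ℂ[X]}, S.degree < (m : ℕ) → T.degree < (m : ℕ) →
      (S + T).degree < (m : ℕ) := fun hS hT => (degree_add_le _ _).trans_lt (max_lt hS hT)
  have hsmul : ∀ {m : ℕ} {S : ℂ[X]} (c : ℂ), S.degree < (m : ℕ) → (c • S).degree < (m : ℕ) :=
    fun c hS => (degree_smul_le _ _).trans_lt hS
  have hsucc : ∀ {m : ℕ} {S : ℂ[X]}, S.degree < (m : ℕ) → S.degree < ((m + 1 : ℕ) : WithBot ℕ) :=
    fun hS => hS.trans (by exact_mod_cast Nat.lt_succ_self _)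
  have hNn : (N n).degree < (n + 1 : ℕ) := newton_degree_lt (by omega)
  obtain ⟨S, hSdeg, hS⟩ := exists_actRel hp hA he (n + 1) ((ξ * p.θd n) • N n + X * l)
    (hadd (hsmul _ hNn) (hXdeg hldeg))
  have hXF : X * F = N (n + 1 + 1) + (p.θd (n + 1) + ξ) • N (n + 1)
      + ((ξ * p.θd n) • N n + X * l) := by
    rw [hFl, mul_add, mul_add, mul_smul_comm, X_mul_newton, X_mul_newton]
    module
  have hlast : p.diamondSplit (n + 1 + 1) = 0 := by
    rw [← hn]; exact splitCoeff_last hp _ _ _ _ _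
  have hG : ActRel p A As (e 0) (X * F) (p.θ (n + 1 + 1) • N (n + 1 + 1)
      + (p.θd (n + 1) + ξ) • (p.θ (n + 1) • N (n + 1) + p.diamondSplit (n + 1) • N n) + S) := by
    rw [hXF]
    have := ((actRel_newton hp hA he (n + 1)).add
      ((actRel_newton hp hA he n).smul (p.θd (n + 1) + ξ))).add hS
    rwa [hlast, zero_smul, add_zero] at this
  have key := star_aeval_apply hp hA.askeyWilson hF' hG
  -- The top coefficient of A^* F is the constant in front of the inhomogeneous term, so subtraction
  -- of that multiple of the characteristic polynomial lowers the degree.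
  have hlead : δ * (p.q * p.θ (n + 1 + 1) - p.q⁻¹ * p.θ (n + 1)) = p.νMinus * p.r₀ := by
    have hν : p.νMinus = p.q * (p.q ^ 2) ^ (n + 1) * p.b := by
      rw [Params.νMinus, hn, zpow_add₀ hp.q_ne, zpow_one, zpow_mul]
      norm_cast
    rw [hν, hδ, p.θ_eq, p.θ_eq, racahSeq, racahSeq]
    exact leading_identity hp.q_ne hp.q_sq_sub_ne rfl (pow_ne_zero _ (pow_ne_zero _ hp.q_ne))
  -- After the top coefficient, `betheEig` matches the next one. The difference of the two sides
  -- then has degree less than d and vanishes at the d distinct nodes σ(u_i) by the Bethe equations.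
  have hpoly : δ • (p.q • (p.θ (n + 1 + 1) • N (n + 1 + 1)
      + (p.θd (n + 1) + ξ) • (p.θ (n + 1) • N (n + 1) + p.diamondSplit (n + 1) • N n) + S)
      - p.q⁻¹ • (X * (p.θ (n + 1) • N (n + 1) + p.diamondSplit (n + 1) • N n
        + ξ • (p.θ n • N n + R) + l'))) - (p.η / p.ρ) • F
      = (p.νMinus * p.r₀) • N (n + 1 + 1) + betheEig p n ξ • F := by
    rw [← sub_eq_zero]
    refine eq_zero_of_degree_lt_of_eval_index_eq_zero (s := Finset.univ) (v := fun i => p.σ (u i))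
      ?_ ?_ ?_
    · intro i _ j _ hij
      by_contra hne
      rw [σ_eq_iff hp (hu i).ne_zero (hu j).ne_zero, div_eq_mul_inv] at hij
      exact h i j (Ne.symm hne) hij
    · have e1 : δ • (p.q • (p.θ (n + 1 + 1) • N (n + 1 + 1)
          + (p.θd (n + 1) + ξ) • (p.θ (n + 1) • N (n + 1) + p.diamondSplit (n + 1) • N n) + S)
          - p.q⁻¹ • (X * (p.θ (n + 1) • N (n + 1) + p.diamondSplit (n + 1) • N n
            + ξ • (p.θ n • N n + R) + l'))) - (p.η / p.ρ) • F
          - ((p.νMinus * p.r₀) • N (n + 1 + 1) + betheEig p n ξ • F)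
          = (δ * p.q * ((p.θd (n + 1) + ξ) * p.diamondSplit (n + 1))) • N n + (δ * p.q) • S
            + (-(δ * p.q⁻¹ * (p.diamondSplit (n + 1) + ξ * p.θ n) * p.θd n)) • N n
            + (-(δ * p.q⁻¹ * ξ)) • (X * R) + (-(δ * p.q⁻¹)) • (X * l')
            + (-(p.η / p.ρ) - betheEig p n ξ) • (ξ • N n + l) := by
        rw [← hlead, hFl, mul_add, mul_add, mul_add, mul_smul_comm, mul_smul_comm, mul_smul_comm,
          mul_add, mul_smul_comm, X_mul_newton, X_mul_newton, betheEig, ← hδ]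
        match_scalars <;> ring
      rw [e1, Finset.card_univ, Fintype.card_fin, hn]
      exact hadd (hadd (hadd (hadd (hadd (hsmul _ hNn) (hsmul _ hSdeg)) (hsmul _ hNn))
        (hsmul _ (hXdeg hRdeg))) (hsmul _ (hXdeg hl'deg)))
        (hsmul _ (hadd (hsmul _ hNn) (hsucc hldeg)))
    · intro i _
      have h1 := hF'.diff (u i) (hu i)
      have h2 := hG.diff (u i) (hu i)
      have h3 : F.eval (p.σ (u i)) = 0 := by
        rw [hF, rootPoly_eval]
        exact Finset.prod_eq_zero (Finset.mem_univ i) (sub_self _)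
      have h4 := bethe_eval hp hu (h i) (hE i)
      obtain ⟨h5, h6⟩ := r₀_mul_bb_q hp (hu i).ne_zero
      rw [Params.diffOp_apply, h3, mul_zero, add_zero] at h1
      rw [Params.diffOp_apply, eval_mul, eval_mul, eval_mul, eval_X, eval_X, eval_X, h3, mul_zero,
        mul_zero, add_zero] at h2
      rw [eval_sub, eval_sub, eval_add, eval_smul _ F, eval_smul _ F, h3, eval_smul, eval_sub,
        eval_smul, ← h2, eval_smul, eval_mul, eval_X, ← h1, eval_smul]
      rw [hNd, ← hF] at h4
      simp only [smul_eq_mul, mul_zero, sub_zero, add_zero]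
      rw [← h4, ← h5, ← h6]
      ring
  rw [key, hpoly]
  simp only [map_add, map_smul, LinearMap.add_apply, LinearMap.smul_apply]
  have h0 : aeval (diamond p A As) (N (n + 1 + 1)) (e 0) = 0 := by
    have h0 := newton_diamond_apply hp hA he
    rwa [hNd] at h0
  rw [h0, smul_zero, zero_add]

lemma sum_racahSeq (hp : p.Valid) (x x' : ℂ) (n : ℕ) : ∑ k ∈ Finset.range n, racahSeq p.q x x' k
    = (x * p.q ^ n + x' * (p.q ^ n)⁻¹ * p.q ^ 2) * p.q⁻¹ * p.qNum n := by
  have hq := hp.q_ne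
  have h1 : p.q ^ 2 - 1 ≠ 0 := sub_ne_zero.2 (hp.q_pow_ne (by norm_num))
  have e1 : p.q - p.q⁻¹ = (p.q ^ 2 - 1) / p.q := by field_simp
  have h : ∀ n : ℕ, p.qNum n = (p.q ^ n - (p.q ^ n)⁻¹) * p.q / (p.q ^ 2 - 1) := by
    intro n
    rw [Params.qNum, zpow_neg, zpow_natCast, e1]
    field_simp
  rw [h]
  induction n with
  | zero => simp
  | succ n ih =>
    rw [Finset.sum_range_succ, ih, racahSeq, ← pow_mul, mul_comm 2 n, pow_mul, pow_succ p.q n]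
    have hQ : p.q ^ n ≠ 0 := pow_ne_zero _ hq
    generalize p.q ^ n = Q at *
    field_simp
    ring

/-- Matches the eigenvalue found from the subleading coefficients with the expression in
`IsInhomRoots`; the part free of the Bethe roots is `eigenvalue_identity`, with ∑ θ^⋄_k summed as a
geometric series. -/
lemma betheEig_eq (hp : p.Valid) {n : ℕ} (hn : p.d = n + 1) (u : Fin p.d → ℂ) :
    betheEig p n (∑ k ∈ Finset.range (n + 1), p.θd k - ∑ j, p.σ (u j))
      = p.q ^ (2 * (p.d : ℤ)) *
        (p.b * (p.ζ ^ (2 : ℤ) + p.ζ ^ (-2 : ℤ)) * p.qNum p.d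
          + p.q ^ (-(p.d : ℤ)) * (p.bs * p.q ^ (p.d : ℤ) + p.cs * p.q ^ (-(p.d : ℤ)))
          - p.q⁻¹ * p.b * ∑ j, (p.q * u j ^ (2 : ℤ) + p.q⁻¹ * u j ^ (-2 : ℤ))) := by
  have hq := hp.q_ne
  have hr := hp.r₀_ne
  have h1 : p.q ^ 2 - 1 ≠ 0 := sub_ne_zero.2 (hp.q_pow_ne (by norm_num))
  have h2 : p.q ^ 4 - 1 ≠ 0 := sub_ne_zero.2 (hp.q_pow_ne (by norm_num))
  have hQ := hp.Q_ne
  have hid := eigenvalue_identity (m := p.midS) hq hQ hp.b_ne hp.bd_ne hr hp.b_mul_c hp.bd_mul_cd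
    h1 h2
  have hσ : ∑ j, (p.q * u j ^ (2 : ℤ) + p.q⁻¹ * u j ^ (-2 : ℤ)) = p.r₀ * ∑ j, p.σ (u j) := by
    rw [Finset.mul_sum]
    refine Finset.sum_congr rfl fun j _ => ?_
    rw [Params.σ, mul_div_cancel₀ _ hr, zpow_neg]
    norm_cast
  have hθd : ∑ k ∈ Finset.range (n + 1), p.θd k
      = (p.bd * p.q ^ p.d + p.cd * (p.q ^ p.d)⁻¹ * p.q ^ 2) * p.q⁻¹ * p.qNum p.d := by
    rw [← hn, ← sum_racahSeq hp]
    rfl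
  have hζ : p.ζ ^ (2 : ℤ) + p.ζ ^ (-2 : ℤ)
      = p.cd * p.r₀ * (p.q ^ p.d)⁻¹ + p.bd * p.r₀ * p.q ^ p.d := by
    rw [hp.ζ_two, hp.ζ_neg_two, zpow_neg, zpow_natCast]
  have hN : p.qNum p.d = (p.q ^ p.d - (p.q ^ p.d)⁻¹) / (p.q - p.q⁻¹) := by
    rw [Params.qNum, zpow_neg, zpow_natCast]
  have hz : (p.q ^ 2) ^ (n + 1) = (p.q ^ p.d) ^ 2 := by rw [hn]; ring
  have hz' : (p.q ^ 2) ^ n = (p.q ^ p.d) ^ 2 * (p.q ^ 2)⁻¹ := by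
    rw [← hz, pow_succ]; field_simp; ring
  have hδ : ∀ ξ, p.r₀ / (p.q ^ 2 - (p.q ^ 2)⁻¹) * (p.q * p.θ (n + 1) - p.q⁻¹ * p.θ n) * ξ
      = p.r₀ * p.b * (p.q ^ p.d) ^ 2 * p.q⁻¹ * ξ := by
    intro ξ
    have e2 : p.q ^ 2 - (p.q ^ 2)⁻¹ = (p.q ^ 4 - 1) / p.q ^ 2 := by field_simp
    rw [p.θ_eq, p.θ_eq, racahSeq, racahSeq, hz, hz', e2]
    generalize p.q ^ p.d = Q at *
    field_simp
    ring
  have hη : p.η / p.ρ = -((p.q + p.q⁻¹) * p.r₀ * awLin p.q (p.q ^ p.d) p.r₀⁻¹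
      (p.b * p.q ^ p.d + p.c * (p.q ^ p.d)⁻¹) (p.bd * p.q ^ p.d + p.cd * (p.q ^ p.d)⁻¹) p.midS
        / (p.q ^ 2 - (p.q ^ 2)⁻¹) ^ 2) := by
    have h3 := hp.q_sq_sub_ne
    rw [hp.η_eq, p.ρ_eq, Params.midS]
    generalize awLin p.q (p.q ^ p.d) p.r₀⁻¹
      (p.b * p.q ^ p.d + p.c * (p.q ^ p.d)⁻¹) (p.bd * p.q ^ p.d + p.cd * (p.q ^ p.d)⁻¹)
      (p.bs * p.q ^ p.d + p.cs * (p.q ^ p.d)⁻¹) = x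
    generalize p.q ^ 2 - (p.q ^ 2)⁻¹ = y at *
    field_simp
  have hmid : p.q ^ (-(p.d : ℤ)) * (p.bs * p.q ^ (p.d : ℤ) + p.cs * p.q ^ (-(p.d : ℤ)))
      = (p.q ^ p.d)⁻¹ * p.midS := by
    rw [zpow_neg, zpow_natCast, Params.midS]
  have hq2 : p.q ^ (2 * (p.d : ℤ)) = (p.q ^ p.d) ^ 2 := by
    rw [mul_comm, zpow_mul]; norm_cast
  have hsplit : p.diamondSplit (n + 1)
      = splitFun p.q (p.q ^ p.d) p.r₀⁻¹ p.bd p.cd p.b p.c p.midS ((p.q ^ p.d) ^ 2) := by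
    rw [Params.diamondSplit, splitCoeff, hz]
  have e1 : p.θd (n + 1) = p.bd * (p.q ^ p.d) ^ 2 + p.cd * ((p.q ^ p.d) ^ 2)⁻¹ := by
    rw [Params.θd, racahSeq, hz]
  have e2 : p.θ (n + 1) = p.b * (p.q ^ p.d) ^ 2 + p.c * ((p.q ^ p.d) ^ 2)⁻¹ := by
    rw [p.θ_eq, racahSeq, hz]
  have hξ := hδ (∑ k ∈ Finset.range (n + 1), p.θd k - ∑ j, p.σ (u j))
  rw [← e1, ← e2, ← hN, ← hsplit] at hid
  rw [hσ, hζ, hmid, hq2]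
  rw [betheEig, hη]
  rw [hθd] at *
  linear_combination hid + hξ

end Eigenvector

end QRacah

/-! ### q-Racah polynomials as components of eigenvectors of A^*. -/

namespace QRacah

open Polynomial

namespace Params.Valid

variable {p : Params} (hp : p.Valid)
include hp

lemma starSplit_eq (n : ℕ) : p.starSplit n
    = p.q ^ 2 * (((p.q ^ 2) ^ n) ^ 2)⁻¹ * (1 - (p.q ^ 2) ^ n)
      * (1 - (p.q ^ 2) ^ n / (p.q ^ 2 * (p.q ^ p.d) ^ 2))
      * ((p.cs + p.b * (p.bd * p.r₀)⁻¹ * ((p.q ^ 2) ^ n / p.q))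
        * (p.c + p.bs * (p.bd * p.r₀) * ((p.q ^ 2) ^ n * (p.q ^ p.d) ^ 2 / p.q))) := by
  have hq := hp.q_ne
  have hQ := hp.Q_ne
  have he := hp.e_ne
  have hgm := hp.gm_eq
  rw [Params.starSplit, splitCoeff, splitFun]
  congr 1
  have e1 : (p.q ^ 2) ^ n * p.q ^ p.d * p.r₀⁻¹
      * (p.bd * p.q ^ p.d + p.cd * (p.q ^ p.d)⁻¹) / p.q
      = (p.q ^ 2) ^ n * p.q ^ p.d * (p.b * p.c * (p.bd * p.r₀ * p.q ^ p.d
        + (p.bd * p.r₀)⁻¹ * (p.q ^ p.d)⁻¹)) / p.q := by rw [← hgm]; ring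
  have hs := hp.bs_cs_eq
  rw [e1]
  generalize p.bd * p.r₀ = E at *
  generalize p.q ^ p.d = Q at *
  field_simp
  linear_combination -(p.q ^ 2) ^ n * p.q * E ^ 2 * Q ^ 2 * hs

/-- All factors of the split coefficient except 1 - q^{2n} and monomials occur in the numerator of
`Params.up`, which is non-zero wherever A^* is irreducible. -/
lemma starSplit_ne_zero {n : ℕ} (hup : p.up n ≠ 0) (hn : n ≠ 0) : p.starSplit n ≠ 0 := by
  have hq := hp.q_ne
  rw [hp.up_eq] at hup
  have h := left_ne_zero_of_mul hup
  rw [upFun] at h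
  have h1 := (div_ne_zero_iff.1 h).1
  have h2 := left_ne_zero_of_mul (left_ne_zero_of_mul h1)
  have h3 := right_ne_zero_of_mul (left_ne_zero_of_mul h1)
  have h4 := right_ne_zero_of_mul h1
  rw [hp.starSplit_eq]
  refine mul_ne_zero (mul_ne_zero (mul_ne_zero (mul_ne_zero (by positivity)
    (inv_ne_zero (by positivity))) ?_) ?_) (mul_ne_zero h4 h3)
  · rw [← pow_mul]
    exact sub_ne_zero.2 (hp.q_pow_ne (by omega)).symm
  · rwa [mul_comm (p.q ^ 2)]

end Params.Valid

section QRacahPolynomial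

variable {p : Params}

lemma racahSeq_sub {x x' Z z : ℂ} (hx' : x' ≠ 0) (hZ : Z ≠ 0) (hz : z ≠ 0) :
    (x * Z + x' * Z⁻¹) - (x * z + x' * z⁻¹) = -x' * z⁻¹ * ((1 - Z⁻¹ * z) * (1 - x / x' * Z * z)) := by
  field_simp
  ring

/-- The terms of the `q`-Racah polynomials in factored form. -/
lemma term_eq (hp : p.Valid) (M N k : ℕ) :
    qPoch (p.q ^ (-2 * (M : ℤ))) (p.q ^ 2) k * qPoch (p.b / p.c * p.q ^ (2 * (M : ℤ))) (p.q ^ 2) k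
        * qPoch (p.q ^ (-2 * (N : ℤ))) (p.q ^ 2) k
        * qPoch (p.bs / p.cs * p.q ^ (2 * (N : ℤ))) (p.q ^ 2) k
      / (qPoch (-(p.b * p.cd / p.cs) * p.r₀ * p.q) (p.q ^ 2) k
        * qPoch (-(p.bs * p.bd / p.c) * p.r₀ * p.q ^ (2 * (p.d : ℤ) + 1)) (p.q ^ 2) k
        * qPoch (p.q ^ (-2 * (p.d : ℤ))) (p.q ^ 2) k * qPoch (p.q ^ 2) (p.q ^ 2) k) * (p.q ^ 2) ^ k
      = ∏ j ∈ Finset.range k, (p.θs N - p.θs j) * (p.θ M - p.θ j) / p.starSplit (j + 1) := by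
  have hq := hp.q_ne
  have hQ := hp.Q_ne
  have hc := hp.c_ne
  have hcs := hp.cs_ne
  have he := hp.e_ne
  have hk : (p.q ^ 2) ^ k = ∏ j ∈ Finset.range k, p.q ^ 2 := by simp
  rw [hk]
  simp only [qPoch, ← Finset.prod_mul_distrib, ← Finset.prod_div_distrib]
  refine Finset.prod_congr rfl fun j _ => ?_
  have hz : (p.q ^ 2) ^ j ≠ 0 := by positivity
  have hM : p.q ^ (-2 * (M : ℤ)) = ((p.q ^ 2) ^ M)⁻¹ := by
    rw [neg_mul, zpow_neg, zpow_mul]; norm_cast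
  have hM' : p.q ^ (2 * (M : ℤ)) = (p.q ^ 2) ^ M := by rw [zpow_mul]; norm_cast
  have hN : p.q ^ (-2 * (N : ℤ)) = ((p.q ^ 2) ^ N)⁻¹ := by
    rw [neg_mul, zpow_neg, zpow_mul]; norm_cast
  have hN' : p.q ^ (2 * (N : ℤ)) = (p.q ^ 2) ^ N := by rw [zpow_mul]; norm_cast
  have hd : p.q ^ (-2 * (p.d : ℤ)) = ((p.q ^ p.d) ^ 2)⁻¹ := by
    rw [neg_mul, zpow_neg, mul_comm, zpow_mul]; norm_cast
  have hd' : p.q ^ (2 * (p.d : ℤ) + 1) = (p.q ^ p.d) ^ 2 * p.q := by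
    rw [zpow_add₀ hq, mul_comm (2 : ℤ), zpow_mul, zpow_one]; norm_cast
  have hb1 : -(p.b * p.cd / p.cs) * p.r₀ * p.q = -(p.b * (p.bd * p.r₀)⁻¹ / p.cs * p.q) := by
    rw [← hp.cd_mul_r₀]; ring
  have hb2 : -(p.bs * p.bd / p.c) * p.r₀ * ((p.q ^ p.d) ^ 2 * p.q)
      = -(p.bs * (p.bd * p.r₀) / p.c * (p.q ^ p.d) ^ 2 * p.q) := by ring
  rw [hM, hM', hN, hN', hd, hd', hb1, hb2, p.θ_eq, p.θ_eq, p.θs_eq, p.θs_eq, racahSeq, racahSeq,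
    racahSeq, racahSeq, racahSeq_sub hc (by positivity) hz,
    racahSeq_sub hcs (by positivity) hz]
  have hS : p.starSplit (j + 1) = (p.q ^ 2)⁻¹ * (((p.q ^ 2) ^ j) ^ 2)⁻¹ * (p.cs * p.c)
      * ((1 - -(p.b * (p.bd * p.r₀)⁻¹ / p.cs * p.q) * (p.q ^ 2) ^ j)
        * (1 - -(p.bs * (p.bd * p.r₀) / p.c * (p.q ^ p.d) ^ 2 * p.q) * (p.q ^ 2) ^ j)
        * (1 - ((p.q ^ p.d) ^ 2)⁻¹ * (p.q ^ 2) ^ j) * (1 - p.q ^ 2 * (p.q ^ 2) ^ j)) := by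
    rw [hp.starSplit_eq, pow_succ (p.q ^ 2)]
    generalize p.bd * p.r₀ = E at *
    generalize p.q ^ p.d = Q at *
    generalize (p.q ^ 2) ^ j = z at *
    field_simp
    ring
  rw [hS]
  generalize 1 - -(p.b * (p.bd * p.r₀)⁻¹ / p.cs * p.q) * (p.q ^ 2) ^ j = B₁
  generalize 1 - -(p.bs * (p.bd * p.r₀) / p.c * (p.q ^ p.d) ^ 2 * p.q) * (p.q ^ 2) ^ j = B₂
  generalize 1 - ((p.q ^ p.d) ^ 2)⁻¹ * (p.q ^ 2) ^ j = B₃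
  generalize 1 - p.q ^ 2 * (p.q ^ 2) ^ j = B₄
  generalize 1 - ((p.q ^ 2) ^ M)⁻¹ * (p.q ^ 2) ^ j = A₁
  generalize 1 - p.b / p.c * (p.q ^ 2) ^ M * (p.q ^ 2) ^ j = A₂
  generalize 1 - ((p.q ^ 2) ^ N)⁻¹ * (p.q ^ 2) ^ j = A₃
  generalize 1 - p.bs / p.cs * (p.q ^ 2) ^ N * (p.q ^ 2) ^ j = A₄
  generalize (p.q ^ 2) ^ j = z at *
  have e : (p.q ^ 2)⁻¹ * (z ^ 2)⁻¹ * (p.cs * p.c) ≠ 0 := by positivity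
  have e2 : -p.cs * z⁻¹ * (A₃ * A₄) * (-p.c * z⁻¹ * (A₁ * A₂))
      = (p.q ^ 2)⁻¹ * (z ^ 2)⁻¹ * (p.cs * p.c) * (A₁ * A₂ * A₃ * A₄ * p.q ^ 2) := by
    field_simp
  rw [e2, mul_div_mul_left _ _ e]
  ring

lemma qRacah_eq (hp : p.Valid) (M N : ℕ) : p.qRacah M N
    = ∑ k ∈ Finset.range (N + 1),
        ∏ j ∈ Finset.range k, (p.θs N - p.θs j) * (p.θ M - p.θ j) / p.starSplit (j + 1) := by
  rw [Params.qRacah, phi43]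
  simp only [term_eq hp]
  refine Finset.sum_subset (Finset.range_mono (by omega)) fun k hk hk' => ?_
  rw [Finset.mem_range] at hk hk'
  -- The terms added beyond min M N have index greater than M and contain the factor θ_M - θ_M.
  exact Finset.prod_eq_zero (i := M) (Finset.mem_range.2 (by omega)) (by simp)

lemma qRacah_zero (p : Params) (N : ℕ) : p.qRacah 0 N = 1 := by
  rw [Params.qRacah, Nat.zero_min, phi43]
  simp [qPoch]

end QRacahPolynomial

section StarEigenvectors

variable {V : Type*} [AddCommGroup V] [Module ℂ V] {p : Params} {A As : Module.End ℂ V}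

/-- The three-term recurrence has non-zero coefficients above the diagonal, so an eigenvector is
determined by its entry at 0. -/
lemma eq_zero_of_irredTridiagonal {n : ℕ} {T : Matrix (Fin (n + 1)) (Fin (n + 1)) ℂ}
    (hT : IrredTridiagonal T) {x : Fin (n + 1) → ℂ} {μ : ℂ} (hx : ∀ i, ∑ j, T i j * x j = μ * x i)
    (h0 : x 0 = 0) : x = 0 := by
  have h : ∀ k : ℕ, ∀ i : Fin (n + 1), (i : ℕ) ≤ k → x i = 0 := by
    intro k
    induction k with
    | zero =>
      intro i hi
      rw [show i = 0 from Fin.ext (by simpa using hi), h0]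
    | succ k ih =>
      intro i hi
      rcases hi.lt_or_eq with hlt | heq
      · exact ih i (by omega)
      have h1 := hx ⟨k, by omega⟩
      rw [ih ⟨k, by omega⟩ le_rfl, mul_zero, Finset.sum_eq_single i] at h1
      · exact (mul_eq_zero.1 h1).resolve_left (hT.2 _ _ (Or.inl heq.symm))
      · intro j _ hj
        rcases le_or_gt (j : ℕ) k with hjk | hjk
        · rw [ih j hjk, mul_zero]
        · rw [hT.1 _ _ (Or.inl _), zero_mul]
          have : (j : ℕ) ≠ i := fun h => hj (Fin.ext h)
          change k + 1 < (j : ℕ)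
          omega
      · simp
  funext i
  exact h i i le_rfl

lemma repr_star_apply {e : Module.Basis (Fin (p.d + 1)) ℂ V} (he : IsEigenbasis p A As e) (v : V)
    (i : Fin (p.d + 1)) : e.repr (As v) i = ∑ j, p.starMatrix i j * e.repr v j := by
  conv_lhs => rw [← e.sum_repr v]
  simp only [map_sum, map_smul, Finsupp.finsetSum_apply, Finsupp.smul_apply, repr_star he,
    smul_eq_mul, mul_comm]

lemma starMatrix_sum (f : ℕ → ℂ) (i : Fin (p.d + 1)) :
    ∑ j, p.starMatrix i j * f j = p.θs 0 * f i + p.lowN i * (f (i - 1) - f i)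
      + p.upN i * (f (i + 1) - f i) := by
  rw [sum_tridiagonal (a := fun i => p.θs 0 - p.upN i - p.lowN i) (B := p.upN) (C := p.lowN)
    (fun i j hij => ?_) (fun i => ?_) (fun i j hij => ?_) (fun i j hij => ?_)
    (by simp [Params.upN]) (by simp [Params.lowN])]
  · ring
  · rw [starMatrix_eq, if_neg (by omega), if_neg (by omega), if_neg (by rintro rfl; omega)]
  · rw [starMatrix_eq, if_neg (by omega), if_neg (by omega), if_pos rfl]
  · rw [starMatrix_eq, if_neg (by omega), if_pos hij]
  · rw [starMatrix_eq, if_pos hij]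

/-- The split form of `A^*` on the sum of the normalized eigenbasis of `A`. -/
lemma star_split (hp : p.Valid) (hA : IsQRacahPair p A As) (hd : p.d ≠ 0)
    {e : Module.Basis (Fin (p.d + 1)) ℂ V} (he : IsEigenbasis p A As e) (n : ℕ) :
    As (aeval A (newton p.θ (n + 1)) (∑ M, e M))
      = p.θs (n + 1) • aeval A (newton p.θ (n + 1)) (∑ M, e M)
        + p.starSplit (n + 1) • aeval A (newton p.θ n) (∑ M, e M) := by
  have hθ : p.θ = racahSeq p.q p.b p.c := funext p.θ_eq
  have hw : ∀ i, e.repr (∑ M, e M) i = 1 := by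
    intro i
    simp [Finsupp.single_apply, Finsupp.finsetSum_apply]
  have h0 : As (∑ M, e M) = p.θs 0 • ∑ M, e M := by
    apply e.repr.injective
    ext i
    rw [repr_star_apply he, map_smul, Finsupp.smul_apply, smul_eq_mul]
    simp only [hw]
    rw [starMatrix_sum (fun _ => 1)]
    ring
  have h1 : As (A (∑ M, e M) - p.θ 0 • ∑ M, e M)
      = p.θs 1 • (A (∑ M, e M) - p.θ 0 • ∑ M, e M) + p.starSplit 1 • ∑ M, e M := by
    apply e.repr.injective
    ext i
    rw [repr_star_apply he]
    simp only [map_sub, map_add, map_smul, Finsupp.sub_apply, Finsupp.add_apply, Finsupp.smul_apply,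
      repr_apply_eig e he.eig, hw, smul_eq_mul, mul_one]
    rw [starMatrix_sum (fun j => p.θ j - p.θ 0)]
    have := hp.star_linear hA.leonard.inj hd (Nat.lt_succ_iff.1 i.2)
    linear_combination this
  have hX : ∀ P : ℂ[X], aeval A (X * P) (∑ M, e M) = A (aeval A P (∑ M, e M)) := by
    intro P; rw [map_mul, aeval_X, Module.End.mul_apply]
  generalize ∑ M, e M = v at *
  rw [hθ, p.θs_eq, Params.starSplit]
  refine split_action (V' := V) (X' := A) hp.q_ne hp.Q_ne hp.b_ne hp.bs_ne hp.b_mul_c hp.bs_mul_cs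
    (i := LinearMap.applyₗ v ∘ₗ (aeval A).toLinearMap)
    (Y := As ∘ₗ LinearMap.applyₗ v ∘ₗ (aeval A).toLinearMap) hX ?_ ?_ ?_ n
  · intro P
    simp only [LinearMap.comp_apply, AlgHom.toLinearMap_apply, LinearMap.applyₗ_apply_apply, hX]
    generalize aeval A P v = w
    have h := congrArg (fun X : Module.End ℂ V => X w) (star_relation hp hA.askeyWilson)
    simp only [Module.End.mul_apply, LinearMap.add_apply, LinearMap.sub_apply,
      LinearMap.smul_apply, Module.End.one_apply] at h
    rw [h, p.ρ_eq, hp.η_eq, hp.ω_eq]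
  · rw [← p.θs_eq]
    simpa using h0
  · have e1 : newton (racahSeq p.q p.b p.c) 1 = X - C (p.θ 0) := by
      simp [newton, hθ]
    rw [e1, ← p.θs_eq]
    rw [Params.starSplit] at h1
    simpa [Module.algebraMap_end_apply] using h1

/-- The eigenvectors of `A^*` in the normalized eigenbasis of `A` are given by `q`-Racah
polynomials. -/
lemma exists_star_eigenvector (hp : p.Valid) (hA : IsQRacahPair p A As) (hd : p.d ≠ 0)
    {e : Module.Basis (Fin (p.d + 1)) ℂ V} (he : IsEigenbasis p A As e) (N : Fin (p.d + 1)) :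
    ∃ v : V, As v = p.θs N • v ∧ ∀ M, e.repr v M = p.qRacah M N := by
  set w := ∑ M, e M with hwdef
  -- These solve the two-term recurrence for eigenvectors in the split basis, where A^* is
  -- bidiagonal. The partial sums fail to be eigenvectors only by a boundary term, which vanishes at
  -- n = N.
  set c : ℕ → ℂ := fun k => ∏ j ∈ Finset.range k, (p.θs N - p.θs j) / p.starSplit (j + 1) with hc
  have hS : ∀ n, n < p.d → p.starSplit (n + 1) ≠ 0 := by
    intro n hn
    refine hp.starSplit_ne_zero (fun h => ?_) (by omega)
    refine (starMatrix_irred hA he).2 ⟨n, by omega⟩ ⟨n + 1, by omega⟩ (Or.inl rfl) ?_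
    rw [Params.starMatrix, if_neg (by simp; omega), if_pos rfl, h]
  have h0 : As w = p.θs 0 • w := by
    apply e.repr.injective
    ext i
    rw [repr_star_apply he, map_smul, Finsupp.smul_apply, smul_eq_mul]
    have hw : ∀ i, e.repr w i = 1 := by
      intro i
      simp [hwdef, Finsupp.single_apply, Finsupp.finsetSum_apply]
    simp only [hw]
    rw [starMatrix_sum (fun _ => 1)]
    ring
  have hsum : ∀ n, n ≤ p.d →
      As (∑ k ∈ Finset.range (n + 1), c k • aeval A (newton p.θ k) w)
        = p.θs N • ∑ k ∈ Finset.range (n + 1), c k • aeval A (newton p.θ k) w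
          - ((p.θs N - p.θs n) * c n) • aeval A (newton p.θ n) w := by
    intro n
    induction n with
    | zero =>
      intro _
      simp [c, newton_zero, h0]
      module
    | succ n ih =>
      intro hn
      rw [Finset.sum_range_succ, map_add, ih (by omega), map_smul, star_split hp hA hd he,
        ← hwdef]
      have hcn : c (n + 1) * p.starSplit (n + 1) = (p.θs N - p.θs n) * c n := by
        have := hS n (by omega)
        simp only [hc]
        rw [Finset.prod_range_succ]
        field_simp
      rw [← hcn]
      module
  refine ⟨_, (hsum N (Nat.lt_succ_iff.1 N.2)).trans (by rw [sub_self, zero_mul, zero_smul, sub_zero]),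
    fun M => ?_⟩
  have hN : ∀ k, e.repr (aeval A (newton p.θ k) w) M = ∏ j ∈ Finset.range k, (p.θ M - p.θ j) := by
    intro k
    induction k with
    | zero => simp [newton_zero, hwdef, Finsupp.single_apply, Finsupp.finsetSum_apply]
    | succ k ih =>
      rw [newton_succ, mul_comm, map_mul, Module.End.mul_apply, Finset.prod_range_succ, ← ih]
      simp only [map_sub, aeval_X, aeval_C, LinearMap.sub_apply, Module.algebraMap_end_apply,
        Finsupp.sub_apply, map_smul, Finsupp.smul_apply, smul_eq_mul, repr_apply_eig e he.eig]
      ring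
  rw [qRacah_eq hp]
  simp only [map_sum, map_smul, Finsupp.finsetSum_apply, Finsupp.smul_apply, smul_eq_mul, hN, hc,
    ← Finset.prod_mul_distrib]
  refine Finset.sum_congr rfl fun k _ => Finset.prod_congr rfl fun j _ => ?_
  ring

lemma repr_eq_qRacah (hp : p.Valid) (hA : IsQRacahPair p A As) (hd : p.d ≠ 0)
    {e : Module.Basis (Fin (p.d + 1)) ℂ V} (he : IsEigenbasis p A As e) {N : Fin (p.d + 1)} {v : V}
    (hv : As v = p.θs N • v) (M : Fin (p.d + 1)) :
    e.repr v M = e.repr v 0 * p.qRacah M N := by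
  obtain ⟨w, hw, hwM⟩ := exists_star_eigenvector hp hA hd he N
  have h := eq_zero_of_irredTridiagonal (starMatrix_irred hA he) (μ := p.θs N)
    (x := fun i => e.repr (v - e.repr v 0 • w) i) (fun i => by
      rw [← repr_star_apply he, map_sub, map_smul, hv, hw, smul_comm, ← smul_sub]
      simp) (by simp [hwM, qRacah_zero])
  have := congrFun h M
  simp only [map_sub, map_smul, Finsupp.sub_apply, Finsupp.smul_apply, smul_eq_mul, hwM,
    Pi.zero_apply] at this
  exact sub_eq_zero.1 this

/-- The components of the Bethe state at inhomogeneous Bethe roots. -/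
theorem component_eq_qRacah (hp : p.Valid) (hA : IsQRacahPair p A As)
    {e : Module.Basis (Fin (p.d + 1)) ℂ V} (he : IsEigenbasis p A As e)
    {y : Fin (p.d + 1) → ℂ} (hy : p.Regular y) {k N : Fin (p.d + 1)}
    (hN : p.IsInhomRoots N (Params.dropAt y k)) :
    component p A As e 0 (Params.dropAt y k) ≠ 0 ∧ ∀ M, component p A As e M (Params.dropAt y k)
      = component p A As e 0 (Params.dropAt y k) * p.qRacah M N := by
  have key : ∀ M, component p A As e M (Params.dropAt y k)
      = component p A As e 0 (Params.dropAt y k) * p.qRacah M N := by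
    intro M
    -- For d = 0 the only index is M = 0; the eigenvector argument needs d = n + 1.
    rcases Nat.eq_zero_or_eq_succ_pred p.d with hd | hn
    · obtain rfl : M = 0 := Fin.ext (by have := M.2; simp; omega)
      rw [Fin.val_zero, qRacah_zero, mul_one]
    · refine repr_eq_qRacah hp hA (by omega) he ?_ M
      rw [hN.eigenvalue, ← betheEig_eq hp hn]
      refine star_bethe hp hA he hn (fun i => hy.good _) (fun i j hij => ?_) hN.bethe
      have hne : k.succAbove i ≠ k.succAbove j := fun h => hij (Fin.succAbove_right_injective h).symm
      exact mul_ne_zero (by rw [← div_eq_mul_inv]; exact hy.bb_div_ne _ _ hne)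
        (hy.bb_mul_ne _ _ hne)
  refine ⟨fun h0 => ?_, key⟩
  refine aeval_apply_ne_zero e (diamond p A As)
    (fun i j hij => repr_diamond_eq_zero hA he i j (Or.inr hij))
    (fun i j hij => repr_diamond_ne_zero hp hA he i j (Or.inr hij))
    (rootPoly_monic (p := p) (v := Params.dropAt y k)).ne_zero rootPoly_natDegree.le ?_
  apply e.repr.injective
  ext M
  have := key M
  rw [h0, zero_mul] at this
  simpa [component] using this

end StarEigenvectors

end QRacah

end

/-! ### The determinant formula for the q-Racah polynomials. -/

theorem mainTheorem6 (p : QRacah.Params) (hp : p.Valid)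
    {V : Type*} [AddCommGroup V] [Module ℂ V] (A As : Module.End ℂ V)
    (hA : QRacah.IsQRacahPair p A As) :
    -- the normalized eigenbasis of `A` exists
    (∃ e : Module.Basis (Fin (p.d + 1)) ℂ V, QRacah.IsEigenbasis p A As e) ∧
    -- matrices with the required properties exist, at all regular points
    (∀ M : Fin (p.d + 1), ∃ W, QRacah.IsReduction p M {y | p.Regular y} W) ∧
    -- the determinant formula
    ∀ (e : Module.Basis (Fin (p.d + 1)) ℂ V) (f : Fin (p.d + 1) → Module.Dual ℂ V),
      QRacah.IsEigenbasis p A As e → QRacah.IsDualFamily p A e f →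
    ∀ (α χ : ℂ) (m : ℤ), χ ≠ 0 →
      (p.q ^ (2 : ℤ) - p.q ^ (-2 : ℤ)) * χ⁻¹ * α * p.b * p.q ^ (-m) = -1 →
    ∀ (P : MvPolynomial (Fin (p.d + 1)) ℂ), P ≠ 0 →
    ∀ (W : Fin (p.d + 1) → (Fin (p.d + 1) → ℂ) → Matrix (Fin (p.d + 1)) (Fin (p.d + 1)) ℂ),
      (∀ M, QRacah.IsReduction p M (p.generic P) (W M)) →
    -- there are unique scalars `ψ_M`, independent of `y`, that express the scalar products
    -- through the minors
    (∃! ψ : Fin (p.d + 1) → ℂ, ∀ M, ∀ y ∈ p.generic P, ∀ k : Fin (p.d + 1),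
      QRacah.scalarX p A As α χ m e f M (QRacah.Params.dropAt y k)
        = ψ M * (-1) ^ ((k : ℕ) + 1) * p.minor M (W M) k y) ∧
    -- and for them the q-Racah polynomials are given by the ratio of determinants
    ∀ ψ : Fin (p.d + 1) → ℂ,
      (∀ M, ∀ y ∈ p.generic P, ∀ k : Fin (p.d + 1),
        QRacah.scalarX p A As α χ m e f M (QRacah.Params.dropAt y k)
          = ψ M * (-1) ^ ((k : ℕ) + 1) * p.minor M (W M) k y) →
      ∀ (M N : Fin (p.d + 1)), ∀ y ∈ p.generic P,
        p.IsInhomRoots N (QRacah.Params.dropAt y (Fin.last p.d)) →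
        ψ 0 ≠ 0 ∧ p.minor 0 (W 0) (Fin.last p.d) y ≠ 0 ∧
        p.qRacah M N = ψ M / ψ 0 *
          (p.minor M (W M) (Fin.last p.d) y / p.minor 0 (W 0) (Fin.last p.d) y) := by
  refine ⟨QRacah.exists_eigenbasis hp hA, fun M => QRacah.exists_reduction hp hA M, ?_⟩
  intro e f he hf α χ m hχ hα P hP W hW
  -- The gauge condition excludes α = 0; hence the Bethe state carries a non-zero constant.
  have hα0 : α ≠ 0 := by
    rintro rfl
    simp at hα
  refine ⟨QRacah.existsUnique_psi hp hA he hf m hχ hP hW, fun ψ hψ M N y hy hN => ?_⟩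
  obtain ⟨h0, hM⟩ := QRacah.component_eq_qRacah hp hA he hy.1 hN
  -- The factor common to all components of the Bethe state; it is independent of M and disappears
  -- from the ratio.
  set κ := QRacah.betheCoeff p α χ m p.d * QRacah.weight (QRacah.Params.dropAt y (Fin.last p.d))
  have hκ : κ ≠ 0 := mul_ne_zero (QRacah.betheCoeff_ne_zero hp hα0 hχ m p.d)
    (QRacah.weight_ne_zero hy.1 _)
  have hX : ∀ M, κ * QRacah.component p A As e M (QRacah.Params.dropAt y (Fin.last p.d))
      = ψ M * (-1) ^ (p.d + 1) * p.minor M (W M) (Fin.last p.d) y := by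
    intro M
    have h := hψ M y hy (Fin.last p.d)
    rw [QRacah.scalarX_eq (u := QRacah.Params.dropAt y (Fin.last p.d)) hp hχ m hf M
      fun i => hy.1.ne_zero _, ← mul_assoc, Fin.val_last] at h
    exact h
  have hX0 := hX 0
  have hne := mul_ne_zero hκ h0
  have hs : (-1 : ℂ) ^ (p.d + 1) ≠ 0 := pow_ne_zero _ (by norm_num)
  -- The 0-th component at Bethe roots is non-zero, so both factors in its determinant formula are.
  have hψ0 : ψ 0 ≠ 0 := fun h => hne (by rw [hX0, h]; ring)
  have hm0 : p.minor 0 (W 0) (Fin.last p.d) y ≠ 0 := fun h => hne (by rw [hX0, h, mul_zero])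
  refine ⟨hψ0, hm0, ?_⟩
  have h1 := hX M
  rw [hM M, ← mul_assoc, hX0] at h1
  rw [div_mul_div_comm, eq_div_iff (mul_ne_zero hψ0 hm0)]
  refine mul_left_cancel₀ hs ?_
  linear_combination h1
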